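/- Consider the quantised massless real scalar field, minimally coupled, on four-dimensional Minkowski space with metric signature $(+,-,-,-)$ and $\hbar=c=1$: the unital $*$-algebra $\mathcal{A}$ generated by $\Phi(f)$, $f\in C_0^\infty(\mathbb{R}^4)$, with $f\mapsto\Phi(f)$ complex-linear, $\Phi(f)^*=\Phi(\overline f)$, $\Phi(\Box f)=0$ and $[\Phi(f),\Phi(f')]=iE(f,f')\mathbf{1}$, where $E$ is the advanced-minus-retarded fundamental solution of $\Box$. A state $\omega$ (normalised positive linear functional on $\mathcal{A}$) is Hadamard if $$\omega(\Phi(f)\Phi(f'))=\lim_{\epsilon\to0^+}\iint \frac{f(x)f'(x')}{4\pi^2\bigl(-(t-t'-i\epsilon)^2+|\boldsymbol{x}-\boldsymbol{x}'|^2\bigr)}\,d^4x\,d^4x'+\iint W(x,x')f(x)f'(x')\,d^4x\,d^4x'$$ for some smooth function $W$ on $\mathbb{R}^4\times\mathbb{R}^4$ (the two-point function normal ordered with respect to the Minkowski vacuum), and then $$\langle{:}T_{ab}{:}\rangle_\omega(x)=\Bigl[\bigl(\partial_a\partial'_b-\tfrac12\eta_{ab}\eta^{cd}\partial_c\partial'_d\bigr)W\Bigr](x,x).$$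 Let $\xi_0>0$, $\alpha_0=1/\xi_0$, and let $\gamma(\tau)=(\xi_0\sinh(\tau/\xi_0),\xi_0\cosh(\tau/\xi_0),0,0)$ be the worldline of uniform proper acceleration $\alpha_0$, parametrised by proper time. Then for every Hadamard state $\omega$ and every real-valued $g\in C_0^\infty(\mathbb{R})$, the energy density $\dot\gamma^a\dot\gamma^b\langle{:}T_{ab}{:}\rangle_\omega(\gamma(\tau))$ is real for all $\tau$, $$\int |g(\tau)|^2\,\dot\gamma^a\dot\gamma^b\langle{:}T_{ab}{:}\rangle_\omega(\gamma(\tau))\,d\tau\ \ge\ -\frac{1}{16\pi^2}\int_{-\infty}^{\infty}\Bigl(|g''(\tau)|^2+2\alpha_0^2|g'(\tau)|^2+\frac{11\alpha_0^4}{30}|g(\tau)|^2\Bigr)d\tau ,$$ and $$\liminf_{T\to\infty}\int\Bigl(\dot\gamma^a\dot\gamma^b\langle{:}T_{ab}{:}\rangle_\omega(\gamma(t))+\frac{11\alpha_0^4}{480\pi^2}\Bigr)|g(t/T)|^2\,dt\ \ge\ 0 .$$ -/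

import Mathlib

open MeasureTheory Filter TopologicalSpace
open scoped Topology Distributions LineDeriv

noncomputable section

namespace ScalarQFT

/-! ### Minkowski space, test functions and the wave operator -/

/-- Four-dimensional Minkowski space in inertial coordinates `(t, x, y, z)`, with `c = 1`. Its
volume form is Lebesgue measure. -/
abbrev Spacetime : Type := Fin 4 → ℝ

/-- The Minkowski metric components `η_ab = diag(+1, -1, -1, -1)`; the inverse metric has the same
components. -/
def minkowskiMetric (a b : Fin 4) : ℝ :=
  if a = b then (if a = 0 then 1 else -1) else 0

/-- The coordinate vector `∂/∂x^a`. -/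
def coordVec (a : Fin 4) : Spacetime := Pi.single a 1

/-- `C_0^∞(M)`: smooth compactly supported complex-valued functions on Minkowski space. -/
abbrev TestFn : Type := 𝓓((⊤ : Opens Spacetime), ℂ)

/-- The pointwise complex conjugate of a test function. -/
def conjTestFn (f : TestFn) : TestFn :=
  TestFunction.postcompCLM (𝕜 := ℝ) (Complex.conjCLE : ℂ →L[ℝ] ℂ) f

@[simp] theorem conjTestFn_apply (f : TestFn) (x : Spacetime) :
    conjTestFn f x = star (f x) := rfl

@[simp] theorem conjTestFn_conjTestFn (f : TestFn) : conjTestFn (conjTestFn f) = f := by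
  ext x
  simp

/-- The massless Klein-Gordon operator `P = □ = η^{ab} ∂_a ∂_b` on test functions. -/
def waveOp (f : TestFn) : TestFn :=
  ∑ a, ∑ b, minkowskiMetric a b • ∂_{coordVec a} (∂_{coordVec b} f)

/-! ### The advanced-minus-retarded fundamental solution -/

/-- The retarded solution `E⁺ f` of `□ φ = f` (supported in `J⁺(supp f)`), given by the retarded
potential `(E⁺ f)(t, 𝐱) = ∫ f(t - |𝐲|, 𝐱 - 𝐲) / (4 π |𝐲|) d³𝐲`. -/
def retardedSolution (f : TestFn) (x : Spacetime) : ℂ :=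
  ∫ y : EuclideanSpace ℝ (Fin 3),
    f ![x 0 - ‖y‖, x 1 - y 0, x 2 - y 1, x 3 - y 2] / ((4 * Real.pi * ‖y‖ : ℝ) : ℂ)

/-- The advanced solution `E⁻ f` of `□ φ = f` (supported in `J⁻(supp f)`), given by the advanced
potential `(E⁻ f)(t, 𝐱) = ∫ f(t + |𝐲|, 𝐱 - 𝐲) / (4 π |𝐲|) d³𝐲`. -/
def advancedSolution (f : TestFn) (x : Spacetime) : ℂ :=
  ∫ y : EuclideanSpace ℝ (Fin 3),
    f ![x 0 + ‖y‖, x 1 - y 0, x 2 - y 1, x 3 - y 2] / ((4 * Real.pi * ‖y‖ : ℝ) : ℂ)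

/-- `E(f, f') = ∫ f (E f') dvol`, where `E = E⁻ - E⁺` is advanced-minus-retarded. -/
def commutatorFn (f f' : TestFn) : ℂ :=
  ∫ x, f x * (advancedSolution f' x - retardedSolution f' x)

/-! ### The free unital `*`-algebra on symbols `Φ(f)`

It consists of the complex linear combinations of words in the symbols `f ∈ C_0^∞(M)`; the
involution is antilinear, reverses words, and sends the symbol `f` to its complex conjugate. -/

/-- The free unital complex algebra on the set of test functions. -/
def FreeFieldAlgebra : Type := MonoidAlgebra ℂ (FreeMonoid TestFn)

instance : Ring FreeFieldAlgebra :=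
  inferInstanceAs (Ring (MonoidAlgebra ℂ (FreeMonoid TestFn)))

instance : Algebra ℂ FreeFieldAlgebra :=
  inferInstanceAs (Algebra ℂ (MonoidAlgebra ℂ (FreeMonoid TestFn)))

/-- Reverse a word and conjugate each of its letters. -/
def wordStar (w : FreeMonoid TestFn) : FreeMonoid TestFn :=
  FreeMonoid.map conjTestFn w.reverse

theorem wordStar_mul (v w : FreeMonoid TestFn) :
    wordStar (v * w) = wordStar w * wordStar v := by
  simp [wordStar, FreeMonoid.reverse_mul]

theorem wordStar_one : wordStar 1 = 1 := rfl

theorem wordStar_of (f : TestFn) :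
    wordStar (FreeMonoid.of f) = FreeMonoid.of (conjTestFn f) := rfl

theorem wordStar_wordStar (w : FreeMonoid TestFn) : wordStar (wordStar w) = w := by
  induction w using FreeMonoid.inductionOn' with
  | one => rfl
  | of_mul f w ih => rw [wordStar_mul, wordStar_mul, wordStar_of, wordStar_of, ih,
      conjTestFn_conjTestFn]

/-- The involution `∑ c_w w ↦ ∑ (conj c_w) w*`. -/
def freeStar (a : MonoidAlgebra ℂ (FreeMonoid TestFn)) : MonoidAlgebra ℂ (FreeMonoid TestFn) :=
  MonoidAlgebra.map (starRingEnd ℂ : ℂ →+ ℂ) (MonoidAlgebra.mapDomain wordStar a)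

theorem freeStar_single (w : FreeMonoid TestFn) (c : ℂ) :
    freeStar (MonoidAlgebra.single w c) = MonoidAlgebra.single (wordStar w) (star c) := by
  simp [freeStar]

theorem freeStar_add (a b : MonoidAlgebra ℂ (FreeMonoid TestFn)) :
    freeStar (a + b) = freeStar a + freeStar b := by
  simp [freeStar, MonoidAlgebra.mapDomain_add, MonoidAlgebra.map_add]

theorem freeStar_zero : freeStar 0 = 0 := by
  simp [freeStar]

theorem freeStar_freeStar (a : MonoidAlgebra ℂ (FreeMonoid TestFn)) :
    freeStar (freeStar a) = a := by
  induction a using MonoidAlgebra.induction_linear with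
  | zero => simp [freeStar_zero]
  | add a b ha hb => rw [freeStar_add, freeStar_add, ha, hb]
  | single w c => rw [freeStar_single, freeStar_single, wordStar_wordStar, star_star]

theorem freeStar_mul (a b : MonoidAlgebra ℂ (FreeMonoid TestFn)) :
    freeStar (a * b) = freeStar b * freeStar a := by
  induction a using MonoidAlgebra.induction_linear with
  | zero => simp [freeStar_zero]
  | add a a' ha ha' => rw [add_mul, freeStar_add, freeStar_add, ha, ha', mul_add]
  | single v c =>
    induction b using MonoidAlgebra.induction_linear with
    | zero => simp [freeStar_zero]
    | add b b' hb hb' => rw [mul_add, freeStar_add, freeStar_add, hb, hb', add_mul]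
    | single w d =>
      rw [MonoidAlgebra.single_mul_single, freeStar_single, freeStar_single, freeStar_single,
        MonoidAlgebra.single_mul_single, wordStar_mul, star_mul]

instance : StarRing FreeFieldAlgebra where
  star := freeStar
  star_involutive := freeStar_freeStar
  star_mul := freeStar_mul
  star_add := freeStar_add

/-- The generator attached to a test function. -/
def freeField (f : TestFn) : FreeFieldAlgebra :=
  MonoidAlgebra.single (FreeMonoid.of f) (1 : ℂ)

theorem star_freeField (f : TestFn) : star (freeField f) = freeField (conjTestFn f) := by
  change freeStar _ = _
  rw [freeField, freeStar_single, wordStar_of, star_one, freeField]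

/-! ### The field algebra `𝒜(M)` -/

/-- The defining relations of the massless real scalar field: complex linearity of `f ↦ Φ(f)`,
the field equation `Φ(P f) = 0`, the commutation relations `[Φ(f), Φ(f')] = i E(f, f') 1`, and,
so that the quotient is the `*`-algebra with these relations, their adjoints. The relation
`Φ(f)* = Φ(conj f)` already holds in the free `*`-algebra. -/
inductive FieldRel : FreeFieldAlgebra → FreeFieldAlgebra → Prop
  | add (f f' : TestFn) : FieldRel (freeField (f + f')) (freeField f + freeField f')
  | smul (c : ℂ) (f : TestFn) : FieldRel (freeField (c • f)) (c • freeField f)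
  | eqn (f : TestFn) : FieldRel (freeField (waveOp f)) 0
  | comm (f f' : TestFn) :
      FieldRel (freeField f * freeField f' - freeField f' * freeField f)
        (algebraMap ℂ FreeFieldAlgebra (Complex.I * commutatorFn f f'))
  | adjoint {a b : FreeFieldAlgebra} : FieldRel a b → FieldRel (star a) (star b)

/-- The unital `*`-algebra `𝒜(M)` of the massless real scalar field on Minkowski space. -/
def FieldAlgebra : Type := RingQuot FieldRel

instance : Ring FieldAlgebra := inferInstanceAs (Ring (RingQuot FieldRel))

instance : Algebra ℂ FieldAlgebra := inferInstanceAs (Algebra ℂ (RingQuot FieldRel))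

/-- The quotient map from the free algebra. -/
def toFieldAlgebra : FreeFieldAlgebra →ₐ[ℂ] FieldAlgebra := RingQuot.mkAlgHom ℂ FieldRel

theorem toFieldAlgebra_surjective : Function.Surjective toFieldAlgebra :=
  RingQuot.mkAlgHom_surjective ℂ FieldRel

theorem toFieldAlgebra_rel {a b : FreeFieldAlgebra} (h : FieldRel a b) :
    toFieldAlgebra a = toFieldAlgebra b :=
  RingQuot.mkAlgHom_rel ℂ h

/-- The involution of the free algebra, followed by the quotient map, as a ring homomorphism into
the opposite ring. -/
def starToOpposite : FreeFieldAlgebra →+* FieldAlgebraᵐᵒᵖ :=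
  (RingHom.op toFieldAlgebra.toRingHom).comp (starRingEquiv : FreeFieldAlgebra ≃+* _).toRingHom

theorem starToOpposite_apply (a : FreeFieldAlgebra) :
    starToOpposite a = MulOpposite.op (toFieldAlgebra (star a)) := rfl

/-- The involution of the field algebra, induced from that of the free algebra. -/
def fieldStar (a : FieldAlgebra) : FieldAlgebra :=
  MulOpposite.unop (RingQuot.lift (r := FieldRel)
    ⟨starToOpposite, fun _ _ h => congrArg MulOpposite.op (toFieldAlgebra_rel h.adjoint)⟩ a)

theorem fieldStar_toFieldAlgebra (a : FreeFieldAlgebra) :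
    fieldStar (toFieldAlgebra a) = toFieldAlgebra (star a) := by
  have h : toFieldAlgebra a = RingQuot.mkRingHom FieldRel a := by
    rw [← RingQuot.mkAlgHom_coe ℂ FieldRel]
    rfl
  rw [fieldStar, h]
  erw [RingQuot.lift_mkRingHom_apply]
  rfl

instance : StarRing FieldAlgebra where
  star := fieldStar
  star_involutive x := by
    obtain ⟨a, rfl⟩ := toFieldAlgebra_surjective x
    rw [fieldStar_toFieldAlgebra, fieldStar_toFieldAlgebra, star_star]
  star_mul x y := by
    obtain ⟨a, rfl⟩ := toFieldAlgebra_surjective x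
    obtain ⟨b, rfl⟩ := toFieldAlgebra_surjective y
    rw [← map_mul, fieldStar_toFieldAlgebra, fieldStar_toFieldAlgebra, fieldStar_toFieldAlgebra,
      star_mul, map_mul]
  star_add x y := by
    obtain ⟨a, rfl⟩ := toFieldAlgebra_surjective x
    obtain ⟨b, rfl⟩ := toFieldAlgebra_surjective y
    rw [← map_add, fieldStar_toFieldAlgebra, fieldStar_toFieldAlgebra, fieldStar_toFieldAlgebra,
      star_add, map_add]

/-- The smeared quantum field `Φ(f)`. -/
def field (f : TestFn) : FieldAlgebra := toFieldAlgebra (freeField f)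

theorem star_field (f : TestFn) : star (field f) = field (conjTestFn f) := by
  change fieldStar _ = _
  rw [field, fieldStar_toFieldAlgebra, star_freeField, field]

theorem field_waveOp (f : TestFn) : field (waveOp f) = 0 := by
  rw [field, toFieldAlgebra_rel (FieldRel.eqn f), map_zero]

theorem field_commutator (f f' : TestFn) :
    field f * field f' - field f' * field f =
      algebraMap ℂ FieldAlgebra (Complex.I * commutatorFn f f') := by
  rw [field, field, ← map_mul, ← map_mul, ← map_sub, toFieldAlgebra_rel (FieldRel.comm f f'),
    AlgHom.commutes]

/-! ### States, Hadamard states and normal ordering -/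

/-- A state on the field algebra: a normalised positive linear functional. -/
structure State where
  /-- The expectation value functional. -/
  expect : FieldAlgebra →ₗ[ℂ] ℂ
  expect_one : expect 1 = 1
  nonneg (A : FieldAlgebra) : 0 ≤ (expect (star A * A)).re ∧ (expect (star A * A)).im = 0

/-- The two-point function `ω₂(f, f') = ω(Φ(f) Φ(f'))`. -/
def State.twoPoint (ω : State) (f f' : TestFn) : ℂ := ω.expect (field f * field f')

/-- The regularised massless vacuum two-point function `1 / (4 π² σ_ε(x, x'))`, where
`σ_ε(x, x') = -(t - t' - i ε)² + |𝐱 - 𝐱'|²`. -/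
def vacuumKernel (ε : ℝ) (x x' : Spacetime) : ℂ :=
  1 / (4 * (Real.pi : ℂ) ^ 2 *
    (-((x 0 - x' 0 : ℝ) - Complex.I * ε) ^ 2 +
      ((x 1 - x' 1) ^ 2 + (x 2 - x' 2) ^ 2 + (x 3 - x' 3) ^ 2 : ℝ)))

/-- `W` is a smooth function on `M × M` with `ω₂ = 1 / (4 π² σ₊) + W` as bidistributions, where
`1 / (4 π² σ₊) = lim_{ε → 0+} 1 / (4 π² σ_ε)` is the Minkowski vacuum two-point function. -/
def State.IsSmoothRemainder (ω : State) (W : Spacetime × Spacetime → ℂ) : Prop :=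
  ContDiff ℝ (⊤ : ℕ∞) W ∧
    ∀ f f' : TestFn,
      Tendsto (fun ε : ℝ => ∫ x, ∫ x', f x * f' x' * vacuumKernel ε x x') (𝓝[>] 0)
        (𝓝 (ω.twoPoint f f' - ∫ x, ∫ x', f x * f' x' * W (x, x')))

/-- Hadamard states: the two-point function has the Hadamard form
`U / (4 π² σ₊) + V log (σ₊ / ℓ²) + W` with `W` smooth. For the massless field on Minkowski space
the geometrically determined coefficients are `U = 1` and `V = 0`, and the whole of Minkowski
space is a causally convex normal neighbourhood. -/
def State.IsHadamard (ω : State) : Prop := ∃ W, ω.IsSmoothRemainder W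

/-- The normal ordered two-point function `:ω₂:(x, x') = ω₂(x, x') - ω₂^vac(x, x')` of a Hadamard
state, a smooth function, uniquely determined as such by its integrals against products of test
functions. Normal ordering is relative to the Minkowski vacuum. -/
def State.normalOrdered (ω : State) (hω : ω.IsHadamard) : Spacetime × Spacetime → ℂ :=
  Classical.choose hω

/-- `(∂_a ⊗ ∂_b') F` at the coincidence point `(x, x)`. -/
def mixedDeriv (F : Spacetime × Spacetime → ℂ) (a b : Fin 4) (x : Spacetime) : ℂ :=
  fderiv ℝ (fun p : Spacetime × Spacetime => fderiv ℝ F p (0, coordVec b)) (x, x) (coordVec a, 0)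

/-- The expectation value `⟨:T_ab:⟩_ω(x)` of the normal ordered stress-energy tensor of the
minimally coupled massless field, obtained by point splitting from the classical expression
`T_ab = ∂_a φ ∂_b φ - ½ η_ab η^{cd} ∂_c φ ∂_d φ`. -/
def State.stressEnergy (ω : State) (hω : ω.IsHadamard) (a b : Fin 4) (x : Spacetime) : ℂ :=
  mixedDeriv (ω.normalOrdered hω) a b x -
    (1 / 2) * minkowskiMetric a b *
      ∑ c, ∑ d, minkowskiMetric c d * mixedDeriv (ω.normalOrdered hω) c d x

/-! ### Uniformly accelerated motion -/

/-- The worldline `γ(τ) = (ξ₀ sinh(τ/ξ₀), ξ₀ cosh(τ/ξ₀), 0, 0)`, parametrised by proper time, of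
uniform proper acceleration `1/ξ₀`. -/
def acceleratedWorldline (ξ₀ : ℝ) (τ : ℝ) : Spacetime :=
  ![ξ₀ * Real.sinh (τ / ξ₀), ξ₀ * Real.cosh (τ / ξ₀), 0, 0]

/-- The energy density `γ̇^a γ̇^b ⟨:T_ab:⟩_ω(γ(τ))` along a worldline `γ`. -/
def State.energyDensity (ω : State) (hω : ω.IsHadamard) (γ : ℝ → Spacetime) (τ : ℝ) : ℂ :=
  ∑ a, ∑ b, ((deriv γ τ a * deriv γ τ b : ℝ) : ℂ) * ω.stressEnergy hω a b (γ τ)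

end ScalarQFT

end

open MeasureTheory Filter TopologicalSpace
open scoped Topology Distributions LineDeriv

noncomputable section

namespace ScalarQFT

/-! ### Consequences of positivity and the commutation relations -/

section

/-! The inequality expresses positivity of the state. From `ω(Φ(f)* Φ(f)) ≥ 0` and the Hadamard
form, the pairing of `W` with `conj f ⊗ f` is at least minus the vacuum two-point function of `conj
f` and `f`. In Fourier space the latter is `(1/16π³) ∫ d³k/|k|` of the squared modulus of the
on-shell transform of `f`. Let `f` concentrate on a curve, differentiated along a vector field `e`
and weighted by `c`. Then `W` is replaced by its mixed derivative restricted to the curve, and the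
lower bound depends only on the plane waves along the curve (`exists_bump_norm_sub_le`,
`ofReal_neg_restriction_le`).

Since the four-velocity is a unit timelike vector, the energy density is half the sum over an
orthonormal frame `e_j` of the mixed derivatives `(e_j ⊗ e_j) W`. In the rapidity `u = τ/ξ`, take
`c(u) = g(u) e^{iαu}` and sum over the frame. Because `W` is real (`im_eq_zero`), the weights leave
`cos(α(u - u'))`. Its integral over `α > 0` is `π δ(u - u')`, obtained rigorously by Abel summation
and the Poisson kernel, so the left side becomes the energy density averaged with `g²`. Only
positive frequencies enter, and this is what keeps the vacuum side finite
(`ofReal_neg_integral_rindlerForm_le`).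

To evaluate the vacuum side, write the momentum in terms of its transverse length `κ` and its
rapidity `θ`; boost covariance leaves only `u - θ`. Evaluate the exponentials at `u + iη`. For `0 <
η < π` all integrals then converge absolutely, and Fubini gives the pairing of `g ⊗ g` with `(3/2) /
(ξ⁴ A sin⁴(A/2))`, where `A = 2η + i(u - u')` (`lintegral_modeDensity`). Its Laurent expansion
begins `24/A⁵ + 4/A³ + (11/30)/A`. Integrating by parts moves the extra powers onto `g`, leaving
`g''`, `g'` and `g` paired with `1/A`, `2/A` and `(11/30)/A`. As `η → 0`, `Re 1/A` tends to `π δ`,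
whereas the remainder is continuous and purely imaginary on the imaginary axis, so its real
contribution vanishes. Fatou's lemma carries the bound to `η = 0`; only that direction is needed.
Rescaling by `ξ` restores proper time.

For the long-time statement, insert `g(t/T)`: the terms in `g'` and `g''` scale as `T⁻¹` and `T⁻³`,
and the term in `g²` is exactly the constant added to the energy density. -/

theorem field_add (f f' : TestFn) : field (f + f') = field f + field f' := by
  rw [field, toFieldAlgebra_rel (FieldRel.add f f'), map_add, field, field]

namespace State

variable (ω : State)

theorem twoPoint_add_left (f g h : TestFn) :
    ω.twoPoint (f + g) h = ω.twoPoint f h + ω.twoPoint g h := by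
  simp only [twoPoint, field_add, add_mul, map_add]

theorem twoPoint_add_right (f g h : TestFn) :
    ω.twoPoint f (g + h) = ω.twoPoint f g + ω.twoPoint f h := by
  simp only [twoPoint, field_add, mul_add, map_add]

theorem twoPoint_conj_self (f : TestFn) :
    0 ≤ (ω.twoPoint (conjTestFn f) f).re ∧ (ω.twoPoint (conjTestFn f) f).im = 0 := by
  simpa [twoPoint, star_field] using ω.nonneg (field f)

theorem twoPoint_comm_of_commutatorFn_eq_zero {f f' : TestFn} (h : commutatorFn f f' = 0) :
    ω.twoPoint f f' = ω.twoPoint f' f := by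
  have := field_commutator f f'
  rw [h, mul_zero, map_zero, sub_eq_zero] at this
  rw [twoPoint, twoPoint, this]

theorem conjTestFn_add (f g : TestFn) : conjTestFn (f + g) = conjTestFn f + conjTestFn g := by
  ext x
  simp [conjTestFn_apply]

/-- Commuting real smeared fields have real correlations. -/
theorem twoPoint_im_eq_zero {f f' : TestFn} (hf : conjTestFn f = f) (hf' : conjTestFn f' = f')
    (h : commutatorFn f f' = 0) : (ω.twoPoint f f').im = 0 := by
  have h1 := (ω.twoPoint_conj_self f).2
  have h2 := (ω.twoPoint_conj_self f').2
  have h3 := (ω.twoPoint_conj_self (f + f')).2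
  rw [conjTestFn_add] at h3
  rw [hf] at h1 h3
  rw [hf'] at h2 h3
  rw [twoPoint_add_left, twoPoint_add_right, twoPoint_add_right,
    ← ω.twoPoint_comm_of_commutatorFn_eq_zero h] at h3
  simp only [Complex.add_im] at h3
  linarith

end State

end

/-! ### Fourier representation of the massless vacuum kernel -/

section

theorem integrableOn_pow_mul_exp_neg_mul {c : ℝ} (hc : 0 < c) (n : ℕ) :
    IntegrableOn (fun t : ℝ => t ^ n * Real.exp (-(c * t))) (Set.Ioi 0) := by
  have h := integrableOn_rpow_mul_exp_neg_mul_rpow (p := 1) (s := n) (b := c)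
    (by have : (0 : ℝ) ≤ n := n.cast_nonneg
        linarith) one_pos hc
  refine h.congr_fun (fun t _ => ?_) measurableSet_Ioi
  simp [neg_mul]

/-- The energy `|k|` of a momentum `k = (k₁, k₂ + i k₃)`. -/
def energy (k : ℝ × ℂ) : ℝ := √(k.1 ^ 2 + ‖k.2‖ ^ 2)

theorem energy_nonneg (k : ℝ × ℂ) : 0 ≤ energy k := Real.sqrt_nonneg _

@[fun_prop]
theorem continuous_energy : Continuous energy := by
  unfold energy
  fun_prop

/-- The product `ℝ × ℂ` carries the sup norm. In `WithLp 2`, with the same volume, `energy` is the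
Euclidean norm, so radial integration and orthogonal symmetries become available. -/
theorem energy_eq_norm_toLp (k : ℝ × ℂ) : energy k = ‖WithLp.toLp 2 k‖ := by
  rw [WithLp.prod_norm_eq_of_L2, energy]
  simp

theorem finrank_withLp_real_prod_complex : Module.finrank ℝ (WithLp 2 (ℝ × ℂ)) = 3 := by
  rw [(WithLp.linearEquiv 2 ℝ (ℝ × ℂ)).finrank_eq, Module.finrank_prod, Complex.finrank_real_complex,
    Module.finrank_self]

theorem integrable_exp_neg_energy_div {c : ℝ} (hc : 0 < c) :
    Integrable (fun k : ℝ × ℂ => Real.exp (-(c * energy k)) / energy k) := by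
  have h : Integrable (fun p : WithLp 2 (ℝ × ℂ) => Real.exp (-(c * ‖p‖)) / ‖p‖) := by
    rw [integrable_fun_norm_addHaar (μ := volume) (f := fun r => Real.exp (-(c * r)) / r),
      finrank_withLp_real_prod_complex]
    refine (integrableOn_pow_mul_exp_neg_mul hc 1).congr_fun (fun t ht => ?_) measurableSet_Ioi
    have : t ≠ 0 := (Set.mem_Ioi.1 ht).ne'
    simp only [smul_eq_mul]
    field_simp
  have h2 := (WithLp.volume_preserving_toLp ℝ ℂ).integrable_comp_of_integrable h
  refine h2.congr (Eventually.of_forall fun k => ?_)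
  simp [energy_eq_norm_toLp]

theorem norm_exp_neg_mul_energy_div (a : ℂ) (k : ℝ × ℂ) :
    ‖Complex.exp (-(a * energy k)) / energy k‖ = Real.exp (-(a.re * energy k)) / energy k := by
  rw [norm_div, Complex.norm_exp, Complex.norm_real, Real.norm_of_nonneg (energy_nonneg k)]
  simp

theorem integrable_cexp_neg_energy_div {a : ℂ} (ha : 0 < a.re) :
    Integrable (fun k : ℝ × ℂ => Complex.exp (-(a * energy k)) / energy k) := by
  refine (integrable_exp_neg_energy_div ha).mono' ?_ ?_
  · refine Measurable.aestronglyMeasurable ?_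
    have := continuous_energy.measurable
    fun_prop
  · exact Eventually.of_forall fun k => (norm_exp_neg_mul_energy_div a k).le

/-- The integral of `e^{-a|k|} / |k|` over the transverse momenta. -/
theorem integral_transverse {a : ℂ} (ha : 0 < a.re) (k : ℝ) :
    ∫ q : ℂ, Complex.exp (-(a * energy (k, q))) / energy (k, q) =
      2 * Real.pi * Complex.exp (-(a * |k|)) / a := by
  have ha0 : a ≠ 0 := by
    rintro rfl
    simp at ha
  have h1 := integral_fun_norm_addHaar (μ := (volume : Measure ℂ))
    (f := fun ρ => Complex.exp (-(a * (√(k ^ 2 + ρ ^ 2) : ℝ))) / (√(k ^ 2 + ρ ^ 2) : ℝ))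
  simp only [energy]
  rw [h1, Complex.finrank_real_complex, Measure.real, Complex.volume_ball]
  have hpos : ∀ ρ ∈ Set.Ioi (0 : ℝ), 0 < k ^ 2 + ρ ^ 2 := fun ρ hρ => by
    have : 0 < ρ := hρ
    positivity
  -- The polar Jacobian `ρ` makes the radial integrand an exact derivative.
  have hd : ∀ ρ ∈ Set.Ioi (0 : ℝ), HasDerivAt
      (fun ρ : ℝ => -(Complex.exp (-(a * (√(k ^ 2 + ρ ^ 2) : ℝ))) / a))
      (ρ ^ (2 - 1) • (Complex.exp (-(a * (√(k ^ 2 + ρ ^ 2) : ℝ))) / (√(k ^ 2 + ρ ^ 2) : ℝ))) ρ := by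
    intro ρ hρ
    have h2 : HasDerivAt (fun ρ : ℝ => √(k ^ 2 + ρ ^ 2)) (ρ / √(k ^ 2 + ρ ^ 2)) ρ := by
      have := (((hasDerivAt_pow 2 ρ).const_add (k ^ 2)).sqrt (hpos ρ hρ).ne')
      convert this using 1
      simp
      field_simp
    have h3 := ((((h2.ofReal_comp).const_mul a).neg.cexp).div_const a).neg
    refine h3.congr_deriv ?_
    have : (√(k ^ 2 + ρ ^ 2) : ℂ) ≠ 0 := by
      exact_mod_cast (Real.sqrt_pos.2 (hpos ρ hρ)).ne'
    simp only [Complex.real_smul]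
    push_cast
    field_simp
    rw [Pi.neg_apply]
    ring
  have hlim : Tendsto (fun ρ : ℝ => -(Complex.exp (-(a * (√(k ^ 2 + ρ ^ 2) : ℝ))) / a)) atTop
      (𝓝 (-(0 / a))) := by
    refine (Tendsto.div_const ?_ a).neg
    rw [Complex.tendsto_exp_nhds_zero_iff]
    have : Tendsto (fun ρ : ℝ => √(k ^ 2 + ρ ^ 2)) atTop atTop :=
      Real.tendsto_sqrt_atTop.comp (tendsto_atTop_add_const_left _ _ (tendsto_pow_atTop two_ne_zero))
    simpa using this.const_mul_atTop ha
  have hint : IntegrableOn (fun ρ : ℝ => ρ ^ (2 - 1) •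
      (Complex.exp (-(a * (√(k ^ 2 + ρ ^ 2) : ℝ))) / (√(k ^ 2 + ρ ^ 2) : ℝ))) (Set.Ioi 0) := by
    have hb := integrableOn_pow_mul_exp_neg_mul ha 0
    refine hb.mono' ?_ ?_
    · refine Measurable.aestronglyMeasurable ?_
      fun_prop
    · refine (ae_restrict_mem measurableSet_Ioi).mono fun ρ hρ => ?_
      -- This inequality serves twice: it bounds the exponential by `e^{-Re(a) ρ}` and the quotient
      -- `ρ / √(k² + ρ²)` by one.
      have hs : ρ ≤ √(k ^ 2 + ρ ^ 2) := Real.le_sqrt_of_sq_le (by nlinarith [sq_nonneg k])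
      have hρ' : 0 < ρ := hρ
      rw [norm_smul, norm_div, Complex.norm_exp, Complex.norm_real,
        Real.norm_of_nonneg (Real.sqrt_nonneg _)]
      have he : Real.exp (-(a * (√(k ^ 2 + ρ ^ 2) : ℝ))).re ≤ Real.exp (-(a.re * ρ)) := by
        refine Real.exp_le_exp.2 ?_
        simp only [Complex.neg_re, Complex.re_mul_ofReal, neg_le_neg_iff]
        exact mul_le_mul_of_nonneg_left hs ha.le
      have : ‖ρ ^ (2 - 1)‖ = ρ := by simp [abs_of_pos hρ']
      rw [this, pow_zero, one_mul, mul_div_assoc', div_le_iff₀ (Real.sqrt_pos.2 (hpos ρ hρ)), mul_comm]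
      gcongr
  rw [integral_Ioi_of_hasDerivAt_of_tendsto (by fun_prop) hd hint hlim]
  simp [Real.sqrt_sq_eq_abs]
  ring

theorem integral_cexp_mul_cexp_neg_abs {a : ℂ} (ha : 0 < a.re) (r : ℝ) :
    ∫ k : ℝ, Complex.exp (Complex.I * (k * r)) * Complex.exp (-(a * |k|)) =
      2 * a / (a ^ 2 + r ^ 2) := by
  have e1 : ∀ k ∈ Set.Ioi (0 : ℝ), Complex.exp (Complex.I * (k * r)) * Complex.exp (-(a * |k|)) =
      Complex.exp ((Complex.I * r - a) * k) := fun k hk => by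
    rw [abs_of_pos hk, ← Complex.exp_add]
    ring_nf
  have e2 : ∀ k ∈ Set.Iic (0 : ℝ), Complex.exp (Complex.I * (k * r)) * Complex.exp (-(a * |k|)) =
      Complex.exp ((Complex.I * r + a) * k) := fun k hk => by
    rw [abs_of_nonpos hk, ← Complex.exp_add]
    push_cast
    ring_nf
  have h1 : (Complex.I * r - a).re < 0 := by simpa using ha
  have h2 : 0 < (Complex.I * r + a).re := by simpa using ha
  have n1 : (Complex.I * r - a) ≠ 0 := fun h => by simp [h] at h1
  have n2 : (Complex.I * r + a) ≠ 0 := fun h => by simp [h] at h2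
  have n3 : a ^ 2 + r ^ 2 ≠ 0 := by
    have : a ^ 2 + r ^ 2 = -(Complex.I * r - a) * (Complex.I * r + a) := by
      ring_nf
      simp
    rw [this]
    exact mul_ne_zero (neg_ne_zero.2 n1) n2
  rw [← setIntegral_univ, ← Set.Iic_union_Ioi (a := (0 : ℝ)),
    setIntegral_union (Set.Iic_disjoint_Ioi le_rfl) measurableSet_Ioi,
    setIntegral_congr_fun measurableSet_Ioi e1, setIntegral_congr_fun measurableSet_Iic e2,
    integral_exp_mul_complex_Ioi h1, integral_exp_mul_complex_Iic h2]
  · simp only [Complex.ofReal_zero, mul_zero, Complex.exp_zero]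
    field_simp
    ring_nf
    simp
  · exact (integrableOn_exp_mul_complex_Iic h2 0).congr_fun (fun k hk => (e2 k hk).symm)
      measurableSet_Iic
  · exact (integrableOn_exp_mul_complex_Ioi h1 0).congr_fun (fun k hk => (e1 k hk).symm)
      measurableSet_Ioi

theorem integral_cexp_neg_energy_axis {a : ℂ} (ha : 0 < a.re) (r : ℝ) :
    ∫ k : ℝ × ℂ, Complex.exp (-(a * energy k)) / energy k * Complex.exp (Complex.I * (k.1 * r : ℝ)) =
      4 * Real.pi / (a ^ 2 + r ^ 2) := by
  have ha0 : a ≠ 0 := by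
    rintro rfl
    simp at ha
  have hint : Integrable (fun k : ℝ × ℂ => Complex.exp (-(a * energy k)) / energy k *
      Complex.exp (Complex.I * (k.1 * r : ℝ))) := by
    refine (integrable_cexp_neg_energy_div ha).mul_bdd (c := 1) ?_ ?_
    · exact Continuous.aestronglyMeasurable (by fun_prop)
    · exact Eventually.of_forall fun k => by
        rw [Complex.norm_exp_I_mul_ofReal]
  rw [Measure.volume_eq_prod, integral_prod _ (by rwa [← Measure.volume_eq_prod])]
  simp only [integral_mul_const, integral_transverse ha]
  have := integral_cexp_mul_cexp_neg_abs ha r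
  calc _ = ∫ k : ℝ, (2 * Real.pi / a) * (Complex.exp (Complex.I * (k * r)) *
        Complex.exp (-(a * |k|))) := by
        refine integral_congr_ae (Eventually.of_forall fun k => ?_)
        simp only
        push_cast
        ring
    _ = _ := by
        rw [integral_const_mul, this]
        field_simp
        ring

/-- The Fourier representation `∫ d³k e^{-a|k| + i k·x} / |k| = 4π / (a² + |x|²)`. -/
theorem integral_cexp_neg_energy {a : ℂ} (ha : 0 < a.re) (x : ℝ × ℂ) :
    ∫ k : ℝ × ℂ, Complex.exp (-(a * energy k)) / energy k *
      Complex.exp (Complex.I * (k.1 * x.1 + k.2.re * x.2.re + k.2.im * x.2.im : ℝ)) =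
      4 * Real.pi / (a ^ 2 + (x.1 ^ 2 + ‖x.2‖ ^ 2 : ℝ)) := by
  set r : ℝ := energy x with hr
  set X : WithLp 2 (ℝ × ℂ) := WithLp.toLp 2 x
  set Y : WithLp 2 (ℝ × ℂ) := WithLp.toLp 2 ((r, 0) : ℝ × ℂ)
  have hXY : ‖X‖ = ‖Y‖ := by
    rw [← energy_eq_norm_toLp, ← energy_eq_norm_toLp, ← hr]
    simp [energy, r]
  -- Reflection in the hyperplane bisecting the equally long vectors `X` and `Y` carries one to the
  -- other, so a general position reduces to one on the first axis.
  set R := (Submodule.span ℝ {X - Y})ᗮ.reflection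
  have hR : R X = Y := Submodule.reflection_sub hXY
  let H : WithLp 2 (ℝ × ℂ) → WithLp 2 (ℝ × ℂ) → ℂ := fun Z p =>
    Complex.exp (-(a * ‖p‖)) / ‖p‖ * Complex.exp (Complex.I * (inner ℝ Z p : ℝ))
  have hH : ∀ z : ℝ × ℂ, ∫ k : ℝ × ℂ, Complex.exp (-(a * energy k)) / energy k *
      Complex.exp (Complex.I * (k.1 * z.1 + k.2.re * z.2.re + k.2.im * z.2.im : ℝ)) =
      ∫ p, H (WithLp.toLp 2 z) p := by
    intro z
    rw [← (WithLp.volume_preserving_toLp ℝ ℂ).integral_comp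
      (MeasurableEquiv.toLp 2 (ℝ × ℂ)).measurableEmbedding]
    refine integral_congr_ae (Eventually.of_forall fun k => ?_)
    have : inner ℝ (WithLp.toLp 2 z) (WithLp.toLp 2 k) =
        k.1 * z.1 + k.2.re * z.2.re + k.2.im * z.2.im := by
      simp only [WithLp.prod_inner_apply, Complex.inner, RCLike.inner_apply]
      simp
      ring
    simp only [H, energy_eq_norm_toLp, this]
  rw [hH x]
  have h2 : ∫ p, H X p = ∫ p, H Y p := by
    rw [← R.measurePreserving.integral_comp R.toMeasurableEquiv.measurableEmbedding (H Y)]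
    refine integral_congr_ae (Eventually.of_forall fun p => ?_)
    simp only [H, LinearIsometryEquiv.norm_map]
    rw [← hR, R.inner_map_map]
  change ∫ p, H X p = _
  rw [h2, ← hH (r, 0)]
  have := integral_cexp_neg_energy_axis ha r
  simp only [Complex.zero_re, Complex.zero_im, mul_zero, add_zero]
  rw [this, hr, ← Complex.ofReal_pow, energy, Real.sq_sqrt (by positivity)]

end

section

/-! ### The vacuum kernel -/

theorem sq_add_ne_zero {a : ℂ} (ha : 0 < a.re) {s : ℝ} (hs : 0 ≤ s) : a ^ 2 + s ≠ 0 := by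
  have h : a ^ 2 + s = (a + Complex.I * √s) * (a - Complex.I * √s) := by
    have : ((√s : ℝ) : ℂ) ^ 2 = s := by rw [← Complex.ofReal_pow, Real.sq_sqrt hs]
    linear_combination (-1 : ℂ) * this + (√s : ℂ) ^ 2 * Complex.I_sq
  rw [h]
  refine mul_ne_zero (fun h0 => ?_) (fun h0 => ?_) <;>
  · have := congrArg Complex.re h0
    simp at this
    exact ha.ne' this

/-- The squared spatial distance. -/
def spatialSq (x x' : Spacetime) : ℝ :=
  (x 1 - x' 1) ^ 2 + (x 2 - x' 2) ^ 2 + (x 3 - x' 3) ^ 2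

theorem spatialSq_nonneg (x x' : Spacetime) : 0 ≤ spatialSq x x' := by
  unfold spatialSq
  positivity

@[fun_prop]
theorem continuous_spatialSq : Continuous fun p : Spacetime × Spacetime => spatialSq p.1 p.2 := by
  unfold spatialSq
  fun_prop

/-- With `a = ε + i(t - t')`, of positive real part for `ε > 0`, the denominator takes the form `a²
+ |x|²` of `integral_cexp_neg_energy`. -/
theorem vacuumKernel_eq (ε : ℝ) (x x' : Spacetime) :
    vacuumKernel ε x x' = 1 / (4 * (Real.pi : ℂ) ^ 2 *
      ((ε + Complex.I * (x 0 - x' 0 : ℝ)) ^ 2 + (spatialSq x x' : ℝ))) := by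
  rw [vacuumKernel, spatialSq]
  congr 3
  linear_combination (-((x 0 - x' 0 : ℝ) ^ 2 + ε ^ 2) : ℂ) * Complex.I_sq

theorem vacuumKernel_den_ne_zero {ε : ℝ} (hε : 0 < ε) (x x' : Spacetime) :
    ((ε : ℂ) + Complex.I * (x 0 - x' 0 : ℝ)) ^ 2 + (spatialSq x x' : ℝ) ≠ 0 :=
  sq_add_ne_zero (by simpa) (spatialSq_nonneg x x')

theorem continuous_vacuumKernel {ε : ℝ} (hε : 0 < ε) :
    Continuous fun p : Spacetime × Spacetime => vacuumKernel ε p.1 p.2 := by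
  simp only [vacuumKernel_eq]
  refine Continuous.div (by fun_prop) (by fun_prop) fun p => ?_
  have := vacuumKernel_den_ne_zero hε p.1 p.2
  have hpi : (Real.pi : ℂ) ≠ 0 := by exact_mod_cast Real.pi_ne_zero
  exact mul_ne_zero (by simp) this

/-- The separation squared `-(t - t')² + |𝐱 - 𝐱'|²`. -/
def separation (x x' : Spacetime) : ℝ := -(x 0 - x' 0) ^ 2 + spatialSq x x'

@[fun_prop]
theorem continuous_separation :
    Continuous fun p : Spacetime × Spacetime => separation p.1 p.2 := by
  unfold separation
  fun_prop

/-- The vacuum kernel becomes real off the light cone. Its denominator is, up to `4π²`, `A + 2iε(t -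
t')` with `A` the separation plus `ε²`; the conditions on `c` keep `|A| ≥ c`, so the imaginary part
is of order `ε`. -/
theorem abs_im_vacuumKernel_le {ε c M : ℝ} {x x' : Spacetime} (hε : 0 < ε) (hc : 0 < c)
    (h1 : 2 * c ≤ |separation x x'|) (h2 : |x 0 - x' 0| ≤ M) (h3 : ε ^ 2 ≤ c) :
    |(vacuumKernel ε x x').im| ≤ ε * M / c ^ 2 := by
  set u := x 0 - x' 0
  set A : ℝ := separation x x' + ε ^ 2
  have hA : c ≤ |A| := by
    have : |separation x x'| ≤ |A| + |ε ^ 2| := by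
      have := abs_sub A (ε ^ 2)
      simpa [A] using this
    rw [abs_of_nonneg (sq_nonneg ε)] at this
    linarith
  have hA2 : c ^ 2 ≤ A ^ 2 := by
    rw [← sq_abs A]
    gcongr
  have hv : vacuumKernel ε x x' = ((1 / (4 * Real.pi ^ 2) : ℝ) : ℂ) * (⟨A, 2 * ε * u⟩ : ℂ)⁻¹ := by
    have : ((ε : ℂ) + Complex.I * (u : ℝ)) ^ 2 + (spatialSq x x' : ℝ) = ⟨A, 2 * ε * u⟩ := by
      apply Complex.ext
      · simp [sq, A, separation, u]
        ring
      · simp [sq]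
        ring
    rw [vacuumKernel_eq, this]
    push_cast
    rw [one_div, one_div, mul_inv]
  have hM : 0 ≤ M := (abs_nonneg _).trans h2
  have hden : 0 < A ^ 2 + (2 * ε * u) ^ 2 := by
    have : 0 < c ^ 2 := by positivity
    nlinarith [sq_nonneg (2 * ε * u)]
  have hpi : 1 / (4 * Real.pi ^ 2) ≤ 1 / 2 := by
    apply one_div_le_one_div_of_le (by norm_num)
    nlinarith [Real.pi_gt_three]
  rw [hv, Complex.im_ofReal_mul, Complex.inv_im, Complex.normSq_mk, abs_mul, abs_div (-_), abs_neg,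
    abs_of_pos (show 0 < A * A + 2 * ε * u * (2 * ε * u) by nlinarith),
    abs_of_pos (show 0 < 1 / (4 * Real.pi ^ 2) by positivity)]
  have e1 : |2 * ε * u| ≤ 2 * (ε * M) := by
    rw [abs_mul, abs_of_pos (by positivity : 0 < 2 * ε)]
    nlinarith
  calc 1 / (4 * Real.pi ^ 2) * (|2 * ε * u| / (A * A + 2 * ε * u * (2 * ε * u)))
      ≤ 1 / 2 * (2 * (ε * M) / c ^ 2) := by
        have e2 : c ^ 2 ≤ A * A + 2 * ε * u * (2 * ε * u) := by nlinarith [sq_nonneg (2 * ε * u)]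
        have e3 : |2 * ε * u| / (A * A + 2 * ε * u * (2 * ε * u)) ≤ 2 * (ε * M) / c ^ 2 := by
          gcongr
        exact mul_le_mul hpi e3 (div_nonneg (abs_nonneg _) (le_trans (by positivity) e2)) (by norm_num)
    _ = _ := by ring

/-! ### Averaging against bump functions -/

/-- A normalised bump function as a test function. -/
def bumpTestFn {x₀ : Spacetime} (ψ : ContDiffBump x₀) : TestFn where
  toFun x := ((ψ.normed volume x : ℝ) : ℂ)
  contDiff' := Complex.ofRealCLM.contDiff.comp ψ.contDiff_normed
  hasCompactSupport' := ψ.hasCompactSupport_normed.comp_left (g := fun r : ℝ => (r : ℂ)) (by simp)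
  tsupport_subset' := by simp

theorem bumpTestFn_apply {x₀ : Spacetime} (ψ : ContDiffBump x₀) (x : Spacetime) :
    bumpTestFn ψ x = ((ψ.normed volume x : ℝ) : ℂ) := rfl

theorem conjTestFn_bumpTestFn {x₀ : Spacetime} (ψ : ContDiffBump x₀) :
    conjTestFn (bumpTestFn ψ) = bumpTestFn ψ := by
  ext x
  simp [bumpTestFn_apply]

theorem normed_eq_zero_of_notMem {x₀ x : Spacetime} (ψ : ContDiffBump x₀)
    (hx : x ∉ Metric.ball x₀ ψ.rOut) : ψ.normed volume x = 0 := by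
  rw [← ψ.support_normed_eq (μ := volume)] at hx
  simpa using hx

theorem abs_integral_normed_mul_sub_le {x₀ : Spacetime} (ψ : ContDiffBump x₀) {f : Spacetime → ℝ}
    (hf : Continuous f) {c η : ℝ} (h : ∀ x ∈ Metric.ball x₀ ψ.rOut, |f x - c| ≤ η) :
    |(∫ x, ψ.normed volume x * f x) - c| ≤ η := by
  have hc := ψ.integral_normed (μ := volume)
  have i1 : Integrable (ψ.normed volume) := ψ.integrable_normed
  have i2 : Integrable fun x => ψ.normed volume x * f x :=
    (ψ.continuous_normed.mul hf).integrable_of_hasCompactSupport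
      ψ.hasCompactSupport_normed.mul_right
  have e : (∫ x, ψ.normed volume x * f x) - c = ∫ x, ψ.normed volume x * (f x - c) := by
    simp only [mul_sub]
    rw [integral_sub i2 (i1.mul_const c), integral_mul_const, hc, one_mul]
  rw [e, ← Real.norm_eq_abs]
  refine (norm_integral_le_of_norm_le (i1.mul_const η) (Eventually.of_forall fun x => ?_)).trans ?_
  · rw [norm_mul, Real.norm_of_nonneg (ψ.nonneg_normed x)]
    by_cases hx : x ∈ Metric.ball x₀ ψ.rOut
    · exact mul_le_mul_of_nonneg_left (h x hx) (ψ.nonneg_normed x)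
    · simp [normed_eq_zero_of_notMem ψ hx]
  · rw [integral_mul_const, hc, one_mul]

theorem continuous_integral_normed_mul {E : Type*} [NormedAddCommGroup E] [NormedSpace ℝ E]
    {x₀ : Spacetime} (ψ : ContDiffBump x₀)
    {F : Spacetime × Spacetime → E} (hF : Continuous F) :
    Continuous fun x => ∫ x', ψ.normed volume x' • F (x, x') := by
  rw [← continuousOn_univ]
  refine continuousOn_integral_of_compact_support (ψ.hasCompactSupport_normed (μ := volume))
    (Continuous.continuousOn ?_) fun x x' _ hx' => ?_
  · have := ψ.continuous_normed (μ := volume)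
    exact (this.comp continuous_snd).smul hF
  · rw [image_eq_zero_of_notMem_tsupport hx', zero_smul]

theorem im_integral_bumpTestFn_mul {x₀ x₀' : Spacetime} (ψ : ContDiffBump x₀)
    (ψ' : ContDiffBump x₀') {F : Spacetime × Spacetime → ℂ} (hF : Continuous F) :
    (∫ x, ∫ x', bumpTestFn ψ x * bumpTestFn ψ' x' * F (x, x')).im =
      ∫ x, ψ.normed volume x * ∫ x', ψ'.normed volume x' * (F (x, x')).im := by
  have e : ∀ x, ∫ x', bumpTestFn ψ x * bumpTestFn ψ' x' * F (x, x') =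
      ψ.normed volume x • ∫ x', ψ'.normed volume x' • F (x, x') := fun x => by
    rw [Complex.real_smul, ← integral_const_mul]
    refine integral_congr_ae (Eventually.of_forall fun x' => ?_)
    simp only [bumpTestFn_apply, Complex.real_smul]
    ring
  simp only [e]
  have i1 : Integrable fun x => ψ.normed volume x • ∫ x', ψ'.normed volume x' • F (x, x') :=
    (ψ.continuous_normed.smul (continuous_integral_normed_mul ψ' hF)).integrable_of_hasCompactSupport
      ψ.hasCompactSupport_normed.smul_right
  change Complex.imCLM _ = _
  rw [← Complex.imCLM.integral_comp_comm i1]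
  refine integral_congr_ae (Eventually.of_forall fun x => ?_)
  simp only [map_smul, smul_eq_mul]
  congr 1
  have i2 : Integrable fun x' => ψ'.normed volume x' • F (x, x') :=
    (ψ'.continuous_normed.smul (hF.comp (by fun_prop))).integrable_of_hasCompactSupport
      ψ'.hasCompactSupport_normed.smul_right
  rw [← Complex.imCLM.integral_comp_comm i2]
  simp

theorem abs_im_integral_bumpTestFn_mul_sub_le {x₀ x₀' : Spacetime} (ψ : ContDiffBump x₀)
    (ψ' : ContDiffBump x₀') {F : Spacetime × Spacetime → ℂ} (hF : Continuous F) {c η : ℝ}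
    (h : ∀ x ∈ Metric.ball x₀ ψ.rOut, ∀ x' ∈ Metric.ball x₀' ψ'.rOut, |(F (x, x')).im - c| ≤ η) :
    |(∫ x, ∫ x', bumpTestFn ψ x * bumpTestFn ψ' x' * F (x, x')).im - c| ≤ η := by
  rw [im_integral_bumpTestFn_mul ψ ψ' hF]
  refine abs_integral_normed_mul_sub_le ψ ?_ fun x hx =>
    abs_integral_normed_mul_sub_le ψ' (by fun_prop) (h x hx)
  exact continuous_integral_normed_mul ψ' (Complex.continuous_im.comp hF)

/-! ### Reality of the normal ordered two-point function -/

/-- Taking `s = ‖y‖` or `s = -‖y‖` covers both potentials: each samples its source only at points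
lightlike related to `x`. -/
theorem separation_retarded (x : Spacetime) (s : ℝ) (y : EuclideanSpace ℝ (Fin 3))
    (hs : s ^ 2 = ‖y‖ ^ 2) :
    separation x ![x 0 + s, x 1 - y 0, x 2 - y 1, x 3 - y 2] = 0 := by
  have : ‖y‖ ^ 2 = y 0 ^ 2 + y 1 ^ 2 + y 2 ^ 2 := by
    rw [EuclideanSpace.norm_sq_eq, Fin.sum_univ_three]
    simp
  simp [separation, spatialSq, hs, this]
  ring

/-- The commutator function vanishes for test functions without lightlike related points. -/
theorem commutatorFn_eq_zero {f f' : TestFn}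
    (h : ∀ x x', f x ≠ 0 → f' x' ≠ 0 → separation x x' ≠ 0) : commutatorFn f f' = 0 := by
  rw [commutatorFn]
  refine integral_eq_zero_of_ae (Eventually.of_forall fun x => ?_)
  by_cases hx : f x = 0
  · simp [hx]
  have h1 : advancedSolution f' x = 0 := by
    refine integral_eq_zero_of_ae (Eventually.of_forall fun y => ?_)
    have : f' ![x 0 + ‖y‖, x 1 - y 0, x 2 - y 1, x 3 - y 2] = 0 := by
      by_contra h0
      exact h x _ hx h0 (separation_retarded x ‖y‖ y rfl)
    simp [this]
  have h2 : retardedSolution f' x = 0 := by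
    refine integral_eq_zero_of_ae (Eventually.of_forall fun y => ?_)
    have : f' ![x 0 - ‖y‖, x 1 - y 0, x 2 - y 1, x 3 - y 2] = 0 := by
      by_contra h0
      refine h x _ hx h0 ?_
      rw [sub_eq_add_neg (x 0)]
      exact separation_retarded x (-‖y‖) y (by ring)
    simp [this]
  simp [h1, h2]

/-- Bump functions near two points that are not lightlike related commute, for timelike as well as
spacelike separation, so their two-point function is real. The vacuum contribution is asymptotically
real too, hence so is the average of `W`; shrinking the bumps recovers the value at the two points.
-/
theorem State.IsSmoothRemainder.im_eq_zero_of_separation_ne_zero {ω : State}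
    {W : Spacetime × Spacetime → ℂ} (hW : ω.IsSmoothRemainder W) {x₀ x₀' : Spacetime}
    (h0 : separation x₀ x₀' ≠ 0) : (W (x₀, x₀')).im = 0 := by
  have hWc : Continuous W := hW.1.continuous
  -- A quarter leaves room for `2c < |separation|` to persist in a neighbourhood.
  set c := |separation x₀ x₀'| / 4 with hc
  have hc0 : 0 < c := by positivity
  refine abs_eq_zero.1 (le_antisymm (le_of_forall_pos_le_add fun η hη => ?_) (abs_nonneg _))
  have ev : ∀ᶠ p : Spacetime × Spacetime in 𝓝 (x₀, x₀'), 2 * c < |separation p.1 p.2| ∧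
      |p.1 0 - p.2 0| < |x₀ 0 - x₀' 0| + 1 ∧ |(W p).im - (W (x₀, x₀')).im| < η := by
    refine ((Continuous.tendsto (by fun_prop) _).eventually (lt_mem_nhds ?_)).and
      (((Continuous.tendsto (by fun_prop) _).eventually (gt_mem_nhds ?_)).and
      ((Continuous.tendsto (by fun_prop) _).eventually (gt_mem_nhds ?_)))
    · simp only
      linarith
    · simp
    · simpa
  obtain ⟨r, hr, hball⟩ := Metric.eventually_nhds_iff_ball.1 ev
  have hmem : ∀ x ∈ Metric.ball x₀ r, ∀ x' ∈ Metric.ball x₀' r, _ := fun x hx x' hx' =>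
    hball (x, x') (by rw [← ball_prod_same]; exact ⟨hx, hx'⟩)
  let ψ : ContDiffBump x₀ := ⟨r / 2, r, by positivity, by linarith⟩
  let ψ' : ContDiffBump x₀' := ⟨r / 2, r, by positivity, by linarith⟩
  set f := bumpTestFn ψ
  set f' := bumpTestFn ψ'
  have hf : ∀ x, f x ≠ 0 → x ∈ Metric.ball x₀ r := fun x hx => by
    by_contra h
    exact hx (by rw [bumpTestFn_apply, normed_eq_zero_of_notMem ψ h, Complex.ofReal_zero])
  have hf' : ∀ x, f' x ≠ 0 → x ∈ Metric.ball x₀' r := fun x hx => by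
    by_contra h
    exact hx (by rw [bumpTestFn_apply, normed_eq_zero_of_notMem ψ' h, Complex.ofReal_zero])
  have hcomm : commutatorFn f f' = 0 := commutatorFn_eq_zero fun x x' hx hx' h => by
    have := (hmem x (hf x hx) x' (hf' x' hx')).1
    simp only [h, abs_zero] at this
    linarith
  have hreal := ω.twoPoint_im_eq_zero (conjTestFn_bumpTestFn ψ) (conjTestFn_bumpTestFn ψ') hcomm
  have hlim := (Complex.continuous_im.tendsto _).comp (hW.2 f f')
  rw [Complex.sub_im, hreal, zero_sub] at hlim
  have hlim0 : Tendsto (fun ε : ℝ => (∫ x, ∫ x', f x * f' x' * vacuumKernel ε x x').im)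
      (𝓝[>] 0) (𝓝 0) := by
    have hg : Tendsto (fun ε : ℝ => ε * (|x₀ 0 - x₀' 0| + 1) / c ^ 2) (𝓝[>] 0) (𝓝 0) := by
      have : Continuous fun ε : ℝ => ε * (|x₀ 0 - x₀' 0| + 1) / c ^ 2 := by fun_prop
      simpa using (this.tendsto 0).mono_left nhdsWithin_le_nhds
    refine squeeze_zero_norm' ?_ hg
    have e1 : ∀ᶠ ε : ℝ in 𝓝[>] 0, ε ^ 2 < c := by
      have : Continuous fun ε : ℝ => ε ^ 2 := by fun_prop
      exact ((this.tendsto 0).eventually (gt_mem_nhds (by simpa))).filter_mono nhdsWithin_le_nhds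
    filter_upwards [e1, self_mem_nhdsWithin] with ε hε1 hε2
    have := abs_im_integral_bumpTestFn_mul_sub_le ψ ψ' (continuous_vacuumKernel hε2) (c := 0)
      (η := ε * (|x₀ 0 - x₀' 0| + 1) / c ^ 2) fun x hx x' hx' => by
        have h := hmem x hx x' hx'
        rw [sub_zero]
        exact abs_im_vacuumKernel_le hε2 hc0 h.1.le h.2.1.le hε1.le
    rwa [sub_zero] at this
  have hz := tendsto_nhds_unique hlim hlim0
  have := abs_im_integral_bumpTestFn_mul_sub_le ψ ψ' hWc (c := (W (x₀, x₀')).im) (η := η)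
    fun x hx x' hx' => (hmem x hx x' hx').2.2.le
  rw [neg_eq_zero.1 hz, zero_sub, abs_neg] at this
  linarith

/-- The normal ordered two-point function is real. -/
theorem State.IsSmoothRemainder.im_eq_zero {ω : State} {W : Spacetime × Spacetime → ℂ}
    (hW : ω.IsSmoothRemainder W) (p : Spacetime × Spacetime) : (W p).im = 0 := by
  obtain ⟨x, x'⟩ := p
  by_cases h : separation x x' = 0
  swap
  · exact hW.im_eq_zero_of_separation_ne_zero h
  -- A lightlike pair is approached by moving one point in time. The separation becomes `-t (2(x⁰ -
  -- x'⁰) + t)`, nonzero for all small `t ≠ 0`, and continuity gives the value at `t = 0`.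
  let q : ℝ → Spacetime := fun t => x + t • coordVec 0
  have hq : Continuous q := by fun_prop
  have hs : ∀ t, separation (q t) x' = separation x x' - t * (2 * (x 0 - x' 0) + t) := fun t => by
    simp only [separation, spatialSq, q, coordVec]
    simp
    ring
  have hev : ∀ᶠ t : ℝ in 𝓝[≠] 0, (W (q t, x')).im = 0 := by
    have h2 : ∀ᶠ t : ℝ in 𝓝[≠] 0, 2 * (x 0 - x' 0) + t ≠ 0 := by
      rcases eq_or_ne (x 0 - x' 0) 0 with h0 | h0
      · filter_upwards [self_mem_nhdsWithin] with t ht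
        simpa [h0] using ht
      · have : Continuous fun t : ℝ => 2 * (x 0 - x' 0) + t := by fun_prop
        exact ((this.tendsto 0).eventually_ne (by simpa using h0)).filter_mono nhdsWithin_le_nhds
    filter_upwards [h2, self_mem_nhdsWithin] with t ht ht0
    refine hW.im_eq_zero_of_separation_ne_zero ?_
    rw [hs, h, zero_sub]
    exact neg_ne_zero.2 (mul_ne_zero ht0 ht)
  have hc : Continuous fun t => (W (q t, x')).im :=
    Complex.continuous_im.comp (hW.1.continuous.comp (by fun_prop))
  have hl := (hc.tendsto 0).mono_left (nhdsWithin_le_nhds (s := {0}ᶜ))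
  have := tendsto_nhds_unique hl (tendsto_const_nhds.congr' (hev.mono fun t ht => ht.symm))
  simpa [q] using this

end

section

/-! ### Test functions concentrated near a curve -/

/-- Smearing data along a curve: a smooth curve `γ`, a smooth vector field `e` along it and a smooth
compactly supported weight `c`. -/
structure CurveData where
  γ : ℝ → Spacetime
  e : ℝ → Spacetime
  c : ℝ → ℂ
  contDiff_γ : ContDiff ℝ (⊤ : ℕ∞) γ
  contDiff_e : ContDiff ℝ (⊤ : ℕ∞) e
  contDiff_c : ContDiff ℝ (⊤ : ℕ∞) c
  hasCompactSupport_c : HasCompactSupport c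

namespace CurveData

variable (d : CurveData)

@[fun_prop]
theorem continuous_γ : Continuous d.γ := d.contDiff_γ.continuous

@[fun_prop]
theorem continuous_e : Continuous d.e := d.contDiff_e.continuous

@[fun_prop]
theorem continuous_c : Continuous d.c := d.contDiff_c.continuous

/-- The integrand of the smearing along a curve. -/
def smearIntegrand (χ : TestFn) (x : Spacetime) (τ : ℝ) : ℂ :=
  d.c τ * fderiv ℝ χ (x - d.γ τ) (d.e τ)

theorem contDiff_smearIntegrand (χ : TestFn) :
    ContDiff ℝ (⊤ : ℕ∞) (fun p : Spacetime × ℝ => d.smearIntegrand χ p.1 p.2) := by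
  have h1 : ContDiff ℝ (⊤ : ℕ∞) (fderiv ℝ χ) :=
    χ.contDiff.fderiv_right (by simp)
  have h2 := d.contDiff_γ
  have h3 := d.contDiff_e
  have h4 := d.contDiff_c
  unfold smearIntegrand
  refine ContDiff.mul (h4.comp contDiff_snd) (ContDiff.clm_apply (h1.comp ?_) (h3.comp contDiff_snd))
  exact contDiff_fst.sub (h2.comp contDiff_snd)

/-- A compact set containing the support of the smeared test function. -/
def smearSupport (χ : TestFn) : Set Spacetime :=
  (fun p : Spacetime × ℝ => p.1 + d.γ p.2) '' (tsupport χ ×ˢ tsupport d.c)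

theorem isCompact_smearSupport (χ : TestFn) : IsCompact (d.smearSupport χ) :=
  (χ.hasCompactSupport.isCompact.prod d.hasCompactSupport_c.isCompact).image (by fun_prop)

theorem smearIntegrand_eq_zero {χ : TestFn} {x : Spacetime} {τ : ℝ}
    (h : τ ∉ tsupport d.c ∨ x ∉ d.smearSupport χ) : d.smearIntegrand χ x τ = 0 := by
  by_cases hτ : τ ∈ tsupport d.c
  · have hx := h.resolve_left (not_not_intro hτ)
    have : x - d.γ τ ∉ tsupport χ := fun h' => hx ⟨(x - d.γ τ, τ), ⟨h', hτ⟩, by simp⟩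
    have h0 : fderiv ℝ χ (x - d.γ τ) = 0 :=
      image_eq_zero_of_notMem_tsupport fun h' => this (tsupport_fderiv_subset ℝ h')
    simp [smearIntegrand, h0]
  · simp [smearIntegrand, image_eq_zero_of_notMem_tsupport hτ]

/-- The derivative along `e` of the translates of `χ` along `γ`, averaged with weight `-c`. -/
def smear (χ : TestFn) : TestFn where
  toFun x := -∫ τ, d.smearIntegrand χ x τ
  contDiff' := by
    -- The `τ`-integral is a convolution with the constant function one, evaluated at `0` and
    -- depending on the parameter `x`; evaluation at `0` accounts for the reflection `t ↦ -t`.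
    have h := contDiffOn_convolution_right_with_param (n := ⊤) (μ := (volume : Measure ℝ))
      (f := fun _ : ℝ => (1 : ℝ)) (ContinuousLinearMap.lsmul ℝ ℝ)
      (g := fun x t => d.smearIntegrand χ x (-t)) (s := Set.univ)
      (k := (fun t => -t) '' tsupport d.c) isOpen_univ
      (d.hasCompactSupport_c.isCompact.image continuous_neg)
      (fun x t _ ht => d.smearIntegrand_eq_zero (Or.inl fun h => ht ⟨-t, h, by simp⟩))
      (locallyIntegrable_const _)
      (((d.contDiff_smearIntegrand χ).comp (contDiff_fst.prodMk contDiff_snd.neg)).contDiffOn)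
    rw [Set.univ_prod_univ, contDiffOn_univ] at h
    have h2 := (h.comp (contDiff_id.prodMk (contDiff_const (c := (0 : ℝ))))).neg
    convert h2 using 2 with x
    simp [convolution]
  hasCompactSupport' := HasCompactSupport.intro (d.isCompact_smearSupport χ) fun x hx => by
    simp [d.smearIntegrand_eq_zero (Or.inr hx)]
  tsupport_subset' := by simp

theorem smear_apply (χ : TestFn) (x : Spacetime) :
    d.smear χ x = -∫ τ, d.smearIntegrand χ x τ := rfl

/-- The weight of the smearing in the coordinates `(τ, y) ↦ γ(τ) + y`. -/
def weight (χ : TestFn) (p : ℝ × Spacetime) : ℂ := d.c p.1 * χ p.2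

@[fun_prop]
theorem continuous_weight (χ : TestFn) : Continuous (d.weight χ) := by
  unfold weight
  fun_prop

theorem weight_eq_zero {χ : TestFn} {p : ℝ × Spacetime} (hp : p ∉ tsupport d.c ×ˢ tsupport χ) :
    d.weight χ p = 0 := by
  rw [Set.mem_prod, not_and_or] at hp
  rcases hp with h | h
  · simp [weight, image_eq_zero_of_notMem_tsupport h]
  · simp [weight, image_eq_zero_of_notMem_tsupport h]

theorem isCompact_weightSupport (χ : TestFn) : IsCompact (tsupport d.c ×ˢ tsupport χ) :=
  d.hasCompactSupport_c.isCompact.prod χ.hasCompactSupport.isCompact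

theorem hasCompactSupport_weight (χ : TestFn) : HasCompactSupport (d.weight χ) :=
  HasCompactSupport.intro (d.isCompact_weightSupport χ) fun _ hp => d.weight_eq_zero hp

theorem integrable_weight (χ : TestFn) : Integrable (d.weight χ) :=
  (d.continuous_weight χ).integrable_of_hasCompactSupport (d.hasCompactSupport_weight χ)

theorem integrable_weight_mul (χ : TestFn) {φ : ℝ × Spacetime → ℂ} (hφ : Continuous φ) :
    Integrable fun p => d.weight χ p * φ p :=
  ((d.continuous_weight χ).mul hφ).integrable_of_hasCompactSupport
    (d.hasCompactSupport_weight χ).mul_right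

theorem integral_translate_by_parts (χ : TestFn) {φ : Spacetime → ℂ} (hφ : ContDiff ℝ 1 φ)
    (z v : Spacetime) :
    -∫ x, fderiv ℝ χ (x - z) v * φ x = ∫ y, χ y * fderiv ℝ φ (z + y) v := by
  have hχ : ContDiff ℝ 1 χ := χ.contDiff.of_le (by simp)
  have hφ' : Continuous fun y => fderiv ℝ φ (z + y) v :=
    ((hφ.continuous_fderiv one_ne_zero).comp (continuous_const_add z)).clm_apply continuous_const
  have hχ' : Continuous fun y => fderiv ℝ χ y v :=
    (hχ.continuous_fderiv one_ne_zero).clm_apply continuous_const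
  have hcs : HasCompactSupport fun y => fderiv ℝ χ y v :=
    χ.hasCompactSupport.fderiv_apply (𝕜 := ℝ) v
  have hφd : ContDiff ℝ 1 fun y => φ (z + y) := hφ.comp (contDiff_const.add contDiff_id)
  have hfd : ∀ y, fderiv ℝ (fun y => φ (z + y)) y = fderiv ℝ φ (z + y) := fun y => by
    rw [fderiv_comp_add_left]
  rw [← integral_add_left_eq_self (fun x => fderiv ℝ χ (x - z) v * φ x) z]
  simp only [add_sub_cancel_left]
  rw [← integral_mul_fderiv_eq_neg_fderiv_mul_of_integrable (f := χ) (g := fun y => φ (z + y))]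
  · simp only [hfd]
  · exact (hχ'.mul hφd.continuous).integrable_of_hasCompactSupport hcs.mul_right
  · simp only [hfd]
    exact (χ.continuous.mul hφ').integrable_of_hasCompactSupport χ.hasCompactSupport.mul_right
  · exact (χ.continuous.mul hφd.continuous).integrable_of_hasCompactSupport
      χ.hasCompactSupport.mul_right
  · exact fun x _ => (hχ.differentiable one_ne_zero) x
  · exact fun x _ => (hφd.differentiable one_ne_zero) x

theorem continuous_fderiv_comp_curve {φ : Spacetime → ℂ} (hφ : ContDiff ℝ 1 φ) :
    Continuous fun p : ℝ × Spacetime => fderiv ℝ φ (d.γ p.1 + p.2) (d.e p.1) :=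
  ((hφ.continuous_fderiv one_ne_zero).comp (by fun_prop)).clm_apply (by fun_prop)

/-- Integration by parts moves the derivative from `χ` to `φ` and absorbs the sign in `smear`. As no
derivative of `χ` remains, `χ` may later be concentrated at the origin. -/
theorem integral_smear_mul (χ : TestFn) {φ : Spacetime → ℂ} (hφ : ContDiff ℝ 1 φ) :
    ∫ x, d.smear χ x * φ x =
      ∫ p : ℝ × Spacetime, d.weight χ p * fderiv ℝ φ (d.γ p.1 + p.2) (d.e p.1) := by
  have e1 : ∀ x, d.smear χ x * φ x = -∫ τ, d.smearIntegrand χ x τ * φ x := fun x => by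
    rw [smear_apply, integral_mul_const, neg_mul]
  simp only [e1]
  rw [integral_neg, integral_integral_swap_of_hasCompactSupport]
  rotate_left
  · exact (d.contDiff_smearIntegrand χ).continuous.mul (hφ.continuous.comp continuous_fst)
  · refine HasCompactSupport.intro
      ((d.isCompact_smearSupport χ).prod d.hasCompactSupport_c.isCompact) fun p hp => ?_
    rw [Set.mem_prod, not_and_or] at hp
    simp [Function.uncurry, d.smearIntegrand_eq_zero hp.symm]
  have e2 : ∀ τ, ∫ x, d.smearIntegrand χ x τ * φ x =
      -(d.c τ * ∫ y, χ y * fderiv ℝ φ (d.γ τ + y) (d.e τ)) := fun τ => by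
    rw [← integral_translate_by_parts χ hφ, mul_neg, neg_neg, ← integral_const_mul]
    simp only [smearIntegrand, mul_assoc]
  simp only [e2]
  rw [integral_neg, neg_neg, Measure.volume_eq_prod,
    integral_prod _ (d.integrable_weight_mul χ (d.continuous_fderiv_comp_curve hφ))]
  simp only [← integral_const_mul, weight, mul_assoc]

end CurveData

/-! ### The mixed second derivative -/

/-- The mixed derivative `(∂_v ⊗ ∂_w') F` at `p`. -/
def mixedForm (F : Spacetime × Spacetime → ℂ) (p : Spacetime × Spacetime) (v w : Spacetime) : ℂ :=
  fderiv ℝ (fderiv ℝ F) p (v, 0) (0, w)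

theorem fderiv_fderiv_apply_eq_mixedForm {F : Spacetime × Spacetime → ℂ}
    (hF : ContDiff ℝ (⊤ : ℕ∞) F) (p : Spacetime × Spacetime) (v w : Spacetime) :
    fderiv ℝ (fun q => fderiv ℝ F q (0, w)) p (v, 0) = mixedForm F p v w := by
  have h1 : ContDiff ℝ (⊤ : ℕ∞) (fderiv ℝ F) := hF.fderiv_right (by simp)
  have h2 : DifferentiableAt ℝ (fderiv ℝ F) p := (h1.differentiable (by simp)) p
  rw [fderiv_clm_apply h2 (differentiableAt_const _)]
  simp [mixedForm]

theorem mixedDeriv_eq_mixedForm {F : Spacetime × Spacetime → ℂ} (hF : ContDiff ℝ (⊤ : ℕ∞) F)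
    (a b : Fin 4) (x : Spacetime) :
    mixedDeriv F a b x = mixedForm F (x, x) (coordVec a) (coordVec b) :=
  fderiv_fderiv_apply_eq_mixedForm hF _ _ _

theorem continuous_mixedForm {F : Spacetime × Spacetime → ℂ} (hF : ContDiff ℝ (⊤ : ℕ∞) F)
    {X : Type*} [TopologicalSpace X] {p : X → Spacetime × Spacetime} {v w : X → Spacetime}
    (hp : Continuous p) (hv : Continuous v) (hw : Continuous w) :
    Continuous fun x => mixedForm F (p x) (v x) (w x) := by
  have h1 : ContDiff ℝ (⊤ : ℕ∞) (fderiv ℝ F) := hF.fderiv_right (by simp)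
  have h2 : Continuous (fderiv ℝ (fderiv ℝ F)) := h1.continuous_fderiv (by simp)
  exact ((h2.comp hp).clm_apply (hv.prodMk continuous_const)).clm_apply (continuous_const.prodMk hw)

theorem mixedForm_im_eq_zero {F : Spacetime × Spacetime → ℂ} (hF : ContDiff ℝ (⊤ : ℕ∞) F)
    (hr : ∀ p, (F p).im = 0) (p : Spacetime × Spacetime) (v w : Spacetime) :
    (mixedForm F p v w).im = 0 := by
  have h1 : ContDiff ℝ (⊤ : ℕ∞) (fderiv ℝ F) := hF.fderiv_right (by simp)
  have key : ∀ (G : Spacetime × Spacetime → ℂ), Differentiable ℝ G → (∀ p, (G p).im = 0) →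
      ∀ p u, (fderiv ℝ G p u).im = 0 := fun G hG hG0 p u => by
    have : fderiv ℝ (fun q => Complex.imCLM (G q)) p = Complex.imCLM.comp (fderiv ℝ G p) :=
      (Complex.imCLM.hasFDerivAt.comp p (hG p).hasFDerivAt).fderiv
    have h0 : (fun q => Complex.imCLM (G q)) = fun _ => 0 := funext fun q => hG0 q
    rw [h0] at this
    have := congrArg (fun L => L u) this
    simpa using this.symm
  rw [← fderiv_fderiv_apply_eq_mixedForm hF]
  refine key _ ?_ (fun q => key F (hF.differentiable (by simp)) hr q _) p _
  exact (h1.differentiable (by simp)).clm_apply (differentiable_const _)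

end

/-! ### Restriction of a smooth kernel to a curve -/

section

namespace CurveData

variable (d : CurveData)

/-- The conjugate smearing data. -/
def conj : CurveData where
  γ := d.γ
  e := d.e
  c τ := star (d.c τ)
  contDiff_γ := d.contDiff_γ
  contDiff_e := d.contDiff_e
  contDiff_c := Complex.conjCLE.contDiff.comp d.contDiff_c
  hasCompactSupport_c := d.hasCompactSupport_c.comp_left (g := fun z : ℂ => star z) (by simp)

/-- For real `χ` conjugation affects only the weight. This identifies the first argument in the
positivity condition as another smearing along the same curve. -/
theorem conj_smear {χ : TestFn} (hχ : conjTestFn χ = χ) :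
    conjTestFn (d.smear χ) = d.conj.smear χ := by
  ext x
  rw [conjTestFn_apply, smear_apply, smear_apply, star_neg]
  congr 1
  change (starRingEnd ℂ) _ = _
  rw [← integral_conj]
  refine integral_congr_ae (Eventually.of_forall fun τ => ?_)
  simp only [smearIntegrand, map_mul]
  congr 1
  have h1 : (fun x => Complex.conjCLE (χ x)) = χ := by
    funext y
    exact congrArg (fun f : TestFn => f y) hχ
  have h2 : DifferentiableAt ℝ χ (x - d.γ τ) := (χ.contDiff.differentiable (by simp)) _
  have h3 : fderiv ℝ (fun x => Complex.conjCLE (χ x)) (x - d.γ τ) =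
      (Complex.conjCLE : ℂ →L[ℝ] ℂ).comp (fderiv ℝ χ (x - d.γ τ)) :=
    ((Complex.conjCLE : ℂ →L[ℝ] ℂ).hasFDerivAt.comp _ h2.hasFDerivAt).fderiv
  rw [h1] at h3
  change (starRingEnd ℂ) _ = fderiv ℝ χ (x - d.γ τ) (d.e τ)
  conv_rhs => rw [h3]
  rfl

/-- Two applications of `integral_smear_mul`, the second variable first, which is why the primed
integral ends up outermost. -/
theorem integral_smear_smear {d₁ d₂ : CurveData} (χ : TestFn) {W : Spacetime × Spacetime → ℂ}
    (hW : ContDiff ℝ (⊤ : ℕ∞) W) :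
    ∫ x, ∫ x', d₁.smear χ x * d₂.smear χ x' * W (x, x') =
      ∫ p' : ℝ × Spacetime, ∫ p : ℝ × Spacetime, d₂.weight χ p' * (d₁.weight χ p *
        mixedForm W (d₁.γ p.1 + p.2, d₂.γ p'.1 + p'.2) (d₁.e p.1) (d₂.e p'.1)) := by
  have hW1 : ContDiff ℝ (⊤ : ℕ∞) (fderiv ℝ W) := hW.fderiv_right (by simp)
  have hWd : ∀ p, HasFDerivAt W (fderiv ℝ W p) p := fun p =>
    ((hW.differentiable (by simp)) p).hasFDerivAt
  let D : Spacetime → ℝ × Spacetime → ℂ := fun x p' =>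
    fderiv ℝ W (x, d₂.γ p'.1 + p'.2) (0, d₂.e p'.1)
  have hD : Continuous D.uncurry :=
    (hW1.continuous.comp (by fun_prop)).clm_apply (by fun_prop)
  have e1 : ∀ x, ∫ x', d₁.smear χ x * d₂.smear χ x' * W (x, x') =
      ∫ p', d₁.smear χ x * (d₂.weight χ p' * D x p') := fun x => by
    simp only [mul_assoc, integral_const_mul]
    have hs : ContDiff ℝ 1 fun x' => W (x, x') :=
      (hW.of_le (by simp)).comp (contDiff_const.prodMk contDiff_id)
    rw [d₂.integral_smear_mul χ hs]
    congr 1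
    refine integral_congr_ae (Eventually.of_forall fun p' => ?_)
    have : HasFDerivAt (fun x' => W (x, x')) ((fderiv ℝ W (x, d₂.γ p'.1 + p'.2)).comp
        (ContinuousLinearMap.inr ℝ Spacetime Spacetime)) (d₂.γ p'.1 + p'.2) :=
      (hWd _).comp _ (hasFDerivAt_prodMk_right x _)
    simp only [this.fderiv, D]
    simp
  simp only [e1]
  rw [integral_integral_swap_of_hasCompactSupport]
  rotate_left
  · exact ((d₁.smear χ).continuous.comp continuous_fst).mul
      (((d₂.continuous_weight χ).comp continuous_snd).mul hD)
  · refine HasCompactSupport.intro ((d₁.smear χ).hasCompactSupport.isCompact.prod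
      (d₂.isCompact_weightSupport χ)) fun q hq => ?_
    rw [Set.mem_prod, not_and_or] at hq
    rcases hq with h | h
    · simp [Function.uncurry, image_eq_zero_of_notMem_tsupport h]
    · simp [Function.uncurry, d₂.weight_eq_zero h]
  refine integral_congr_ae (Eventually.of_forall fun p' => ?_)
  have hs : ContDiff ℝ 1 fun x => D x p' :=
    ((hW1.of_le (by simp)).comp (contDiff_id.prodMk contDiff_const)).clm_apply contDiff_const
  have e2 : ∀ x, d₁.smear χ x * (d₂.weight χ p' * D x p') =
      d₂.weight χ p' * (d₁.smear χ x * D x p') := fun x => by ring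
  simp only [e2, integral_const_mul]
  rw [d₁.integral_smear_mul χ hs]
  congr 1
  refine integral_congr_ae (Eventually.of_forall fun p => ?_)
  have h1 : DifferentiableAt ℝ (fun q => fderiv ℝ W q (0, d₂.e p'.1))
      (d₁.γ p.1 + p.2, d₂.γ p'.1 + p'.2) :=
    ((hW1.clm_apply contDiff_const).differentiable (by simp)) _
  have h2 : HasFDerivAt (fun x => D x p') ((fderiv ℝ (fun q => fderiv ℝ W q (0, d₂.e p'.1))
      (d₁.γ p.1 + p.2, d₂.γ p'.1 + p'.2)).comp
        (ContinuousLinearMap.inl ℝ Spacetime Spacetime)) (d₁.γ p.1 + p.2) :=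
    HasFDerivAt.comp (g := fun q => fderiv ℝ W q (0, d₂.e p'.1))
      (f := fun x : Spacetime => (x, d₂.γ p'.1 + p'.2)) (d₁.γ p.1 + p.2) h1.hasFDerivAt
      (hasFDerivAt_prodMk_left (d₁.γ p.1 + p.2) (d₂.γ p'.1 + p'.2))
  simp only [h2.fderiv]
  rw [← fderiv_fderiv_apply_eq_mixedForm hW]
  simp

/-- The bilinear form of a smooth kernel restricted to the curve. -/
def restriction (W : Spacetime × Spacetime → ℂ) (τ τ' : ℝ) : ℂ :=
  mixedForm W (d.γ τ, d.γ τ') (d.e τ) (d.e τ')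

theorem continuous_restriction {W : Spacetime × Spacetime → ℂ} (hW : ContDiff ℝ (⊤ : ℕ∞) W)
    {X : Type*} [TopologicalSpace X] {a b : X → ℝ} (ha : Continuous a) (hb : Continuous b) :
    Continuous fun x => d.restriction W (a x) (b x) :=
  continuous_mixedForm hW (by fun_prop) (by fun_prop) (by fun_prop)

theorem integral_weight_mul {x₀ : Spacetime} (ψ : ContDiffBump x₀) (q : ℝ → ℂ) :
    ∫ p : ℝ × Spacetime, d.weight (bumpTestFn ψ) p * q p.1 = ∫ τ, d.c τ * q τ := by
  have : ∀ p : ℝ × Spacetime, d.weight (bumpTestFn ψ) p * q p.1 =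
      (d.c p.1 * q p.1) * bumpTestFn ψ p.2 := fun p => by
    rw [weight]
    ring
  simp only [this]
  rw [Measure.volume_eq_prod, integral_prod_mul (fun τ => d.c τ * q τ) (fun y => bumpTestFn ψ y)]
  simp only [bumpTestFn_apply]
  rw [integral_complex_ofReal, ψ.integral_normed]
  simp

theorem integral_norm_weight {x₀ : Spacetime} (ψ : ContDiffBump x₀) :
    ∫ p : ℝ × Spacetime, ‖d.weight (bumpTestFn ψ) p‖ = ∫ τ, ‖d.c τ‖ := by
  have : ∀ p : ℝ × Spacetime, ‖d.weight (bumpTestFn ψ) p‖ =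
      ‖d.c p.1‖ * ψ.normed volume p.2 := fun p => by
    rw [weight, norm_mul, bumpTestFn_apply, Complex.norm_real,
      Real.norm_of_nonneg (ψ.nonneg_normed _)]
  simp only [this]
  rw [Measure.volume_eq_prod, integral_prod_mul (fun τ => ‖d.c τ‖) (fun y => ψ.normed volume y),
    ψ.integral_normed, mul_one]

/-- As the bump function concentrates at the origin, the smeared kernel is approximated by its
restriction to the curve. -/
theorem exists_bump_norm_sub_le {W : Spacetime × Spacetime → ℂ} (hW : ContDiff ℝ (⊤ : ℕ∞) W)
    {η : ℝ} (hη : 0 < η) : ∃ ψ : ContDiffBump (0 : Spacetime),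
      ‖(∫ x, ∫ x', d.conj.smear (bumpTestFn ψ) x * d.smear (bumpTestFn ψ) x' * W (x, x')) -
        ∫ τ', ∫ τ, d.c τ' * (star (d.c τ) * d.restriction W τ τ')‖ ≤ η := by
  set N := ∫ τ, ‖d.c τ‖ with hN
  have hN0 : 0 ≤ N := integral_nonneg fun τ => norm_nonneg _
  -- The two weights have `L¹` norm `N` each, so a uniform error `η'` in the kernel costs `N² η'`;
  -- the added one guards against `N = 0`.
  set η' := η / (N * N + 1) with hη'
  have hη'0 : 0 < η' := by positivity
  let K := tsupport d.c
  have hK : IsCompact K := d.hasCompactSupport_c.isCompact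
  let Q : Spacetime × Spacetime → ℝ × ℝ → ℂ := fun y t =>
    mixedForm W (d.γ t.1 + y.1, d.γ t.2 + y.2) (d.e t.1) (d.e t.2)
  have hQ : Continuous Q.uncurry :=
    continuous_mixedForm hW (by fun_prop) (by fun_prop) (by fun_prop)
  -- Compactness of the parameter set makes the kernel continuous in the displacement `y` at `0`,
  -- uniformly in the two curve parameters.
  obtain ⟨v, hv, hvQ⟩ := (hK.prod hK).mem_uniformity_of_prod (f := Q) (s := Set.univ) (q := 0)
    hQ.continuousOn (Set.mem_univ _) (Metric.dist_mem_uniformity hη'0)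
  rw [nhdsWithin_univ] at hv
  obtain ⟨r, hr, hball⟩ := Metric.mem_nhds_iff.1 hv
  let ψ : ContDiffBump (0 : Spacetime) := ⟨r / 2, r, by positivity, by linarith⟩
  refine ⟨ψ, ?_⟩
  set χ := bumpTestFn ψ
  rw [integral_smear_smear χ hW]
  let C := d.weight χ
  let C' := d.conj.weight χ
  let F : (ℝ × Spacetime) × (ℝ × Spacetime) → ℂ := fun q =>
    C q.1 * (C' q.2 * Q (q.2.2, q.1.2) (q.2.1, q.1.1))
  let F₀ : (ℝ × Spacetime) × (ℝ × Spacetime) → ℂ := fun q =>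
    C q.1 * (C' q.2 * Q 0 (q.2.1, q.1.1))
  have hCc : Continuous C := d.continuous_weight χ
  have hC'c : Continuous C' := d.conj.continuous_weight χ
  have hcs : ∀ G : (ℝ × Spacetime) × (ℝ × Spacetime) → ℂ, Continuous G →
      Integrable fun q => C q.1 * (C' q.2 * G q) := fun G hG => by
    refine Continuous.integrable_of_hasCompactSupport (by fun_prop) ?_
    refine HasCompactSupport.intro ((d.isCompact_weightSupport χ).prod
      (d.conj.isCompact_weightSupport χ)) fun q hq => ?_
    rw [Set.mem_prod, not_and_or] at hq
    rcases hq with h | h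
    · simp [C, d.weight_eq_zero h]
    · simp [C', d.conj.weight_eq_zero h]
  have hF : Integrable F := hcs _ (hQ.comp (by fun_prop : Continuous fun q :
    (ℝ × Spacetime) × (ℝ × Spacetime) => ((q.2.2, q.1.2), (q.2.1, q.1.1))))
  have hF₀ : Integrable F₀ := hcs _ (hQ.comp (by fun_prop : Continuous fun q :
    (ℝ × Spacetime) × (ℝ × Spacetime) => ((0 : Spacetime × Spacetime), (q.2.1, q.1.1))))
  have e0 : ∫ p', ∫ p, F₀ (p', p) = ∫ τ', ∫ τ, d.c τ' * (star (d.c τ) * d.restriction W τ τ') := by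
    have h1 : ∀ p' : ℝ × Spacetime, ∫ p, F₀ (p', p) =
        C p' * ∫ τ, star (d.c τ) * d.restriction W τ p'.1 := fun p' => by
      simp only [F₀]
      rw [integral_const_mul]
      congr 1
      have := d.conj.integral_weight_mul ψ (fun τ => d.restriction W τ p'.1)
      rw [← show _ = ∫ τ, star (d.c τ) * d.restriction W τ p'.1 from this]
      simp [C', Q, restriction, χ]
    simp only [h1]
    rw [d.integral_weight_mul ψ (fun τ' => ∫ τ, star (d.c τ) * d.restriction W τ τ')]
    simp only [integral_const_mul]
  rw [← e0]
  change ‖(∫ p', ∫ p, F (p', p)) - _‖ ≤ _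
  have eF : ∫ p', ∫ p, F (p', p) = ∫ q, F q := by
    rw [Measure.volume_eq_prod (ℝ × Spacetime), integral_prod _ hF]
  have eF₀ : ∫ p', ∫ p, F₀ (p', p) = ∫ q, F₀ q := by
    rw [Measure.volume_eq_prod (ℝ × Spacetime), integral_prod _ hF₀]
  rw [eF, eF₀, ← integral_sub hF hF₀]
  have hbound : ∀ q, ‖F q - F₀ q‖ ≤ ‖C q.1‖ * ‖C' q.2‖ * η' := fun q => by
    have : F q - F₀ q = C q.1 * C' q.2 * (Q (q.2.2, q.1.2) (q.2.1, q.1.1) - Q 0 (q.2.1, q.1.1)) := by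
      simp only [F, F₀]
      ring
    rw [this, norm_mul, norm_mul]
    by_cases h : C q.1 = 0 ∨ C' q.2 = 0
    · rcases h with h | h <;> simp [h]
    · rw [not_or] at h
      refine mul_le_mul_of_nonneg_left ?_ (by positivity)
      have h1 : q.1 ∈ tsupport d.c ×ˢ tsupport χ := by
        by_contra h'
        exact h.1 (d.weight_eq_zero h')
      have h2 : q.2 ∈ tsupport d.conj.c ×ˢ tsupport χ := by
        by_contra h'
        exact h.2 (d.conj.weight_eq_zero h')
      have hb : ∀ y, χ y ≠ 0 → y ∈ Metric.ball (0 : Spacetime) r := fun y hy => by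
        by_contra h'
        exact hy (by rw [bumpTestFn_apply, normed_eq_zero_of_notMem ψ h', Complex.ofReal_zero])
      have hy1 : χ q.1.2 ≠ 0 := fun h0 => h.1 (by simp [C, weight, h0])
      have hy2 : χ q.2.2 ≠ 0 := fun h0 => h.2 (by simp [C', weight, h0])
      have hc2 : q.2.1 ∈ K := by
        refine subset_tsupport _ fun h0 => h.2 ?_
        simp [C', weight, conj, h0]
      have := hvQ (q.2.2, q.1.2) (hball (by
        rw [show (0 : Spacetime × Spacetime) = (0, 0) from rfl, ← ball_prod_same]
        exact ⟨hb _ hy2, hb _ hy1⟩)) (q.2.1, q.1.1) ⟨hc2, h1.1⟩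
      simp only [Set.mem_ofPred_eq, dist_eq_norm] at this
      exact this.le
  have hint : Integrable fun q : (ℝ × Spacetime) × (ℝ × Spacetime) => ‖C q.1‖ * ‖C' q.2‖ * η' :=
    ((d.integrable_weight χ).norm.mul_prod (d.conj.integrable_weight χ).norm).mul_const η'
  refine (norm_integral_le_of_norm_le hint (Eventually.of_forall hbound)).trans ?_
  rw [integral_mul_const, Measure.volume_eq_prod (ℝ × Spacetime),
    integral_prod_mul (fun p => ‖C p‖) (fun p => ‖C' p‖), d.integral_norm_weight ψ,
    d.conj.integral_norm_weight ψ]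
  have : ∫ τ, ‖d.conj.c τ‖ = N := by simp [conj, hN]
  rw [this, hη', mul_div_assoc', div_le_iff₀ (by positivity)]
  nlinarith

end CurveData

end

section

/-- Integrability is not needed because the Bochner integral of a non-integrable function is zero.
Bounds can therefore pass to `ENNReal` before the vacuum contribution is known to be finite. -/
theorem ofReal_integral_le_lintegral {X : Type*} [MeasurableSpace X] {μ : Measure X} (f : X → ℝ) :
    ENNReal.ofReal (∫ x, f x ∂μ) ≤ ∫⁻ x, ENNReal.ofReal (f x) ∂μ := by
  by_cases hf : Integrable f μ
  · rw [integral_eq_lintegral_pos_part_sub_lintegral_neg_part hf]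
    exact (ENNReal.ofReal_le_ofReal (sub_le_self _ ENNReal.toReal_nonneg)).trans
      ENNReal.ofReal_toReal_le
  · simp [integral_undef hf]

/-! ### Plane waves -/

/-- The Minkowski product of the lightlike momentum with spatial part `k` and the vector `x`. -/
def phase (k : ℝ × ℂ) : Spacetime →L[ℝ] ℝ :=
  energy k • ContinuousLinearMap.proj 0 - k.1 • ContinuousLinearMap.proj 1 -
    k.2.re • ContinuousLinearMap.proj 2 - k.2.im • ContinuousLinearMap.proj 3

theorem phase_apply (k : ℝ × ℂ) (x : Spacetime) :
    phase k x = energy k * x 0 - k.1 * x 1 - k.2.re * x 2 - k.2.im * x 3 := rfl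

/-- The positive frequency plane wave with momentum `k`. -/
def planeWave (k : ℝ × ℂ) (x : Spacetime) : ℂ := Complex.exp (Complex.I * (phase k x : ℝ))

theorem norm_planeWave (k : ℝ × ℂ) (x : Spacetime) : ‖planeWave k x‖ = 1 := by
  rw [planeWave, Complex.norm_exp_I_mul_ofReal]

theorem planeWave_add (k : ℝ × ℂ) (x y : Spacetime) :
    planeWave k (x + y) = planeWave k x * planeWave k y := by
  rw [planeWave, planeWave, planeWave, ← Complex.exp_add, map_add]
  push_cast
  ring_nf

@[fun_prop]
theorem continuous_planeWave_comp {X : Type*} [TopologicalSpace X] {k : X → ℝ × ℂ}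
    {x : X → Spacetime} (hk : Continuous k) (hx : Continuous x) :
    Continuous fun t => planeWave (k t) (x t) := by
  simp only [planeWave, phase_apply]
  fun_prop

theorem hasFDerivAt_planeWave (k : ℝ × ℂ) (x : Spacetime) :
    HasFDerivAt (planeWave k)
      (planeWave k x • (Complex.I • (Complex.ofRealCLM.comp (phase k)))) x := by
  have h := ((Complex.ofRealCLM.comp (phase k)).hasFDerivAt (x := x)).const_smul Complex.I
  exact h.cexp

theorem fderiv_planeWave_apply (k : ℝ × ℂ) (x v : Spacetime) :
    fderiv ℝ (planeWave k) x v = Complex.I * (phase k v : ℝ) * planeWave k x := by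
  rw [(hasFDerivAt_planeWave k x).fderiv]
  simp only [smul_apply, ContinuousLinearMap.comp_apply,
    Complex.ofRealCLM_apply, smul_eq_mul]
  ring

theorem contDiff_planeWave (k : ℝ × ℂ) : ContDiff ℝ 1 (planeWave k) := by
  unfold planeWave
  exact (contDiff_const.mul (Complex.ofRealCLM.contDiff.comp (phase k).contDiff)).cexp

/-- The vacuum kernel as a superposition of plane waves. -/
theorem vacuumKernel_eq_integral {ε : ℝ} (hε : 0 < ε) (x x' : Spacetime) :
    vacuumKernel ε x x' = ((1 / (16 * Real.pi ^ 3) : ℝ) : ℂ) *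
      ∫ k : ℝ × ℂ, ((Real.exp (-(ε * energy k)) / energy k : ℝ) : ℂ) *
        (star (planeWave k x) * planeWave k x') := by
  have h := integral_cexp_neg_energy (a := ε + Complex.I * (x 0 - x' 0 : ℝ)) (by simpa)
    (x 1 - x' 1, ⟨x 2 - x' 2, x 3 - x' 3⟩)
  have hs : (x 1 - x' 1) ^ 2 + ‖(⟨x 2 - x' 2, x 3 - x' 3⟩ : ℂ)‖ ^ 2 = spatialSq x x' := by
    rw [← Complex.normSq_eq_norm_sq, Complex.normSq_mk, spatialSq]
    ring
  rw [hs] at h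
  have e : ∀ k : ℝ × ℂ, ((Real.exp (-(ε * energy k)) / energy k : ℝ) : ℂ) *
        (star (planeWave k x) * planeWave k x') =
      Complex.exp (-((ε + Complex.I * (x 0 - x' 0 : ℝ)) * energy k)) / energy k *
      Complex.exp (Complex.I * (k.1 * (x 1 - x' 1) + k.2.re * (x 2 - x' 2) +
        k.2.im * (x 3 - x' 3) : ℝ)) := fun k => by
    have : star (planeWave k x) = Complex.exp (-(Complex.I * (phase k x : ℝ))) := by
      rw [planeWave]
      change (starRingEnd ℂ) _ = _
      rw [← Complex.exp_conj]
      simp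
    rw [this, planeWave, ← Complex.exp_add]
    push_cast
    rw [div_mul_eq_mul_div, div_mul_eq_mul_div, ← Complex.exp_add, ← Complex.exp_add]
    congr 2
    rw [phase_apply, phase_apply]
    push_cast
    ring
  simp only [e]
  rw [h, vacuumKernel_eq]
  have h0 := vacuumKernel_den_ne_zero hε x x'
  have hpi : (Real.pi : ℂ) ≠ 0 := by exact_mod_cast Real.pi_ne_zero
  push_cast at h0 ⊢
  field_simp
  norm_num

/-- The Fourier transform of a test function on the light cone. -/
def onShell (f : TestFn) (k : ℝ × ℂ) : ℂ := ∫ x, f x * planeWave k x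

theorem continuous_onShell (f : TestFn) : Continuous (onShell f) := by
  rw [← continuousOn_univ]
  refine continuousOn_integral_of_compact_support f.hasCompactSupport
    (Continuous.continuousOn (by fun_prop)) fun k x _ hx => ?_
  rw [image_eq_zero_of_notMem_tsupport hx, zero_mul]

theorem integrable_testFn (f : TestFn) : Integrable f :=
  f.continuous.integrable_of_hasCompactSupport f.hasCompactSupport

theorem norm_onShell_le (f : TestFn) (k : ℝ × ℂ) : ‖onShell f k‖ ≤ ∫ x, ‖f x‖ := by
  refine (norm_integral_le_integral_norm _).trans_eq ?_
  simp [norm_planeWave]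

theorem integral_vacuumKernel {ε : ℝ} (hε : 0 < ε) (f : TestFn) :
    ∫ x, ∫ x', conjTestFn f x * f x' * vacuumKernel ε x x' =
      ((1 / (16 * Real.pi ^ 3) * ∫ k : ℝ × ℂ, Real.exp (-(ε * energy k)) / energy k *
        ‖onShell f k‖ ^ 2 : ℝ) : ℂ) := by
  let h : ℝ × ℂ → ℂ := fun k => ((Real.exp (-(ε * energy k)) / energy k : ℝ) : ℂ)
  have hh : Integrable h := (integrable_exp_neg_energy_div hε).ofReal
  have e1 : ∀ x, ∫ x', conjTestFn f x * f x' * vacuumKernel ε x x' =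
      ((1 / (16 * Real.pi ^ 3) : ℝ) : ℂ) *
        ∫ k, conjTestFn f x * (h k * (star (planeWave k x) * onShell f k)) := fun x => by
    have h1 : ∀ x', conjTestFn f x * f x' * vacuumKernel ε x x' =
        ((1 / (16 * Real.pi ^ 3) : ℝ) : ℂ) * (conjTestFn f x *
          ∫ k, f x' * (h k * (star (planeWave k x) * planeWave k x'))) := fun x' => by
      rw [vacuumKernel_eq_integral hε, integral_const_mul]
      ring
    simp only [h1]
    rw [integral_const_mul, integral_const_mul, integral_integral_swap]
    · rw [← integral_const_mul]
      congr 1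
      refine integral_congr_ae (Eventually.of_forall fun k => ?_)
      simp only [onShell]
      rw [← integral_const_mul, ← integral_const_mul, ← integral_const_mul, ← integral_const_mul]
      refine integral_congr_ae (Eventually.of_forall fun x' => ?_)
      simp only
      ring
    · have i1 : Integrable fun q : Spacetime × (ℝ × ℂ) => f q.1 * h q.2 :=
        (integrable_testFn f).mul_prod hh
      have i2 := i1.mul_bdd (c := 1) (g := fun q => star (planeWave q.2 x) * planeWave q.2 q.1)
        (Continuous.aestronglyMeasurable (by fun_prop))
        (Eventually.of_forall fun q => by simp [norm_planeWave])
      refine i2.congr (Eventually.of_forall fun q => ?_)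
      simp only [Function.uncurry]
      ring
  simp only [e1]
  rw [integral_const_mul, integral_integral_swap]
  · push_cast
    congr 1
    rw [← integral_complex_ofReal]
    refine integral_congr_ae (Eventually.of_forall fun k => ?_)
    have h2 : star (onShell f k) = ∫ x, conjTestFn f x * star (planeWave k x) := by
      change (starRingEnd ℂ) _ = _
      rw [onShell, ← integral_conj]
      refine integral_congr_ae (Eventually.of_forall fun x => ?_)
      simp
    have h3 : ∀ x, conjTestFn f x * (h k * (star (planeWave k x) * onShell f k)) =
        (h k * onShell f k) * (conjTestFn f x * star (planeWave k x)) := fun x => by ring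
    simp only [h3]
    rw [integral_const_mul, ← h2]
    have h4 : onShell f k * star (onShell f k) = ((‖onShell f k‖ ^ 2 : ℝ) : ℂ) := by
      rw [Complex.ofReal_pow]
      exact Complex.mul_conj' _
    rw [mul_assoc, h4]
    push_cast
    simp [h]
  · have i1 : Integrable fun q : Spacetime × (ℝ × ℂ) => conjTestFn f q.1 * h q.2 :=
      (integrable_testFn (conjTestFn f)).mul_prod hh
    have hc := continuous_onShell f
    have i2 := i1.mul_bdd (c := ∫ x, ‖f x‖)
      (g := fun q => star (planeWave q.2 q.1) * onShell f q.2)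
      (Continuous.aestronglyMeasurable (by fun_prop))
      (Eventually.of_forall fun q => by simpa [norm_planeWave] using norm_onShell_le f q.2)
    refine i2.congr (Eventually.of_forall fun q => ?_)
    simp only [Function.uncurry]
    ring

/-! ### Lower bound from positivity, along an arbitrary curve -/

namespace CurveData

variable (d : CurveData)

/-- The amplitude of the mode `k` along the curve. -/
def amplitude (k : ℝ × ℂ) : ℂ := ∫ τ, d.c τ * ((phase k (d.e τ) : ℝ) * planeWave k (d.γ τ))

/-- Translation covariance of plane waves factors the transform into `i` times the amplitude times
the transform of the bump. The last factor has modulus at most one, being the transform of a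
probability density. The bound is uniform in the bump, so no limit in it is required. -/
theorem norm_onShell_smear_le {x₀ : Spacetime} (ψ : ContDiffBump x₀) (k : ℝ × ℂ) :
    ‖onShell (d.smear (bumpTestFn ψ)) k‖ ≤ ‖d.amplitude k‖ := by
  have h : onShell (d.smear (bumpTestFn ψ)) k =
      Complex.I * d.amplitude k * onShell (bumpTestFn ψ) k := by
    rw [onShell, d.integral_smear_mul _ (contDiff_planeWave k), Measure.volume_eq_prod, amplitude,
      onShell, ← integral_const_mul Complex.I, ← integral_prod_mul]
    refine integral_congr_ae (Eventually.of_forall fun p => ?_)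
    simp only [fderiv_planeWave_apply, planeWave_add, weight]
    ring
  have h1 : ‖onShell (bumpTestFn ψ) k‖ ≤ 1 := by
    refine (norm_onShell_le _ k).trans_eq ?_
    rw [← ψ.integral_normed (μ := volume)]
    refine integral_congr_ae (Eventually.of_forall fun x => ?_)
    simp only [bumpTestFn_apply, Complex.norm_real, Real.norm_of_nonneg (ψ.nonneg_normed x)]
  rw [h, norm_mul, norm_mul, Complex.norm_I, one_mul]
  exact mul_le_of_le_one_right (norm_nonneg _) h1

/-- Positivity of the state bounds the restriction of the normal ordered two-point function to a
curve by the vacuum two-point function on the curve. -/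
theorem ofReal_neg_restriction_le {ω : State} {W : Spacetime × Spacetime → ℂ}
    (hW : ω.IsSmoothRemainder W) :
    ENNReal.ofReal (-(∫ τ', ∫ τ, d.c τ' * (star (d.c τ) * d.restriction W τ τ')).re) ≤
      ENNReal.ofReal (1 / (16 * Real.pi ^ 3)) *
        ∫⁻ k, ENNReal.ofReal (‖d.amplitude k‖ ^ 2 / energy k) := by
  set R := ENNReal.ofReal (1 / (16 * Real.pi ^ 3)) *
        ∫⁻ k, ENNReal.ofReal (‖d.amplitude k‖ ^ 2 / energy k) with hR
  -- An infinite vacuum contribution makes the claim trivial.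
  rcases eq_or_ne R ⊤ with h | h
  · rw [h]
    exact le_top
  refine ENNReal.ofReal_le_of_le_toReal (le_of_forall_pos_le_add fun η hη => ?_)
  obtain ⟨ψ, hψ⟩ := d.exists_bump_norm_sub_le hW.1 hη
  set f := d.smear (bumpTestFn ψ)
  have hf : conjTestFn f = d.conj.smear (bumpTestFn ψ) := d.conj_smear (conjTestFn_bumpTestFn ψ)
  rw [← hf] at hψ
  have hlim := (Complex.continuous_re.tendsto _).comp (hW.2 (conjTestFn f) f)
  -- This difference is the vacuum two-point function. Dropping `e^{-ε|k|} ≤ 1` and bounding the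
  -- on-shell transform by the amplitude gives an estimate uniform in `ε`.
  have hle : (ω.twoPoint (conjTestFn f) f -
      ∫ x, ∫ x', conjTestFn f x * f x' * W (x, x')).re ≤ R.toReal := by
    refine le_of_tendsto hlim ?_
    filter_upwards [self_mem_nhdsWithin] with ε hε
    have hε' : 0 < ε := hε
    simp only [Function.comp_apply]
    rw [integral_vacuumKernel hε', Complex.ofReal_re, ← ENNReal.ofReal_le_iff_le_toReal h,
      ENNReal.ofReal_mul (by positivity), hR]
    gcongr
    refine (ofReal_integral_le_lintegral _).trans (lintegral_mono fun k => ?_)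
    refine ENNReal.ofReal_le_ofReal ?_
    have hexp : Real.exp (-(ε * energy k)) ≤ 1 :=
      Real.exp_le_one_iff.2 (neg_nonpos.2 (mul_nonneg hε'.le (energy_nonneg k)))
    have hn := d.norm_onShell_smear_le ψ k
    have he := energy_nonneg k
    calc Real.exp (-(ε * energy k)) / energy k * ‖onShell f k‖ ^ 2
        ≤ 1 / energy k * ‖d.amplitude k‖ ^ 2 := by gcongr
      _ = _ := by ring
  -- Positivity of the state enters here.
  have hpos := (ω.twoPoint_conj_self f).1
  rw [Complex.sub_re] at hle
  have := (Complex.abs_re_le_norm _).trans hψ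
  rw [Complex.sub_re, abs_le] at this
  linarith [this.2]

end CurveData

end

section

/-! ### Uniform acceleration in rapidity coordinates -/

/-- The uniformly accelerated worldline parametrised by rapidity. -/
def rindlerCurve (ξ u : ℝ) : Spacetime := ![ξ * Real.sinh u, ξ * Real.cosh u, 0, 0]

/-- An orthonormal frame along the uniformly accelerated worldline. -/
def rindlerFrame (j : Fin 4) (u : ℝ) : Spacetime :=
  ![![Real.cosh u, Real.sinh u, 0, 0], ![Real.sinh u, Real.cosh u, 0, 0], ![0, 0, 1, 0],
    ![0, 0, 0, 1]] j

theorem contDiff_rindlerCurve (ξ : ℝ) : ContDiff ℝ (⊤ : ℕ∞) (rindlerCurve ξ) := by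
  rw [contDiff_pi]
  intro i
  have h1 : ContDiff ℝ (⊤ : ℕ∞) Real.sinh := Real.contDiff_sinh
  have h2 : ContDiff ℝ (⊤ : ℕ∞) Real.cosh := Real.contDiff_cosh
  fin_cases i
  · exact contDiff_const.mul h1
  · exact contDiff_const.mul h2
  · exact contDiff_const
  · exact contDiff_const

theorem contDiff_rindlerFrame (j : Fin 4) : ContDiff ℝ (⊤ : ℕ∞) (rindlerFrame j) := by
  rw [contDiff_pi]
  intro i
  have h1 : ContDiff ℝ (⊤ : ℕ∞) Real.sinh := Real.contDiff_sinh
  have h2 : ContDiff ℝ (⊤ : ℕ∞) Real.cosh := Real.contDiff_cosh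
  fin_cases j <;> fin_cases i <;> first | exact h1 | exact h2 | exact contDiff_const

/-- Smearing along the accelerated worldline with the weight `g(u) e^{iαu}`. -/
def rindlerData (ξ : ℝ) (j : Fin 4) (α : ℝ) {g : ℝ → ℝ} (hg : ContDiff ℝ (⊤ : ℕ∞) g)
    (hgc : HasCompactSupport g) : CurveData where
  γ := rindlerCurve ξ
  e := rindlerFrame j
  c u := g u * Complex.exp (Complex.I * (α * u : ℝ))
  contDiff_γ := contDiff_rindlerCurve ξ
  contDiff_e := contDiff_rindlerFrame j
  contDiff_c := (Complex.ofRealCLM.contDiff.comp hg).mul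
    (contDiff_const.mul (Complex.ofRealCLM.contDiff.comp (contDiff_const.mul contDiff_id))).cexp
  hasCompactSupport_c := (hgc.comp_left (g := fun r : ℝ => (r : ℂ)) (by simp)).mul_right

/-- The plane wave of a lightlike momentum along the accelerated worldline, damped by a complex
shift of the rapidity. -/
def dampedWave (ξ η κ x : ℝ) : ℂ :=
  Complex.exp (((ξ * κ : ℝ) : ℂ) * (Complex.I * (Real.cos η * Real.sinh x : ℝ) -
    (Real.sin η * Real.cosh x : ℝ)))

/-- The amplitude of the mode with transverse momentum `κ` and rapidity `θ`. -/
def modeAmplitude (ξ : ℝ) (g v : ℝ → ℝ) (η α κ θ : ℝ) : ℂ :=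
  ∫ u, g u * (Complex.exp (Complex.I * (α * u : ℝ)) * (v (u - θ) * dampedWave ξ η κ (u - θ)))

/-- The density of the vacuum contribution in frequency, transverse momentum and rapidity. -/
def modeDensity (ξ : ℝ) (g : ℝ → ℝ) (η : ℝ) (p : ℝ × ℝ × ℝ) : ℝ :=
  Real.exp (-(2 * η * p.1)) * (p.2.1 ^ 3 *
    (‖modeAmplitude ξ g Real.cosh η p.1 p.2.1 p.2.2‖ ^ 2 +
      ‖modeAmplitude ξ g Real.sinh η p.1 p.2.1 p.2.2‖ ^ 2 +
      ‖modeAmplitude ξ g (fun _ => 1) η p.1 p.2.1 p.2.2‖ ^ 2))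

theorem continuous_modeAmplitude (ξ : ℝ) {g v : ℝ → ℝ} (hg : Continuous g)
    (hgc : HasCompactSupport g) (hv : Continuous v) :
    Continuous fun q : ℝ × ℝ × ℝ × ℝ => modeAmplitude ξ g v q.1 q.2.1 q.2.2.1 q.2.2.2 := by
  rw [← continuousOn_univ]
  refine continuousOn_integral_of_compact_support (k := tsupport g) hgc
    (Continuous.continuousOn ?_) fun p u _ hu => ?_
  · simp only [Function.uncurry_def, dampedWave]
    fun_prop
  · rw [image_eq_zero_of_notMem_tsupport hu, Complex.ofReal_zero, zero_mul]

theorem continuous_modeDensity (ξ : ℝ) {g : ℝ → ℝ} (hg : Continuous g)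
    (hgc : HasCompactSupport g) :
    Continuous fun q : ℝ × ℝ × ℝ × ℝ => modeDensity ξ g q.1 q.2 := by
  have h1 := continuous_modeAmplitude ξ hg hgc Real.continuous_cosh
  have h2 := continuous_modeAmplitude ξ hg hgc Real.continuous_sinh
  have h3 := continuous_modeAmplitude ξ hg hgc (continuous_const (y := (1 : ℝ)))
  unfold modeDensity
  fun_prop

/-- The substitution `k = κ sinh θ` introduces the rapidity; its Jacobian `κ cosh θ` will cancel the
energy in the measure `d³k/|k|`. -/
theorem lintegral_comp_const_mul_sinh {κ : ℝ} (hκ : 0 < κ) (G : ℝ → ENNReal) :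
    ∫⁻ k, G k = ∫⁻ θ, ENNReal.ofReal (κ * Real.cosh θ) * G (κ * Real.sinh θ) := by
  have h := lintegral_image_eq_lintegral_abs_deriv_mul (s := Set.univ) MeasurableSet.univ
    (f := fun θ => κ * Real.sinh θ) (f' := fun θ => κ * Real.cosh θ)
    (fun θ _ => ((Real.hasDerivAt_sinh θ).const_mul κ).hasDerivWithinAt)
    (fun a _ b _ hab => Real.sinh_injective (mul_left_cancel₀ hκ.ne' hab)) G
  have hs : Function.Surjective fun θ => κ * Real.sinh θ := fun y =>
    ⟨Real.arsinh (y / κ), by simp [Real.sinh_arsinh]; field_simp⟩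
  rw [Set.image_univ, hs.range_eq, setLIntegral_univ, setLIntegral_univ] at h
  rw [h]
  refine lintegral_congr fun θ => ?_
  rw [abs_of_pos (mul_pos hκ (Real.cosh_pos θ))]

theorem energy_mul_sinh {κ θ : ℝ} {q : ℂ} (hκ : 0 < κ) (hq : ‖q‖ = κ) :
    energy (κ * Real.sinh θ, q) = κ * Real.cosh θ := by
  rw [energy, hq, show (κ * Real.sinh θ) ^ 2 + κ ^ 2 = (κ * Real.cosh θ) ^ 2 by
    rw [mul_pow, mul_pow, Real.cosh_sq]
    ring, Real.sqrt_sq (mul_pos hκ (Real.cosh_pos θ)).le]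

/-- Boost covariance: contracting the momentum with the frame gives `κ cosh(u - θ)`, `κ sinh(u - θ)`
and two transverse components whose squares sum to `κ²`, while the phase is `ξκ sinh(u - θ)`. Thus
only `κ`, `θ` and `α` matter. The prefactor `κ` on the left is the Jacobian of polar coordinates in
the transverse plane. -/
theorem sum_norm_amplitude_sq {ξ α κ θ : ℝ} {q : ℂ} (hκ : 0 < κ) (hq : ‖q‖ = κ) {g : ℝ → ℝ}
    (hg : ContDiff ℝ (⊤ : ℕ∞) g) (hgc : HasCompactSupport g) :
    κ * ∑ j, ‖(rindlerData ξ j α hg hgc).amplitude (κ * Real.sinh θ, q)‖ ^ 2 =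
      modeDensity ξ g 0 (α, κ, θ) := by
  have hE := energy_mul_sinh (θ := θ) hκ hq
  have hw : ∀ u, planeWave (κ * Real.sinh θ, q) (rindlerCurve ξ u) = dampedWave ξ 0 κ (u - θ) := by
    intro u
    rw [planeWave, dampedWave, phase_apply, hE, Real.sinh_sub]
    simp [rindlerCurve]
    ring_nf
  have hamp : ∀ (j : Fin 4) (r : ℝ) (v : ℝ → ℝ),
      (∀ u, phase (κ * Real.sinh θ, q) (rindlerFrame j u) = r * v (u - θ)) →
      (rindlerData ξ j α hg hgc).amplitude (κ * Real.sinh θ, q) =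
        (r : ℂ) * modeAmplitude ξ g v 0 α κ θ := by
    intro j r v h
    rw [CurveData.amplitude, modeAmplitude, ← integral_const_mul]
    refine integral_congr_ae (Eventually.of_forall fun u => ?_)
    simp only [rindlerData, h, hw]
    push_cast
    ring
  have h0 := hamp 0 κ Real.cosh fun u => by
    rw [phase_apply, hE, Real.cosh_sub]
    simp [rindlerFrame]
    ring
  have h1 := hamp 1 κ Real.sinh fun u => by
    rw [phase_apply, hE, Real.sinh_sub]
    simp [rindlerFrame]
    ring
  have h2 := hamp 2 (-q.re) (fun _ => 1) fun u => by
    rw [phase_apply]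
    simp [rindlerFrame]
  have h3 := hamp 3 (-q.im) (fun _ => 1) fun u => by
    rw [phase_apply]
    simp [rindlerFrame]
  have hq2 : q.re ^ 2 + q.im ^ 2 = κ ^ 2 := by
    rw [← hq, ← Complex.normSq_eq_norm_sq, Complex.normSq_apply]
    ring
  rw [Fin.sum_univ_four, h0, h1, h2, h3]
  simp only [norm_mul, Complex.norm_real, Real.norm_eq_abs, mul_pow, sq_abs, modeDensity]
  simp only [mul_zero, zero_mul, neg_zero, Real.exp_zero, one_mul, neg_sq]
  linear_combination κ * ‖modeAmplitude ξ g (fun _ => 1) 0 α κ θ‖ ^ 2 * hq2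

theorem continuous_amplitude (d : CurveData) : Continuous d.amplitude := by
  rw [← continuousOn_univ]
  refine continuousOn_integral_of_compact_support (k := tsupport d.c) d.hasCompactSupport_c
    (Continuous.continuousOn ?_) fun p u _ hu => ?_
  · simp only [Function.uncurry_def, phase_apply]
    fun_prop
  · rw [image_eq_zero_of_notMem_tsupport hu, zero_mul]

/-- The total vacuum contribution at frequency `α`, in transverse momentum and rapidity. -/
theorem lintegral_sum_amplitude (ξ α : ℝ) {g : ℝ → ℝ}
    (hg : ContDiff ℝ (⊤ : ℕ∞) g) (hgc : HasCompactSupport g) :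
    ∫⁻ k, ENNReal.ofReal (∑ j, ‖(rindlerData ξ j α hg hgc).amplitude k‖ ^ 2 / energy k) =
      ENNReal.ofReal (2 * Real.pi) * ∫⁻ p : ℝ × ℝ,
        ENNReal.ofReal (modeDensity ξ g 0 (α, p)) ∂((volume.restrict (Set.Ioi 0)).prod volume) := by
  have hamp : ∀ j, Continuous (rindlerData ξ j α hg hgc).amplitude := fun j =>
    continuous_amplitude _
  have hm : Measurable fun k : ℝ × ℂ =>
      ENNReal.ofReal (∑ j, ‖(rindlerData ξ j α hg hgc).amplitude k‖ ^ 2 / energy k) := by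
    refine ENNReal.measurable_ofReal.comp (Finset.measurable_sum _ fun j _ => ?_)
    exact ((hamp j).norm.pow 2).measurable.div continuous_energy.measurable
  have hc : Continuous fun p : ℝ × ℝ => modeDensity ξ g 0 (α, p) :=
    (continuous_modeDensity ξ hg.continuous hgc).comp (by fun_prop :
      Continuous fun p : ℝ × ℝ => ((0 : ℝ), α, p))
  have hm2 : Measurable fun p : ℝ × ℝ => ENNReal.ofReal (modeDensity ξ g 0 (α, p)) :=
    hc.measurable.ennreal_ofReal
  rw [Measure.volume_eq_prod, lintegral_prod_symm' _ hm, lintegral_prod _ hm2.aemeasurable,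
    ← Complex.lintegral_comp_polarCoord_symm, polarCoord_target]
  have e1 : ∀ p ∈ Set.Ioi (0 : ℝ) ×ˢ Set.Ioo (-Real.pi) Real.pi,
      ENNReal.ofReal p.1 • ∫⁻ k, ENNReal.ofReal (∑ j, ‖(rindlerData ξ j α hg hgc).amplitude
        (k, Complex.polarCoord.symm p)‖ ^ 2 / energy (k, Complex.polarCoord.symm p)) =
      ∫⁻ θ, ENNReal.ofReal (modeDensity ξ g 0 (α, p.1, θ)) := by
    intro p hp
    have hκ : 0 < p.1 := hp.1
    have hq : ‖Complex.polarCoord.symm p‖ = p.1 := by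
      rw [Complex.norm_polarCoord_symm, abs_of_pos hκ]
    rw [lintegral_comp_const_mul_sinh hκ, smul_eq_mul, ← lintegral_const_mul']
    swap
    · exact ENNReal.ofReal_ne_top
    refine lintegral_congr fun θ => ?_
    have hcosh := Real.cosh_pos θ
    rw [← ENNReal.ofReal_mul (by positivity), ← ENNReal.ofReal_mul hκ.le,
      ← sum_norm_amplitude_sq (θ := θ) hκ hq hg hgc, energy_mul_sinh hκ hq, ← Finset.sum_div]
    congr 1
    field_simp
  rw [setLIntegral_congr_fun (measurableSet_Ioi.prod measurableSet_Ioo) e1, Measure.volume_eq_prod,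
    ← Measure.prod_restrict]
  have hm3 : Measurable fun κ : ℝ => ∫⁻ θ, ENNReal.ofReal (modeDensity ξ g 0 (α, κ, θ)) :=
    hm2.lintegral_prod_right'
  have hm4 : Measurable fun p : ℝ × ℝ => ∫⁻ θ, ENNReal.ofReal (modeDensity ξ g 0 (α, p.1, θ)) :=
    hm3.comp measurable_fst
  rw [lintegral_prod _ hm4.aemeasurable]
  -- Nothing depends on the polar angle, which contributes the factor `2π`.
  simp only [lintegral_const, Measure.restrict_apply_univ, Real.volume_Ioo]
  rw [lintegral_mul_const _ hm3, mul_comm]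
  congr 2
  ring

end

section

/-! ### The Poisson kernel -/

theorem integral_exp_neg_mul_cos {δ : ℝ} (hδ : 0 < δ) (s : ℝ) :
    ∫ α in Set.Ioi (0 : ℝ), Real.exp (-(δ * α)) * Real.cos (α * s) = δ / (δ ^ 2 + s ^ 2) := by
  set a : ℂ := ⟨-δ, s⟩ with ha
  have har : a.re < 0 := by simpa [ha]
  have h := integral_exp_mul_complex_Ioi har 0
  have hi := integrableOn_exp_mul_complex_Ioi har 0
  have e : ∀ α : ℝ, Real.exp (-(δ * α)) * Real.cos (α * s) = (Complex.exp (a * α)).re := fun α => by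
    rw [Complex.exp_re, Complex.re_mul_ofReal, Complex.im_mul_ofReal]
    simp only [ha]
    ring_nf
  simp only [e]
  have h2 := Complex.reCLM.integral_comp_comm hi
  simp only [Complex.reCLM_apply] at h2
  rw [h2, h]
  simp only [Complex.ofReal_zero, mul_zero, Complex.exp_zero]
  rw [neg_div, one_div, Complex.neg_re, Complex.inv_re, Complex.normSq_apply]
  simp only [ha]
  rw [← neg_div, neg_neg]
  congr 1
  ring

/-- Abel regularisation of `∫₀^∞ cos(αs) dα = π δ(s)`: the factor `e^{-δα}` makes Fubini legitimate
and yields the Poisson kernel. -/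
theorem integral_exp_neg_mul_integral_cos {Φ : ℝ × ℝ → ℝ} (hΦ : Continuous Φ)
    (hΦc : HasCompactSupport Φ) {δ : ℝ} (hδ : 0 < δ) :
    ∫ α in Set.Ioi (0 : ℝ), Real.exp (-(δ * α)) * ∫ q : ℝ × ℝ, Φ q * Real.cos (α * (q.2 - q.1)) =
      ∫ q : ℝ × ℝ, Φ q * (δ / (δ ^ 2 + (q.2 - q.1) ^ 2)) := by
  simp only [← integral_const_mul]
  rw [integral_integral_swap]
  · refine integral_congr_ae (Eventually.of_forall fun q => ?_)
    simp only
    rw [← integral_exp_neg_mul_cos hδ, ← integral_const_mul]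
    refine integral_congr_ae (Eventually.of_forall fun α => ?_)
    simp only
    ring
  · have h1 : IntegrableOn (fun α : ℝ => Real.exp (-(δ * α))) (Set.Ioi 0) := by
      simpa using integrableOn_pow_mul_exp_neg_mul hδ 0
    have h2 : Integrable Φ := hΦ.integrable_of_hasCompactSupport hΦc
    have h3 := (h1.mul_prod h2).mul_bdd (c := 1)
      (g := fun p : ℝ × ℝ × ℝ => Real.cos (p.1 * (p.2.2 - p.2.1)))
      (Continuous.aestronglyMeasurable (by fun_prop))
      (Eventually.of_forall fun p => by simpa using Real.abs_cos_le_one _)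
    refine h3.congr (Eventually.of_forall fun p => ?_)
    simp only [Function.uncurry]
    ring

/-- The Poisson kernel is an approximate identity. -/
theorem tendsto_integral_poisson {Φ : ℝ × ℝ → ℝ} (hΦ : Continuous Φ) (hΦc : HasCompactSupport Φ) :
    Tendsto (fun δ : ℝ => ∫ q : ℝ × ℝ, Φ q * (δ / (δ ^ 2 + (q.2 - q.1) ^ 2))) (𝓝[>] 0)
      (𝓝 (Real.pi * ∫ u, Φ (u, u))) := by
  obtain ⟨M, hM⟩ := hΦ.bounded_above_of_compact_support hΦc
  set K : Set ℝ := Prod.fst '' tsupport Φ with hK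
  have hKc : IsCompact K := hΦc.isCompact.image continuous_fst
  have hKz : ∀ x y, x ∉ K → Φ (x, y) = 0 := fun x y hx => by
    by_contra h
    exact hx ⟨(x, y), subset_tsupport _ h, rfl⟩
  -- The substitution `q.2 = q.1 + δ v` turns the kernel into the fixed integrable function `1/(1 +
  -- v²)`, of total mass `π`, so dominated convergence applies.
  let G : ℝ → ℝ × ℝ → ℝ := fun δ p => Φ (p.1, p.1 + δ * p.2) * (1 + p.2 ^ 2)⁻¹
  let bound : ℝ × ℝ → ℝ := fun p => K.indicator (fun _ => M) p.1 * (1 + p.2 ^ 2)⁻¹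
  have hbi : Integrable bound := by
    refine Integrable.mul_prod ?_ integrable_inv_one_add_sq
    exact (integrable_indicator_iff hKc.measurableSet).2
      (integrableOn_const (hs := hKc.measure_lt_top.ne))
  have hbd : ∀ δ p, ‖G δ p‖ ≤ bound p := fun δ p => by
    simp only [G, bound]
    rw [norm_mul, Real.norm_of_nonneg (by positivity : 0 ≤ (1 + p.2 ^ 2)⁻¹)]
    refine mul_le_mul_of_nonneg_right ?_ (by positivity)
    by_cases h : p.1 ∈ K
    · rw [Set.indicator_of_mem h]
      exact hM _
    · simp [hKz _ _ h, h]
  have hGc : ∀ δ, Continuous (G δ) := fun δ =>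
    (hΦ.comp (by fun_prop)).mul (Continuous.inv₀ (by fun_prop) fun p => by positivity)
  have hGi : ∀ δ, Integrable (G δ) := fun δ =>
    hbi.mono' (hGc δ).aestronglyMeasurable (Eventually.of_forall (hbd δ))
  have hlim : Tendsto (fun δ : ℝ => ∫ p, G δ p) (𝓝[>] 0) (𝓝 (∫ p, G 0 p)) := by
    refine tendsto_integral_filter_of_dominated_convergence bound
      (Eventually.of_forall fun δ => (hGc δ).aestronglyMeasurable)
      (Eventually.of_forall fun δ => Eventually.of_forall (hbd δ)) hbi
      (Eventually.of_forall fun p => ?_)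
    have : Continuous fun δ : ℝ => G δ p := (hΦ.comp (by fun_prop)).mul continuous_const
    exact (this.tendsto 0).mono_left nhdsWithin_le_nhds
  have h0 : ∫ p, G 0 p = Real.pi * ∫ u, Φ (u, u) := by
    simp only [G, zero_mul, add_zero]
    rw [Measure.volume_eq_prod, integral_prod_mul (fun u => Φ (u, u)) (fun v : ℝ => (1 + v ^ 2)⁻¹),
      integral_univ_inv_one_add_sq, mul_comm]
  rw [h0] at hlim
  refine hlim.congr' ?_
  filter_upwards [self_mem_nhdsWithin] with δ hδ
  have hδ' : 0 < δ := hδ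
  have hF : Integrable fun q : ℝ × ℝ => Φ q * (δ / (δ ^ 2 + (q.2 - q.1) ^ 2)) := by
    refine (Continuous.integrable_of_hasCompactSupport ?_ hΦc.mul_right)
    exact hΦ.mul (Continuous.div (by fun_prop) (by fun_prop) fun q => by positivity)
  rw [Measure.volume_eq_prod, integral_prod _ hF, integral_prod _ (hGi δ)]
  refine integral_congr_ae (Eventually.of_forall fun x => ?_)
  simp only
  rw [← integral_add_left_eq_self (fun y => Φ (x, y) * (δ / (δ ^ 2 + (y - x) ^ 2))) x]
  have := Measure.integral_comp_mul_left
    (fun y => Φ (x, x + y) * (δ / (δ ^ 2 + (x + y - x) ^ 2))) δ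
  rw [abs_of_pos (inv_pos.2 hδ'), smul_eq_mul, inv_mul_eq_div, eq_div_iff hδ'.ne',
    ← integral_mul_const] at this
  rw [← this]
  refine integral_congr_ae (Eventually.of_forall fun v => ?_)
  simp only [G]
  field_simp
  ring

/-! ### The bound in terms of vacuum modes -/

/-- Twice the energy density, split along the accelerated worldline. -/
def rindlerForm (ξ : ℝ) (W : Spacetime × Spacetime → ℂ) (u u' : ℝ) : ℝ :=
  ∑ j, (mixedForm W (rindlerCurve ξ u, rindlerCurve ξ u') (rindlerFrame j u)
    (rindlerFrame j u')).re

theorem continuous_rindlerForm (ξ : ℝ) {W : Spacetime × Spacetime → ℂ}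
    (hW : ContDiff ℝ (⊤ : ℕ∞) W) {X : Type*} [TopologicalSpace X] {a b : X → ℝ}
    (ha : Continuous a) (hb : Continuous b) :
    Continuous fun x => rindlerForm ξ W (a x) (b x) := by
  have h1 := (contDiff_rindlerCurve ξ).continuous
  unfold rindlerForm
  refine continuous_finsetSum _ fun j _ => Complex.continuous_re.comp ?_
  have h2 := (contDiff_rindlerFrame j).continuous
  exact continuous_mixedForm hW (by fun_prop) (by fun_prop) (by fun_prop)

variable {ξ : ℝ} {W : Spacetime × Spacetime → ℂ} {g : ℝ → ℝ}

/-- The energy density, smeared against the product of two copies of `g`. -/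
def smearedForm (ξ : ℝ) (W : Spacetime × Spacetime → ℂ) (g : ℝ → ℝ) (q : ℝ × ℝ) : ℝ :=
  g q.1 * (g q.2 * rindlerForm ξ W q.2 q.1)

theorem continuous_smearedForm (hW : ContDiff ℝ (⊤ : ℕ∞) W) (hg : Continuous g) :
    Continuous (smearedForm ξ W g) := by
  have h2 := continuous_rindlerForm ξ hW (continuous_snd (X := ℝ) (Y := ℝ)) continuous_fst
  unfold smearedForm
  fun_prop

theorem hasCompactSupport_smearedForm (hgc : HasCompactSupport g) :
    HasCompactSupport (smearedForm ξ W g) := by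
  refine HasCompactSupport.intro (hgc.isCompact.prod hgc.isCompact) fun q hq => ?_
  rw [Set.mem_prod, not_and_or] at hq
  rcases hq with h | h
  · simp [smearedForm, image_eq_zero_of_notMem_tsupport h]
  · simp [smearedForm, image_eq_zero_of_notMem_tsupport h]

/-- The weights combine to `g g e^{-iα(q.2 - q.1)}`. Since `W`, and hence its mixed derivative, is
real, taking the real part leaves only the cosine. -/
theorem sum_re_restriction (hW : ContDiff ℝ (⊤ : ℕ∞) W) (hr : ∀ p, (W p).im = 0)
    (hg : ContDiff ℝ (⊤ : ℕ∞) g) (hgc : HasCompactSupport g) (α : ℝ) :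
    ∑ j, (∫ τ', ∫ τ, (rindlerData ξ j α hg hgc).c τ' * (star ((rindlerData ξ j α hg hgc).c τ) *
      (rindlerData ξ j α hg hgc).restriction W τ τ')).re =
      ∫ q, smearedForm ξ W g q * Real.cos (α * (q.2 - q.1)) := by
  let m : Fin 4 → ℝ × ℝ → ℝ := fun j q =>
    (mixedForm W (rindlerCurve ξ q.2, rindlerCurve ξ q.1) (rindlerFrame j q.2)
      (rindlerFrame j q.1)).re
  have hmc : ∀ j, Continuous (m j) := fun j => by
    have h1 := (contDiff_rindlerCurve ξ).continuous
    have h2 := (contDiff_rindlerFrame j).continuous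
    exact Complex.continuous_re.comp
      (continuous_mixedForm hW (by fun_prop) (by fun_prop) (by fun_prop))
  have hgc' := hg.continuous
  let I : Fin 4 → ℝ × ℝ → ℝ := fun j q => g q.1 * (g q.2 * (m j q * Real.cos (α * (q.2 - q.1))))
  have hI : ∀ j, Integrable (I j) := fun j => by
    have := hmc j
    refine Continuous.integrable_of_hasCompactSupport (by fun_prop) ?_
    refine HasCompactSupport.intro (hgc.isCompact.prod hgc.isCompact) fun q hq => ?_
    rw [Set.mem_prod, not_and_or] at hq
    rcases hq with h | h
    · simp [I, image_eq_zero_of_notMem_tsupport h]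
    · simp [I, image_eq_zero_of_notMem_tsupport h]
  have key : ∀ j, (∫ τ', ∫ τ, (rindlerData ξ j α hg hgc).c τ' *
      (star ((rindlerData ξ j α hg hgc).c τ) *
      (rindlerData ξ j α hg hgc).restriction W τ τ')).re = ∫ q, I j q := fun j => by
    let d := rindlerData ξ j α hg hgc
    let J : ℝ × ℝ → ℂ := fun q => d.c q.1 * (star (d.c q.2) * d.restriction W q.2 q.1)
    have hJc : Continuous J := by
      have h1 := d.continuous_c
      have h2 : Continuous fun q : ℝ × ℝ => d.restriction W q.2 q.1 :=
        d.continuous_restriction hW continuous_snd continuous_fst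
      fun_prop
    have hJ : Integrable J := by
      refine hJc.integrable_of_hasCompactSupport ?_
      refine HasCompactSupport.intro (d.hasCompactSupport_c.isCompact.prod
        d.hasCompactSupport_c.isCompact) fun q hq => ?_
      rw [Set.mem_prod, not_and_or] at hq
      rcases hq with h | h
      · simp [J, image_eq_zero_of_notMem_tsupport h]
      · simp [J, image_eq_zero_of_notMem_tsupport h]
    change (∫ τ', ∫ τ, J (τ', τ)).re = _
    have h1 : ∫ τ', ∫ τ, J (τ', τ) = ∫ q, J q := by
      rw [Measure.volume_eq_prod, integral_prod _ hJ]
    rw [h1]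
    have h2 := Complex.reCLM.integral_comp_comm hJ
    simp only [Complex.reCLM_apply] at h2
    rw [← h2]
    refine integral_congr_ae (Eventually.of_forall fun q => ?_)
    have h3 : d.restriction W q.2 q.1 = (m j q : ℂ) := by
      apply Complex.ext
      · rfl
      · exact mixedForm_im_eq_zero hW hr _ _ _
    have h4 : star (d.c q.2) = g q.2 * Complex.exp (-(Complex.I * (α * q.2 : ℝ))) := by
      change (starRingEnd ℂ) (g q.2 * Complex.exp (Complex.I * (α * q.2 : ℝ))) = _
      rw [map_mul, ← Complex.exp_conj]
      simp
    have h5 : J q = ((g q.1 * (g q.2 * m j q) : ℝ) : ℂ) *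
        Complex.exp ((-(α * (q.2 - q.1)) : ℝ) * Complex.I) := by
      have e : Complex.exp ((-(α * (q.2 - q.1)) : ℝ) * Complex.I) =
          Complex.exp (Complex.I * (α * q.1 : ℝ)) * Complex.exp (-(Complex.I * (α * q.2 : ℝ))) := by
        rw [← Complex.exp_add]
        push_cast
        ring_nf
      simp only [J]
      rw [h3, h4, e]
      simp only [d, rindlerData]
      push_cast
      ring
    simp only
    rw [h5, Complex.re_ofReal_mul, Complex.exp_ofReal_mul_I_re, Real.cos_neg]
    simp only [I]
    ring
  simp only [key]
  rw [← integral_finsetSum _ fun j _ => hI j]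
  refine integral_congr_ae (Eventually.of_forall fun q => ?_)
  simp only [I, smearedForm, rindlerForm, m, Finset.mul_sum, Finset.sum_mul]
  refine Finset.sum_congr rfl fun j _ => ?_
  ring

/-- The measure on frequency, transverse momentum and rapidity. -/
def modeMeasure : Measure (ℝ × ℝ × ℝ) :=
  (volume.restrict (Set.Ioi 0)).prod ((volume.restrict (Set.Ioi 0)).prod volume)

/-- The bound along a curve is summed over the four frame vectors. The angular factor `2π` turns
`1/(16π³)` into `1/(8π²)`. -/
theorem ofReal_neg_smearedForm_le {ω : State} (hW : ω.IsSmoothRemainder W)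
    (hg : ContDiff ℝ (⊤ : ℕ∞) g) (hgc : HasCompactSupport g) (α : ℝ) :
    ENNReal.ofReal (-∫ q, smearedForm ξ W g q * Real.cos (α * (q.2 - q.1))) ≤
      ENNReal.ofReal (1 / (8 * Real.pi ^ 2)) * ∫⁻ p : ℝ × ℝ,
        ENNReal.ofReal (modeDensity ξ g 0 (α, p)) ∂((volume.restrict (Set.Ioi 0)).prod volume) := by
  rw [← sum_re_restriction hW.1 hW.im_eq_zero hg hgc, ← Finset.sum_neg_distrib]
  have h1 := lintegral_sum_amplitude ξ α hg hgc
  have h2 : ENNReal.ofReal (1 / (8 * Real.pi ^ 2)) =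
      ENNReal.ofReal (1 / (16 * Real.pi ^ 3)) * ENNReal.ofReal (2 * Real.pi) := by
    rw [← ENNReal.ofReal_mul (by positivity)]
    congr 1
    field_simp
    norm_num
  rw [h2, mul_assoc, ← h1]
  have h3 : ∀ k, ENNReal.ofReal (∑ j, ‖(rindlerData ξ j α hg hgc).amplitude k‖ ^ 2 / energy k) =
      ∑ j, ENNReal.ofReal (‖(rindlerData ξ j α hg hgc).amplitude k‖ ^ 2 / energy k) := fun k =>
    ENNReal.ofReal_sum_of_nonneg fun j _ => div_nonneg (sq_nonneg _) (energy_nonneg k)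
  simp only [h3]
  rw [lintegral_finsetSum, Finset.mul_sum]
  · have h4 : ∀ (s : Finset (Fin 4)) (a : Fin 4 → ℝ),
        ENNReal.ofReal (∑ j ∈ s, a j) ≤ ∑ j ∈ s, ENNReal.ofReal (a j) := fun s a => by
      induction s using Finset.induction_on with
      | empty => simp
      | insert j s hj ih =>
        rw [Finset.sum_insert hj, Finset.sum_insert hj]
        exact ENNReal.ofReal_add_le.trans (add_le_add_right ih _)
    refine (h4 _ _).trans (Finset.sum_le_sum fun j _ => ?_)
    exact (rindlerData ξ j α hg hgc).ofReal_neg_restriction_le hW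
  · intro j _
    refine ENNReal.measurable_ofReal.comp ?_
    exact ((continuous_amplitude _).norm.pow 2).measurable.div continuous_energy.measurable

/-- The averaged energy density is bounded below by the total vacuum contribution of the modes of
positive frequency. -/
theorem ofReal_neg_integral_rindlerForm_le {ω : State} (hW : ω.IsSmoothRemainder W)
    (hg : ContDiff ℝ (⊤ : ℕ∞) g) (hgc : HasCompactSupport g) :
    ENNReal.ofReal (-(Real.pi * ∫ u, g u ^ 2 * rindlerForm ξ W u u)) ≤
      ENNReal.ofReal (1 / (8 * Real.pi ^ 2)) *
        ∫⁻ p, ENNReal.ofReal (modeDensity ξ g 0 p) ∂modeMeasure := by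
  have hΦ := continuous_smearedForm (ξ := ξ) hW.1 hg.continuous
  have hΦc := hasCompactSupport_smearedForm (ξ := ξ) (W := W) hgc
  have hlim := tendsto_integral_poisson hΦ hΦc
  have hdiag : ∫ u, smearedForm ξ W g (u, u) = ∫ u, g u ^ 2 * rindlerForm ξ W u u := by
    refine integral_congr_ae (Eventually.of_forall fun u => ?_)
    simp only [smearedForm]
    ring
  rw [hdiag] at hlim
  refine le_of_tendsto ((ENNReal.continuous_ofReal.tendsto _).comp hlim.neg) ?_
  filter_upwards [self_mem_nhdsWithin] with δ hδ
  have hδ' : 0 < δ := hδ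
  simp only [Function.comp_apply]
  -- The Poisson average is unfolded into an integral over `α > 0`. There the inequality holds at
  -- each frequency, and the factor `e^{-δα} ≤ 1` can be discarded from its left side.
  rw [← integral_exp_neg_mul_integral_cos hΦ hΦc hδ', ← integral_neg]
  refine (ofReal_integral_le_lintegral _).trans ?_
  have hm : Measurable fun p : ℝ × ℝ × ℝ => ENNReal.ofReal (modeDensity ξ g 0 p) := by
    have : Continuous fun p : ℝ × ℝ × ℝ => modeDensity ξ g 0 p :=
      (continuous_modeDensity ξ hg.continuous hgc).comp (by fun_prop :
        Continuous fun p : ℝ × ℝ × ℝ => ((0 : ℝ), p))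
    exact this.measurable.ennreal_ofReal
  rw [modeMeasure, lintegral_prod _ hm.aemeasurable, ← lintegral_const_mul' _ _ ENNReal.ofReal_ne_top]
  refine setLIntegral_mono' measurableSet_Ioi fun α hα => ?_
  refine le_trans ?_ (ofReal_neg_smearedForm_le hW hg hgc α)
  have hα' : 0 < α := hα
  have hexp : Real.exp (-(δ * α)) ≤ 1 := Real.exp_le_one_iff.2 (by nlinarith)
  rw [← mul_neg, ENNReal.ofReal_mul (Real.exp_pos _).le]
  exact mul_le_of_le_one_left' (ENNReal.ofReal_le_one.2 hexp)

end

section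

/-! ### Integrals over frequency, transverse momentum and rapidity -/

theorem norm_pow_mul_cexp (w : ℂ) (n : ℕ) {t : ℝ} (ht : t ∈ Set.Ioi (0 : ℝ)) :
    ‖(t : ℂ) ^ n * Complex.exp (-(t * w))‖ = t ^ n * Real.exp (-(w.re * t)) := by
  have ht' : 0 < t := ht
  rw [norm_mul, norm_pow, Complex.norm_real, Real.norm_of_nonneg ht'.le, Complex.norm_exp]
  simp [mul_comm]

theorem integrableOn_pow_mul_cexp {w : ℂ} (hw : 0 < w.re) (n : ℕ) :
    IntegrableOn (fun t : ℝ => (t : ℂ) ^ n * Complex.exp (-(t * w))) (Set.Ioi 0) := by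
  refine (integrableOn_pow_mul_exp_neg_mul hw n).mono'
    (Continuous.aestronglyMeasurable (by fun_prop)) ?_
  exact (ae_restrict_mem measurableSet_Ioi).mono fun t ht => (norm_pow_mul_cexp w n ht).le

/-- Euler's integral for complex `w`. The boundary values of `t^{n+1} e^{-tw}` vanish, which gives
the recursion in `n`. -/
theorem integral_pow_mul_cexp {w : ℂ} (hw : 0 < w.re) (n : ℕ) :
    ∫ t in Set.Ioi (0 : ℝ), (t : ℂ) ^ n * Complex.exp (-(t * w)) = n.factorial / w ^ (n + 1) := by
  have hw0 : w ≠ 0 := by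
    rintro rfl
    simp at hw
  induction n with
  | zero =>
    have h := integral_exp_mul_complex_Ioi (a := -w) (by simpa) 0
    simp only [pow_zero, one_mul, Nat.factorial_zero, Nat.cast_one, zero_add, pow_one]
    rw [← show _ = 1 / w from h.trans (by simp [neg_div_neg_eq])]
    refine integral_congr_ae (Eventually.of_forall fun t => ?_)
    simp only
    ring_nf
  | succ n ih =>
    have hd : ∀ t : ℝ, HasDerivAt (fun t : ℝ => (t : ℂ) ^ (n + 1) * Complex.exp (-(t * w)))
        ((n + 1) * ((t : ℂ) ^ n * Complex.exp (-(t * w))) -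
          w * ((t : ℂ) ^ (n + 1) * Complex.exp (-(t * w)))) t := fun t => by
      have h1 : HasDerivAt (fun t : ℝ => (t : ℂ)) 1 t := Complex.ofRealCLM.hasDerivAt
      have h2 := (h1.pow (n + 1)).mul ((h1.mul_const w).neg.cexp)
      refine h2.congr_deriv ?_
      push_cast
      change ((n : ℂ) + 1) * (t : ℂ) ^ n * 1 * Complex.exp (-(t * w)) +
        (t : ℂ) ^ (n + 1) * (Complex.exp (-(t * w)) * -(1 * w)) = _
      ring
    have i1 := (integrableOn_pow_mul_cexp hw n).const_mul ((n : ℂ) + 1)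
    have i2 := (integrableOn_pow_mul_cexp hw (n + 1)).const_mul w
    have hlim : Tendsto (fun t : ℝ => (t : ℂ) ^ (n + 1) * Complex.exp (-(t * w))) atTop (𝓝 0) := by
      rw [tendsto_zero_iff_norm_tendsto_zero]
      have := (isLittleO_pow_exp_pos_mul_atTop (n + 1) hw).tendsto_div_nhds_zero
      refine this.congr' ?_
      filter_upwards [Ioi_mem_atTop 0] with t ht
      rw [norm_pow_mul_cexp w _ ht, Real.exp_neg, div_eq_mul_inv]
    have h := integral_Ioi_of_hasDerivAt_of_tendsto (a := 0) (m := 0)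
      ((hd 0).continuousAt.continuousWithinAt) (fun t _ => hd t) (i1.sub i2) hlim
    rw [integral_sub i1 i2, integral_const_mul, integral_const_mul, ih] at h
    simp only [Complex.ofReal_zero, zero_pow (Nat.succ_ne_zero n), zero_mul, sub_zero] at h
    rw [sub_eq_zero] at h
    rw [eq_div_iff (pow_ne_zero _ hw0), Nat.factorial_succ, pow_succ w (n + 1)]
    push_cast
    set I := ∫ t in Set.Ioi (0 : ℝ), (t : ℂ) ^ (n + 1) * Complex.exp (-(t * w))
    have h2 : ((n : ℂ) + 1) * n.factorial = w * I * w ^ (n + 1) := by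
      rw [← h]
      field_simp
    linear_combination -h2

theorem integrable_inv_cosh_sq : Integrable fun x : ℝ => (Real.cosh x ^ 2)⁻¹ := by
  refine integrable_inv_one_add_sq.mono' ?_ (Eventually.of_forall fun x => ?_)
  · exact (Continuous.inv₀ (by fun_prop) fun x => by
      have := Real.cosh_pos x
      positivity).aestronglyMeasurable
  · have hc := Real.cosh_pos x
    rw [Real.norm_of_nonneg (by positivity)]
    refine inv_anti₀ (by positivity) ?_
    have : |x| ≤ |Real.sinh x| := by
      rw [Real.abs_sinh]
      exact Real.self_le_sinh_iff.2 (abs_nonneg x)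
    have h2 := sq_le_sq.2 this
    have := Real.cosh_sq x
    linarith

theorem tendsto_sinh_div_cosh_atTop :
    Tendsto (fun x : ℝ => Real.sinh x / Real.cosh x) atTop (𝓝 1) := by
  have e : ∀ x : ℝ, Real.sinh x / Real.cosh x = 1 - Real.exp (-x) / Real.cosh x := fun x => by
    have := (Real.cosh_pos x).ne'
    rw [← Real.cosh_sub_sinh]
    field_simp
    ring
  simp only [e]
  have : Tendsto (fun x : ℝ => Real.exp (-x) / Real.cosh x) atTop (𝓝 0) := by
    refine squeeze_zero (fun x => div_nonneg (Real.exp_pos _).le (Real.cosh_pos x).le)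
      (fun x => ?_) (Real.tendsto_exp_neg_atTop_nhds_zero)
    exact div_le_self (Real.exp_pos _).le (Real.one_le_cosh x)
  simpa using this.const_sub 1

theorem integral_inv_cosh_sq : ∫ x : ℝ, (Real.cosh x ^ 2)⁻¹ = 2 := by
  have hd : ∀ x, HasDerivAt (fun x : ℝ => Real.sinh x / Real.cosh x) ((Real.cosh x ^ 2)⁻¹) x := by
    intro x
    have hc := (Real.cosh_pos x).ne'
    refine ((Real.hasDerivAt_sinh x).div (Real.hasDerivAt_cosh x) hc).congr_deriv ?_
    have := Real.cosh_sq x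
    field_simp
    linarith
  have hbot : Tendsto (fun x : ℝ => Real.sinh x / Real.cosh x) atBot (𝓝 (-1)) := by
    refine ((tendsto_sinh_div_cosh_atTop.comp tendsto_neg_atBot_atTop).neg).congr fun x => ?_
    simp [neg_div]
  rw [integral_of_hasDerivAt_of_tendsto hd integrable_inv_cosh_sq hbot tendsto_sinh_div_cosh_atTop]
  norm_num

/-- The integrand over transverse momentum and rapidity. -/
def rapidityKernel (ξ m : ℝ) (Z : ℂ) (p : ℝ × ℝ) : ℂ :=
  2 * (Real.cosh (m - p.2) : ℂ) ^ 2 * ((p.1 : ℂ) ^ 3 *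
    Complex.exp (-(p.1 * ((2 * ξ * Real.cosh (m - p.2) : ℝ) * Z))))

variable {ξ m : ℝ} {Z : ℂ}

@[fun_prop]
theorem continuous_rapidityKernel : Continuous (rapidityKernel ξ m Z) := by
  unfold rapidityKernel
  fun_prop

/-- The modulus is the same kernel at `Re Z`, so absolute convergence follows from the closed form
at a real parameter. -/
theorem norm_rapidityKernel (p : ℝ × ℝ) (hp : p.1 ∈ Set.Ioi (0 : ℝ)) :
    ((‖rapidityKernel ξ m Z p‖ : ℝ) : ℂ) = rapidityKernel ξ m (Z.re : ℝ) p := by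
  rw [rapidityKernel, rapidityKernel, norm_mul, norm_pow_mul_cexp _ _ hp, norm_mul, norm_pow,
    Complex.norm_real, Real.norm_of_nonneg (Real.cosh_pos _).le, Complex.re_ofReal_mul]
  push_cast
  rw [Complex.norm_ofNat, Complex.ofReal_ofNat]
  ring_nf

theorem re_rapidity_pos (hξ : 0 < ξ) (hZ : 0 < Z.re) (θ : ℝ) :
    0 < (((2 * ξ * Real.cosh (m - θ) : ℝ) : ℂ) * Z).re := by
  rw [Complex.re_ofReal_mul]
  have := Real.cosh_pos (m - θ)
  positivity

/-- The momentum integral is `3!` over the fourth power of `2ξ cosh(m - θ) Z`. Two of the four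
powers of `cosh` cancel against the frame factor, leaving an integrable function of the rapidity. -/
theorem integral_rapidityKernel_momentum (hξ : 0 < ξ) (hZ : 0 < Z.re) (θ : ℝ) :
    ∫ κ in Set.Ioi (0 : ℝ), rapidityKernel ξ m Z (κ, θ) =
      ((Real.cosh (m - θ) ^ 2)⁻¹ : ℝ) * (3 / 4 / (ξ ^ 4 * Z ^ 4)) := by
  simp only [rapidityKernel]
  rw [integral_const_mul, integral_pow_mul_cexp (re_rapidity_pos hξ hZ θ)]
  have hZ0 : Z ≠ 0 := by
    rintro rfl
    simp at hZ
  have hξ0 : (ξ : ℂ) ≠ 0 := by exact_mod_cast hξ.ne'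
  have hc : (Real.cosh (m - θ) : ℂ) ≠ 0 := by exact_mod_cast (Real.cosh_pos (m - θ)).ne'
  rw [show Nat.factorial 3 = 6 from rfl]
  push_cast at hc ⊢
  field_simp
  norm_num

theorem integrable_rapidityKernel (hξ : 0 < ξ) (hZ : 0 < Z.re) :
    Integrable (rapidityKernel ξ m Z) ((volume.restrict (Set.Ioi 0)).prod volume) := by
  rw [integrable_prod_iff' continuous_rapidityKernel.aestronglyMeasurable]
  refine ⟨Eventually.of_forall fun θ => ?_, ?_⟩
  · exact (integrableOn_pow_mul_cexp (re_rapidity_pos (m := m) hξ hZ θ) 3).const_mul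
      (2 * (Real.cosh (m - θ) : ℂ) ^ 2)
  · have e : ∀ θ, ∫ κ in Set.Ioi (0 : ℝ), ‖rapidityKernel ξ m Z (κ, θ)‖ =
        (Real.cosh (m - θ) ^ 2)⁻¹ * (3 / 4 / (ξ ^ 4 * Z.re ^ 4)) := fun θ => by
      have h := integral_rapidityKernel_momentum (m := m) (Z := (Z.re : ℝ)) hξ (by simpa) θ
      rw [← Complex.ofReal_inj, ← integral_complex_ofReal]
      rw [setIntegral_congr_fun measurableSet_Ioi fun κ hκ => norm_rapidityKernel (κ, θ) hκ, h]
      push_cast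
      rfl
    simp only [e]
    exact (integrable_inv_cosh_sq.comp_sub_left m).mul_const _

theorem integral_rapidityKernel (hξ : 0 < ξ) (hZ : 0 < Z.re) :
    ∫ p, rapidityKernel ξ m Z p ∂((volume.restrict (Set.Ioi 0)).prod volume) =
      3 / 2 / (ξ ^ 4 * Z ^ 4) := by
  rw [integral_prod_symm _ (integrable_rapidityKernel hξ hZ)]
  simp only [integral_rapidityKernel_momentum hξ hZ]
  rw [integral_mul_const, integral_complex_ofReal,
    integral_sub_left_eq_self (fun x => (Real.cosh x ^ 2)⁻¹) volume m, integral_inv_cosh_sq]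
  push_cast
  ring

/-- The integrand over frequency, transverse momentum and rapidity. -/
def modeKernel (ξ m : ℝ) (A Z : ℂ) (p : ℝ × ℝ × ℝ) : ℂ :=
  Complex.exp (-(p.1 * A)) * rapidityKernel ξ m Z p.2

variable {A : ℂ}

theorem integrable_modeKernel (hξ : 0 < ξ) (hA : 0 < A.re) (hZ : 0 < Z.re) :
    Integrable (modeKernel ξ m A Z) modeMeasure := by
  have h := integrableOn_pow_mul_cexp hA 0
  simp only [pow_zero, one_mul] at h
  exact h.mul_prod (integrable_rapidityKernel hξ hZ)

theorem integral_modeKernel (hξ : 0 < ξ) (hA : 0 < A.re) (hZ : 0 < Z.re) :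
    ∫ p, modeKernel ξ m A Z p ∂modeMeasure = 1 / A * (3 / 2 / (ξ ^ 4 * Z ^ 4)) := by
  have h := integral_pow_mul_cexp hA 0
  simp only [pow_zero, one_mul, Nat.factorial_zero, Nat.cast_one, zero_add, pow_one] at h
  simp only [modeKernel]
  rw [modeMeasure, integral_prod_mul (fun α : ℝ => Complex.exp (-(α * A))) (rapidityKernel ξ m Z),
    h, integral_rapidityKernel hξ hZ]

theorem ae_modeMeasure : ∀ᵐ p ∂modeMeasure, p.2.1 ∈ Set.Ioi (0 : ℝ) := by
  rw [modeMeasure]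
  refine (Measure.ae_prod_iff_ae_ae ?_).2 ?_
  · exact measurableSet_Ioi.preimage (measurable_fst.comp measurable_snd)
  · refine Eventually.of_forall fun α => (Measure.ae_prod_iff_ae_ae ?_).2 ?_
    · exact measurableSet_Ioi.preimage measurable_fst
    · refine (ae_restrict_mem measurableSet_Ioi).mono fun κ hκ => Eventually.of_forall fun θ => hκ

theorem integral_norm_modeKernel (hξ : 0 < ξ) (hA : 0 < A.re) (hZ : 0 < Z.re) :
    ∫ p, ‖modeKernel ξ m A Z p‖ ∂modeMeasure = 1 / A.re * (3 / 2 / (ξ ^ 4 * Z.re ^ 4)) := by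
  have h := integral_modeKernel (m := m) (A := (A.re : ℝ)) (Z := (Z.re : ℝ)) hξ (by simpa) (by simpa)
  rw [← Complex.ofReal_inj, ← integral_complex_ofReal]
  push_cast
  rw [← h]
  refine integral_congr_ae (ae_modeMeasure.mono fun p hp => ?_)
  simp only [modeKernel]
  rw [norm_mul, Complex.ofReal_mul, norm_rapidityKernel p.2 hp, Complex.norm_exp]
  simp

end

section

/-! ### The damped vacuum contribution -/

/-- The damped proper time difference `i (s - 2iη)`. -/
def shiftedTime (η s : ℝ) : ℂ := ((2 * η : ℝ) : ℂ) + (s : ℝ) * Complex.I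

/-- The damped chordal distance `i sinh ((s - 2iη) / 2)`. -/
def shiftedSinh (η s : ℝ) : ℂ :=
  ((Real.cosh (s / 2) * Real.sin η : ℝ) : ℂ) +
    ((Real.sinh (s / 2) * Real.cos η : ℝ) : ℂ) * Complex.I

theorem shiftedTime_re (η s : ℝ) : (shiftedTime η s).re = 2 * η := by simp [shiftedTime]

theorem shiftedSinh_re (η s : ℝ) : (shiftedSinh η s).re = Real.cosh (s / 2) * Real.sin η := by
  simp only [shiftedSinh, Complex.add_re, Complex.ofReal_re, Complex.re_ofReal_mul, Complex.I_re,
    mul_zero, add_zero]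

/-- The integrand of the damped vacuum contribution. -/
def vacuumIntegrand (ξ : ℝ) (g : ℝ → ℝ) (η : ℝ) (q : ℝ × ℝ) (p : ℝ × ℝ × ℝ) : ℂ :=
  ((g q.1 * g q.2 : ℝ) : ℂ) * modeKernel ξ ((q.1 + q.2) / 2) (shiftedTime η (q.1 - q.2))
    (shiftedSinh η (q.1 - q.2)) p

variable {ξ η : ℝ} {g : ℝ → ℝ}

theorem continuous_vacuumIntegrand (hg : Continuous g) :
    Continuous fun r : (ℝ × ℝ) × ℝ × ℝ × ℝ => vacuumIntegrand ξ g η r.1 r.2 := by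
  unfold vacuumIntegrand modeKernel rapidityKernel shiftedTime shiftedSinh
  fun_prop

/-- Each squared modulus is a double integral over `u` and `u'`. In terms of midpoint and
difference, the sum over the frame depends only on the midpoint, and the exponents combine into the
two factors of `modeKernel`. -/
theorem modeDensity_eq_integral (hg : Continuous g) (hgc : HasCompactSupport g)
    (p : ℝ × ℝ × ℝ) :
    (modeDensity ξ g η p : ℂ) = ∫ q, vacuumIntegrand ξ g η q p := by
  obtain ⟨α, κ, θ⟩ := p
  let f : (ℝ → ℝ) → ℝ → ℂ := fun v u =>
    g u * (Complex.exp (Complex.I * (α * u : ℝ)) * (v (u - θ) * dampedWave ξ η κ (u - θ)))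
  have hsq : ∀ v : ℝ → ℝ, ((‖modeAmplitude ξ g v η α κ θ‖ ^ 2 : ℝ) : ℂ) =
      ∫ q : ℝ × ℝ, (starRingEnd ℂ) (f v q.1) * f v q.2 := fun v => by
    rw [Measure.volume_eq_prod, integral_prod_mul (fun u => (starRingEnd ℂ) (f v u)) (f v),
      integral_conj, Complex.ofReal_pow]
    exact (Complex.conj_mul' _).symm
  have hint : ∀ v : ℝ → ℝ, Continuous v →
      Integrable fun q : ℝ × ℝ => (starRingEnd ℂ) (f v q.1) * f v q.2 := fun v hv => by
    have hf : Integrable (f v) := by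
      refine Continuous.integrable_of_hasCompactSupport ?_
        (hgc.comp_left (g := fun r : ℝ => (r : ℂ)) (by simp)).mul_right
      simp only [f, dampedWave]
      fun_prop
    exact (Complex.conjCLE.toContinuousLinearMap.integrable_comp hf).mul_prod hf
  have i1 := hint _ Real.continuous_cosh
  have i2 := hint _ Real.continuous_sinh
  have i3 := hint _ (continuous_const (y := (1 : ℝ)))
  have i12 : Integrable fun q : ℝ × ℝ => (starRingEnd ℂ) (f Real.cosh q.1) * f Real.cosh q.2 +
      (starRingEnd ℂ) (f Real.sinh q.1) * f Real.sinh q.2 := i1.add i2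
  rw [modeDensity]
  rw [Complex.ofReal_mul, Complex.ofReal_mul, Complex.ofReal_add, Complex.ofReal_add, hsq, hsq, hsq,
    ← integral_add i1 i2, ← integral_add i12 i3, ← integral_const_mul, ← integral_const_mul]
  refine integral_congr_ae (Eventually.of_forall fun q => ?_)
  obtain ⟨u, u'⟩ := q
  obtain ⟨x, hx⟩ : ∃ x : ℝ, x = (u + u') / 2 - θ := ⟨_, rfl⟩
  obtain ⟨y, hy⟩ : ∃ y : ℝ, y = (u - u') / 2 := ⟨_, rfl⟩
  have hu : u - θ = x + y := by rw [hx, hy]; ring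
  have hu' : u' - θ = x - y := by rw [hx, hy]; ring
  have hcs := Real.cosh_sq x
  have hcs' := Real.cosh_sq y
  -- The first two terms sum to `cosh 2x`.
  have hframe : (Real.cosh (x + y) * Real.cosh (x - y) + Real.sinh (x + y) * Real.sinh (x - y) + 1 :
      ℝ) = 2 * Real.cosh x ^ 2 := by
    rw [Real.cosh_add, Real.cosh_sub, Real.sinh_add, Real.sinh_sub]
    linear_combination (-Real.cosh y ^ 2 + Real.sinh y ^ 2) * hcs +
      (2 * Real.cosh x ^ 2 - 1) * hcs'
  have hconj : (starRingEnd ℂ) (dampedWave ξ η κ (x + y)) =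
      Complex.exp (((ξ * κ : ℝ) : ℂ) * (-(Complex.I * (Real.cos η * Real.sinh (x + y) : ℝ)) -
        (Real.sin η * Real.cosh (x + y) : ℝ))) := by
    rw [dampedWave, ← Complex.exp_conj]
    simp only [map_mul, map_sub, Complex.conj_ofReal, Complex.conj_I]
    ring_nf
  -- Conjugation adds the two damping terms and subtracts the two phases. The addition formulas then
  -- factor out `2 cosh x`, leaving `sin η cosh y + i cos η sinh y`.
  have hwave : (starRingEnd ℂ) (dampedWave ξ η κ (x + y)) * dampedWave ξ η κ (x - y) =
      Complex.exp (-(κ * ((2 * ξ * Real.cosh x : ℝ) * shiftedSinh η (u - u')))) := by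
    rw [hconj, dampedWave, ← Complex.exp_add, shiftedSinh, ← hy, Real.sinh_add, Real.sinh_sub,
      Real.cosh_add, Real.cosh_sub]
    push_cast
    ring_nf
  have hfreq : (Real.exp (-(2 * η * α)) : ℂ) * ((starRingEnd ℂ)
      (Complex.exp (Complex.I * (α * u : ℝ))) * Complex.exp (Complex.I * (α * u' : ℝ))) =
      Complex.exp (-(α * shiftedTime η (u - u'))) := by
    rw [← Complex.exp_conj, ← Complex.exp_add, Complex.ofReal_exp, ← Complex.exp_add, shiftedTime]
    simp
    ring_nf
  have hframe' : ((Real.cosh (x + y) : ℂ) * Real.cosh (x - y) +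
      Real.sinh (x + y) * Real.sinh (x - y) + 1) = 2 * (Real.cosh x : ℂ) ^ 2 := by
    exact_mod_cast congrArg (fun r : ℝ => (r : ℂ)) hframe
  simp only [f, vacuumIntegrand, modeKernel, rapidityKernel, hu, hu', ← hx, map_mul, Complex.conj_ofReal]
  rw [← hwave, ← hfreq, ← hframe']
  push_cast
  ring

/-- The damping gives both complex parameters positive real part, namely `2η` and `cosh(s/2) sin η`;
the latter needs `η < π`. The integral of the modulus over the modes is then continuous in `u` and
`u'`, with compact support. -/
theorem integrable_vacuumIntegrand (hξ : 0 < ξ) (hη : 0 < η) (hη' : η < Real.pi)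
    (hg : Continuous g) (hgc : HasCompactSupport g) :
    Integrable (fun r : (ℝ × ℝ) × ℝ × ℝ × ℝ => vacuumIntegrand ξ g η r.1 r.2)
      (volume.prod modeMeasure) := by
  have : SFinite modeMeasure := by
    unfold modeMeasure
    infer_instance
  have hsin : 0 < Real.sin η := Real.sin_pos_of_pos_of_lt_pi hη hη'
  have hA : ∀ s, 0 < (shiftedTime η s).re := fun s => by
    rw [shiftedTime_re]
    positivity
  have hZ : ∀ s, 0 < (shiftedSinh η s).re := fun s => by
    rw [shiftedSinh_re]
    exact mul_pos (Real.cosh_pos _) hsin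
  rw [integrable_prod_iff (continuous_vacuumIntegrand hg).aestronglyMeasurable]
  refine ⟨Eventually.of_forall fun q => (integrable_modeKernel (m := (q.1 + q.2) / 2) hξ
    (hA (q.1 - q.2)) (hZ (q.1 - q.2))).const_mul ((g q.1 * g q.2 : ℝ) : ℂ), ?_⟩
  simp only [vacuumIntegrand, norm_mul, integral_const_mul,
    integral_norm_modeKernel hξ (hA _) (hZ _), shiftedTime_re, shiftedSinh_re]
  refine Continuous.integrable_of_hasCompactSupport ?_ ?_
  · refine Continuous.mul (by fun_prop) (continuous_const.mul (continuous_const.div (by fun_prop) ?_))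
    intro q
    have := Real.cosh_pos ((q.1 - q.2) / 2)
    positivity
  · refine HasCompactSupport.intro (hgc.isCompact.prod hgc.isCompact) fun q hq => ?_
    rw [Set.mem_prod, not_and_or] at hq
    rcases hq with h | h
    · simp [image_eq_zero_of_notMem_tsupport h]
    · simp [image_eq_zero_of_notMem_tsupport h]

/-- The damped vacuum contribution in closed form. -/
theorem lintegral_modeDensity (hξ : 0 < ξ) (hη : 0 < η) (hη' : η < Real.pi)
    (hg : Continuous g) (hgc : HasCompactSupport g) :
    ∫⁻ p, ENNReal.ofReal (modeDensity ξ g η p) ∂modeMeasure =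
      ENNReal.ofReal (∫ q : ℝ × ℝ, ((g q.1 * g q.2 : ℝ) : ℂ) * (1 / shiftedTime η (q.1 - q.2) *
        (3 / 2 / (ξ ^ 4 * shiftedSinh η (q.1 - q.2) ^ 4)))).re := by
  have : SFinite modeMeasure := by
    unfold modeMeasure
    infer_instance
  have hsin : 0 < Real.sin η := Real.sin_pos_of_pos_of_lt_pi hη hη'
  have hI := integrable_vacuumIntegrand (g := g) hξ hη hη' hg hgc
  have h1 : Integrable (fun p => (modeDensity ξ g η p : ℂ)) modeMeasure := by
    simp only [modeDensity_eq_integral hg hgc]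
    exact hI.integral_prod_right
  have h2 : Integrable (modeDensity ξ g η) modeMeasure := by
    simpa using h1.re
  have h0 : 0 ≤ᵐ[modeMeasure] modeDensity ξ g η := ae_modeMeasure.mono fun p hp => by
    have : 0 < p.2.1 := hp
    simp only [modeDensity, Pi.zero_apply]
    positivity
  rw [← ofReal_integral_eq_lintegral_ofReal h2 h0]
  congr 1
  rw [← Complex.ofReal_re (∫ p, modeDensity ξ g η p ∂modeMeasure), ← integral_complex_ofReal]
  congr 1
  simp only [modeDensity_eq_integral hg hgc]
  rw [← integral_integral_swap hI]
  refine integral_congr_ae (Eventually.of_forall fun q => ?_)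
  simp only [vacuumIntegrand]
  rw [integral_const_mul, integral_modeKernel hξ]
  · rw [shiftedTime_re]
    positivity
  · rw [shiftedSinh_re]
    exact mul_pos (Real.cosh_pos _) hsin

end

section

/-! ### The Laurent expansion of the vacuum kernel -/

/-- The fifth order Taylor polynomial of the sine. -/
def sinTaylor (w : ℂ) : ℂ := w - w ^ 3 / 6 + w ^ 5 / 120

/-- The two exponentials in the sine are expanded to order six, where the even terms cancel; the
constant is crude. -/
theorem norm_sin_sub_sinTaylor_le {w : ℂ} (hw : ‖w‖ ≤ 1) :
    ‖Complex.sin w - sinTaylor w‖ ≤ ‖w‖ ^ 7 / 10 := by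
  have h1 := Complex.exp_bound (x := -w * Complex.I) (n := 7) (by simpa) (by norm_num)
  have h2 := Complex.exp_bound (x := w * Complex.I) (n := 7) (by simpa) (by norm_num)
  set E1 := Complex.exp (-w * Complex.I) -
    ∑ m ∈ Finset.range 7, (-w * Complex.I) ^ m / m.factorial with hE1
  set E2 := Complex.exp (w * Complex.I) -
    ∑ m ∈ Finset.range 7, (w * Complex.I) ^ m / m.factorial with hE2
  have e : Complex.sin w - sinTaylor w = (E1 - E2) * Complex.I / 2 := by
    have i2 : Complex.I ^ 2 = -1 := Complex.I_sq
    have i4 : Complex.I ^ 4 = 1 := Complex.I_pow_four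
    have i6 : Complex.I ^ 6 = -1 := by rw [show 6 = 4 + 2 from rfl, pow_add, i2, i4, one_mul]
    rw [hE1, hE2, sinTaylor, Complex.sin]
    simp only [Finset.sum_range_succ, Finset.sum_range_zero, Nat.factorial]
    push_cast
    linear_combination -w * i2 - w ^ 3 / 6 * i4 - w ^ 5 / 120 * i6
  rw [e, norm_div, norm_mul, Complex.norm_I, mul_one, Complex.norm_ofNat]
  have h3 : ‖E1 - E2‖ ≤ ‖w‖ ^ 7 / 10 + ‖w‖ ^ 7 / 10 := by
    refine (norm_sub_le _ _).trans (add_le_add (h1.trans ?_) (h2.trans ?_)) <;>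
    · simp only [norm_mul, norm_neg, Complex.norm_I, mul_one, Nat.factorial]
      norm_num
      have := pow_nonneg (norm_nonneg w) 7
      linarith
  linarith

/-- The polynomial `1 + (2/3)w² + (11/45)w⁴` truncates the series of `(w / sin w)⁴`, so the error
starts at `w¹⁰`. The lower bound on the sine allows division by it afterwards. -/
theorem norm_sub_sin_pow_four_mul_le {w : ℂ} (hw : ‖w‖ ≤ 1) :
    ‖w ^ 4 - Complex.sin w ^ 4 * (1 + 2 / 3 * w ^ 2 + 11 / 45 * w ^ 4)‖ ≤ 200 * ‖w‖ ^ 10 ∧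
      ‖w‖ / 2 ≤ ‖Complex.sin w‖ := by
  set S := Complex.sin w
  set p := sinTaylor w with hp
  set x := ‖w‖ with hx
  have hx0 : 0 ≤ x := norm_nonneg w
  have hr : ‖S - p‖ ≤ x ^ 7 / 10 := norm_sin_sub_sinTaylor_le hw
  have hle : ∀ n m : ℕ, x ^ (n + m) ≤ x ^ m := fun n m =>
    pow_le_pow_of_le_one hx0 hw (Nat.le_add_left _ _)
  have h7 : x ^ 7 ≤ x := by simpa using hle 6 1
  have h3 : x ^ 3 ≤ x := by simpa using hle 2 1
  have h5 : x ^ 5 ≤ x := by simpa using hle 4 1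
  have hp3 : ‖w ^ 3 / 6‖ = x ^ 3 / 6 := by
    rw [norm_div, norm_pow, Complex.norm_ofNat]
  have hp5 : ‖w ^ 5 / 120‖ = x ^ 5 / 120 := by
    rw [norm_div, norm_pow, Complex.norm_ofNat]
  have hple : ‖p‖ ≤ 2 * x := by
    have := norm_add_le (w - w ^ 3 / 6) (w ^ 5 / 120)
    have := norm_sub_le w (w ^ 3 / 6)
    rw [hp, sinTaylor]
    linarith
  have hpge : 4 / 5 * x ≤ ‖p‖ := by
    have e1 := norm_sub_norm_le w (w ^ 3 / 6)
    have e2 := norm_sub_norm_le (w - w ^ 3 / 6) (-(w ^ 5 / 120))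
    rw [sub_neg_eq_add, norm_neg] at e2
    rw [hp, sinTaylor]
    linarith
  have hSp : S = p + (S - p) := by ring
  have hSle : ‖S‖ ≤ 3 * x := by
    have := norm_add_le p (S - p)
    rw [← hSp] at this
    linarith
  have hSge : x / 2 ≤ ‖S‖ := by
    have := norm_sub_norm_le p (p - S)
    rw [sub_sub_cancel, norm_sub_rev] at this
    linarith
  refine ⟨?_, hSge⟩
  set P : ℂ := 1 + 2 / 3 * w ^ 2 + 11 / 45 * w ^ 4 with hP
  -- Here `q` is the exact quotient of `w⁴ - p⁴ P` by `w¹⁰`. Replacing `p` by `sin w` costs `(S⁴ -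
  -- p⁴) P`, whose factor `S - p` is of order `w⁷`.
  set q : ℂ := 7 / 108 + -(127 / 4320) * w ^ 2 + (1 / 160) * w ^ 4 + -(919 / 1166400) * w ^ 6 +
    (293 / 4665600) * w ^ 8 + -(391 / 124416000) * w ^ 10 + (17 / 186624000) * w ^ 12 +
    -(11 / 9331200000) * w ^ 14 with hq
  have e : w ^ 4 - S ^ 4 * P = w ^ 10 * q - (S - p) * ((S + p) * (S ^ 2 + p ^ 2)) * P := by
    rw [hP, hq, hp, sinTaylor]
    ring
  have hx1 : ∀ n : ℕ, x ^ n ≤ 1 := fun n => pow_le_one₀ hx0 hw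
  have hPle : ‖P‖ ≤ 2 := by
    refine (norm_add₃_le).trans ?_
    simp only [norm_mul, norm_div, norm_pow, Complex.norm_ofNat, norm_one]
    have := hx1 2
    have := hx1 4
    linarith
  have hqle : ‖q‖ ≤ 1 := by
    have hadd : ∀ (a b : ℂ) (s t : ℝ), ‖a‖ ≤ s → ‖b‖ ≤ t → ‖a + b‖ ≤ s + t := fun a b s t ha hb =>
      (norm_add_le a b).trans (add_le_add ha hb)
    have hmul : ∀ (c : ℂ) (n : ℕ), ‖c * w ^ n‖ ≤ ‖c‖ := fun c n => by
      rw [norm_mul, norm_pow]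
      exact mul_le_of_le_one_right (norm_nonneg _) (hx1 n)
    have := hadd _ _ _ _ (hadd _ _ _ _ (hadd _ _ _ _ (hadd _ _ _ _ (hadd _ _ _ _ (hadd _ _ _ _
      (hadd _ _ _ _ (le_refl ‖(7 / 108 : ℂ)‖) (hmul (-(127 / 4320)) 2)) (hmul (1 / 160) 4))
      (hmul (-(919 / 1166400)) 6)) (hmul (293 / 4665600) 8)) (hmul (-(391 / 124416000)) 10))
      (hmul (17 / 186624000) 12)) (hmul (-(11 / 9331200000)) 14)
    refine this.trans ?_
    simp only [norm_neg, norm_div, Complex.norm_ofNat, norm_one]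
    norm_num
  have hsum : ‖(S + p) * (S ^ 2 + p ^ 2)‖ ≤ 5 * x * (13 * x ^ 2) := by
    rw [norm_mul]
    refine mul_le_mul ?_ ?_ (norm_nonneg _) (by positivity)
    · have := norm_add_le S p
      linarith
    · refine (norm_add_le _ _).trans ?_
      rw [norm_pow, norm_pow]
      have h1 : ‖S‖ ^ 2 ≤ (3 * x) ^ 2 := by gcongr
      have h2 : ‖p‖ ^ 2 ≤ (2 * x) ^ 2 := by gcongr
      linarith
  rw [e]
  calc ‖w ^ 10 * q - (S - p) * ((S + p) * (S ^ 2 + p ^ 2)) * P‖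
      ≤ ‖w ^ 10 * q‖ + ‖(S - p) * ((S + p) * (S ^ 2 + p ^ 2)) * P‖ := norm_sub_le _ _
    _ ≤ x ^ 10 * 1 + x ^ 7 / 10 * (5 * x * (13 * x ^ 2)) * 2 := by
        rw [norm_mul, norm_mul, norm_mul (S - p), norm_pow]
        gcongr
    _ ≤ 200 * x ^ 10 := by
        have := pow_nonneg hx0 10
        nlinarith

/-- The vacuum kernel on the worldline, divided by the time difference, without its singular part. -/
def vacuumRemainder (A : ℂ) : ℂ :=
  3 / 2 / (A * Complex.sin (A / 2) ^ 4) - 24 / A ^ 5 - 4 / A ^ 3 - 11 / 30 / A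

/-- The other zeros of `sin(A/2)` lie at nonzero multiples of `2π`, outside the strip `|Re A| ≤ 1`.
-/
theorem sin_half_ne_zero {A : ℂ} (hA : A ≠ 0) (hre : |A.re| ≤ 1) : Complex.sin (A / 2) ≠ 0 := by
  rw [Complex.sin_ne_zero_iff]
  intro k hk
  have h1 := congrArg Complex.re hk
  have h2 := congrArg Complex.im hk
  simp at h1 h2
  have hk0 : k = 0 := by
    by_contra hk0
    have h3 : (1 : ℝ) ≤ |(k : ℝ)| := by exact_mod_cast Int.one_le_abs hk0
    have h4 : |A.re / 2| = |(k : ℝ)| * Real.pi := by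
      rw [h1, abs_mul, abs_of_pos Real.pi_pos]
    rw [abs_div, abs_two] at h4
    nlinarith [Real.pi_gt_three]
  apply hA
  apply Complex.ext
  · simpa [hk0] using h1
  · simpa using h2

/-- The subtracted terms are the whole principal part of an odd function, so the remainder vanishes
linearly at `0`. This agrees with the value `0` that division by zero assigns there. -/
theorem norm_vacuumRemainder_le {A : ℂ} (hA : ‖A‖ ≤ 1) : ‖vacuumRemainder A‖ ≤ 2400 * ‖A‖ := by
  rcases eq_or_ne A 0 with rfl | hA0
  · simp [vacuumRemainder]
  obtain ⟨w, hw⟩ : ∃ w, w = A / 2 := ⟨_, rfl⟩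
  have hAw : A = 2 * w := by rw [hw]; ring
  have hwn : ‖A‖ = 2 * ‖w‖ := by rw [hAw, norm_mul, Complex.norm_ofNat]
  have hw0 : w ≠ 0 := by
    rw [hw]
    exact div_ne_zero hA0 two_ne_zero
  have hS : Complex.sin w ≠ 0 := by
    rw [hw]
    exact sin_half_ne_zero hA0 ((Complex.abs_re_le_norm A).trans hA)
  obtain ⟨h1, h2⟩ := norm_sub_sin_pow_four_mul_le (w := w) (by linarith [norm_nonneg w])
  have e : vacuumRemainder A = 3 / 4 * ((w ^ 4 - Complex.sin w ^ 4 *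
      (1 + 2 / 3 * w ^ 2 + 11 / 45 * w ^ 4)) / (w ^ 5 * Complex.sin w ^ 4)) := by
    rw [vacuumRemainder, ← hw, hAw]
    field_simp
    ring
  have hwpos : 0 < ‖w‖ := norm_pos_iff.2 hw0
  have hden : ‖w‖ ^ 9 / 16 ≤ ‖w ^ 5 * Complex.sin w ^ 4‖ := by
    rw [norm_mul, norm_pow, norm_pow]
    calc ‖w‖ ^ 9 / 16 = ‖w‖ ^ 5 * (‖w‖ / 2) ^ 4 := by ring
      _ ≤ _ := by gcongr
  have h34 : ‖(3 / 4 : ℂ)‖ = 3 / 4 := by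
    rw [norm_div, Complex.norm_ofNat, Complex.norm_ofNat]
  rw [e, norm_mul, h34, norm_div, hwn]
  -- The constant is `3/4 · 200 · 16`.
  calc _ ≤ 3 / 4 * (200 * ‖w‖ ^ 10 / (‖w‖ ^ 9 / 16)) := by gcongr
    _ = 2400 * ‖w‖ := by
      field_simp
      norm_num
    _ ≤ _ := by linarith

theorem continuousAt_vacuumRemainder {A : ℂ} (hre : |A.re| ≤ 1) :
    ContinuousAt vacuumRemainder A := by
  rcases eq_or_ne A 0 with rfl | hA
  · have h0 : vacuumRemainder 0 = 0 := by simp [vacuumRemainder]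
    rw [ContinuousAt, h0]
    refine squeeze_zero_norm' (a := fun A => 2400 * ‖A‖) ?_ ?_
    · filter_upwards [Metric.closedBall_mem_nhds (0 : ℂ) one_pos] with A hA
      exact norm_vacuumRemainder_le (by simpa using hA)
    · have : Continuous fun A : ℂ => 2400 * ‖A‖ := by fun_prop
      simpa using this.tendsto 0
  · have hS := sin_half_ne_zero hA hre
    unfold vacuumRemainder
    refine ((ContinuousAt.sub (ContinuousAt.sub ?_ ?_) ?_).sub ?_)
    · exact continuousAt_const.div (by fun_prop) (mul_ne_zero hA (pow_ne_zero _ hS))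
    · exact continuousAt_const.div (by fun_prop) (pow_ne_zero _ hA)
    · exact continuousAt_const.div (by fun_prop) (pow_ne_zero _ hA)
    · exact continuousAt_const.div (by fun_prop) hA

theorem shiftedSinh_eq_sin (η s : ℝ) : shiftedSinh η s = Complex.sin (shiftedTime η s / 2) := by
  have : shiftedTime η s / 2 = (η : ℂ) + ((s / 2 : ℝ) : ℂ) * Complex.I := by
    rw [shiftedTime]
    push_cast
    ring
  rw [this, Complex.sin_add, Complex.sin_mul_I, Complex.cos_mul_I, shiftedSinh]
  push_cast
  ring

/-- At `A = is` the fourth power of the sine is `sinh(s/2)⁴`, which is real, while odd powers of `A`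
are imaginary. -/
theorem vacuumRemainder_imaginary (s : ℝ) : (vacuumRemainder (shiftedTime 0 s)).re = 0 := by
  have hA : shiftedTime 0 s = (s : ℂ) * Complex.I := by simp [shiftedTime]
  have hS : Complex.sin (shiftedTime 0 s / 2) ^ 4 = ((Real.sinh (s / 2) ^ 4 : ℝ) : ℂ) := by
    rw [← shiftedSinh_eq_sin, shiftedSinh]
    simp only [Real.sin_zero, Real.cos_zero, mul_zero, mul_one, Complex.ofReal_zero, zero_add]
    rw [mul_pow, Complex.I_pow_four, mul_one]
    push_cast
    rfl
  have i3 : Complex.I ^ 3 = -Complex.I := Complex.I_pow_three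
  have i5 : Complex.I ^ 5 = Complex.I := by
    rw [pow_succ, Complex.I_pow_four, one_mul]
  have e : vacuumRemainder (shiftedTime 0 s) =
      ((-(3 / 2 / (s * Real.sinh (s / 2) ^ 4)) + 24 / s ^ 5 - 4 / s ^ 3 + 11 / 30 / s : ℝ) : ℂ) *
        Complex.I := by
    rw [vacuumRemainder, hS, hA, mul_pow, mul_pow, i3, i5]
    have hI : (Complex.I)⁻¹ = -Complex.I := Complex.inv_I
    simp only [div_eq_mul_inv, mul_inv, hI, inv_neg]
    push_cast
    ring
  rw [e, Complex.re_ofReal_mul, Complex.I_re, mul_zero]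

end

section

/-! ### Removing the damping -/

theorem integral_div_pow_succ {g : ℝ → ℝ} (hg : ContDiff ℝ 1 g) (hgc : HasCompactSupport g)
    {a b : ℂ} (hab : ∀ t : ℝ, a + b * t ≠ 0) (n : ℕ) :
    n * b * ∫ t, (g t : ℂ) / (a + b * t) ^ (n + 1) =
      ∫ t, ((deriv g t : ℝ) : ℂ) / (a + b * t) ^ n := by
  have hg' : Continuous (deriv g) := hg.continuous_deriv le_rfl
  have hc : ∀ m : ℕ, Continuous fun t : ℝ => ((a + b * t) ^ m)⁻¹ := fun m =>
    Continuous.inv₀ (by fun_prop) fun t => pow_ne_zero _ (hab t)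
  have hint : ∀ (f : ℝ → ℝ), Continuous f → HasCompactSupport f → ∀ v : ℝ → ℂ, Continuous v →
      Integrable ((fun t => (f t : ℂ)) * v) := fun f hf hfc v hv =>
    Continuous.integrable_of_hasCompactSupport ((Complex.continuous_ofReal.comp hf).mul hv)
      (hfc.comp_left (g := fun r : ℝ => (r : ℂ)) (by simp)).mul_right
  have hu : ∀ t, HasDerivAt (fun t => (g t : ℂ)) ((deriv g t : ℝ) : ℂ) t := fun t =>
    ((hg.differentiable one_ne_zero) t).hasDerivAt.ofReal_comp
  have hv : ∀ t : ℝ, HasDerivAt (fun t : ℝ => ((a + b * t) ^ n)⁻¹)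
      (-(n * b) * ((a + b * t) ^ (n + 1))⁻¹) t := fun t => by
    have h1 : HasDerivAt (fun t : ℝ => a + b * (t : ℂ)) b t := by
      simpa using ((hasDerivAt_id t).ofReal_comp.const_mul b).const_add a
    have h2 := (h1.pow n).inv (pow_ne_zero n (hab t))
    refine h2.congr_deriv ?_
    have h0 := hab t
    rcases n with _ | n
    · simp
    · simp only [Nat.add_sub_cancel, Pi.pow_apply]
      field_simp
      ring
  have h := integral_mul_deriv_eq_deriv_mul_of_integrable (fun t _ => hu t) (fun t _ => hv t)
    (hint g hg.continuous hgc _ (continuous_const.mul (hc _)))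
    (hint _ hg' hgc.deriv _ (hc n)) (hint g hg.continuous hgc _ (hc n))
  simp only [div_eq_mul_inv]
  rw [← neg_inj, ← h, ← integral_const_mul, ← integral_neg]
  refine integral_congr_ae (Eventually.of_forall fun t => ?_)
  simp only
  ring

theorem shiftedTime_ne_zero {η : ℝ} (hη : 0 < η) (s : ℝ) : shiftedTime η s ≠ 0 := by
  intro h
  have := congrArg Complex.re h
  rw [shiftedTime_re, Complex.zero_re] at this
  linarith

theorem continuous_shiftedTime {X : Type*} [TopologicalSpace X] {a b : X → ℝ}
    (ha : Continuous a) (hb : Continuous b) : Continuous fun x => shiftedTime (a x) (b x) := by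
  unfold shiftedTime
  fun_prop

/-- The pairing of two functions with an inverse power of the damped time difference. -/
def powerPairing (η : ℝ) (n : ℕ) (g h : ℝ → ℝ) : ℂ :=
  ∫ q : ℝ × ℝ, ((g q.1 * h q.2 : ℝ) : ℂ) / shiftedTime η (q.1 - q.2) ^ n

theorem integrable_mul_of_hasCompactSupport {g h : ℝ → ℝ} (hg : Continuous g)
    (hgc : HasCompactSupport g) (hh : Continuous h) (hhc : HasCompactSupport h)
    {k : ℝ × ℝ → ℂ} (hk : Continuous k) :
    Integrable fun q : ℝ × ℝ => ((g q.1 * h q.2 : ℝ) : ℂ) * k q := by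
  refine Continuous.integrable_of_hasCompactSupport (by fun_prop) ?_
  refine HasCompactSupport.intro (hgc.isCompact.prod hhc.isCompact) fun q hq => ?_
  rw [Set.mem_prod, not_and_or] at hq
  rcases hq with h | h
  · simp [image_eq_zero_of_notMem_tsupport h]
  · simp [image_eq_zero_of_notMem_tsupport h]

theorem continuous_inv_shiftedTime_pow {η : ℝ} (hη : 0 < η) (n : ℕ) :
    Continuous fun q : ℝ × ℝ => (shiftedTime η (q.1 - q.2) ^ n)⁻¹ :=
  Continuous.inv₀ ((continuous_shiftedTime continuous_const (by fun_prop)).pow n)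
    fun _ => pow_ne_zero _ (shiftedTime_ne_zero hη _)

variable {η : ℝ} {g h : ℝ → ℝ}

theorem powerPairing_deriv_left (hη : 0 < η) (hg : ContDiff ℝ 1 g) (hgc : HasCompactSupport g)
    (hh : Continuous h) (hhc : HasCompactSupport h) (n : ℕ) :
    n * Complex.I * powerPairing η (n + 1) g h = powerPairing η n (deriv g) h := by
  have hg' : Continuous (deriv g) := hg.continuous_deriv le_rfl
  have i1 := integrable_mul_of_hasCompactSupport hg.continuous hgc hh hhc
    (continuous_inv_shiftedTime_pow hη (n + 1))
  have i2 := integrable_mul_of_hasCompactSupport hg' hgc.deriv hh hhc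
    (continuous_inv_shiftedTime_pow hη n)
  simp only [powerPairing, div_eq_mul_inv]
  rw [Measure.volume_eq_prod, integral_prod_symm _ i1, integral_prod_symm _ i2,
    ← integral_const_mul]
  refine integral_congr_ae (Eventually.of_forall fun y => ?_)
  have e : ∀ t, shiftedTime η (t - y) = (shiftedTime η (-y)) + Complex.I * t := fun t => by
    simp only [shiftedTime]
    push_cast
    ring
  have := integral_div_pow_succ hg hgc (a := shiftedTime η (-y)) (b := Complex.I)
    (fun t => by rw [← e]; exact shiftedTime_ne_zero hη _) n
  simp only [← e] at this
  have e2 : ∀ (f : ℝ → ℝ) (m : ℕ), ∫ x, ((f x * h y : ℝ) : ℂ) * (shiftedTime η (x - y) ^ m)⁻¹ =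
      (∫ x, (f x : ℂ) / shiftedTime η (x - y) ^ m) * h y := fun f m => by
    rw [← integral_mul_const]
    refine integral_congr_ae (Eventually.of_forall fun x => ?_)
    simp only
    push_cast
    ring
  simp only [e2, ← this]
  ring

theorem powerPairing_deriv_right (hη : 0 < η) (hg : Continuous g) (hgc : HasCompactSupport g)
    (hh : ContDiff ℝ 1 h) (hhc : HasCompactSupport h) (n : ℕ) :
    -(n * Complex.I * powerPairing η (n + 1) g h) = powerPairing η n g (deriv h) := by
  have hh' : Continuous (deriv h) := hh.continuous_deriv le_rfl
  have i1 := integrable_mul_of_hasCompactSupport hg hgc hh.continuous hhc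
    (continuous_inv_shiftedTime_pow hη (n + 1))
  have i2 := integrable_mul_of_hasCompactSupport hg hgc hh' hhc.deriv
    (continuous_inv_shiftedTime_pow hη n)
  simp only [powerPairing, div_eq_mul_inv]
  rw [Measure.volume_eq_prod, integral_prod _ i1, integral_prod _ i2,
    ← integral_const_mul, ← integral_neg]
  refine integral_congr_ae (Eventually.of_forall fun x => ?_)
  have e : ∀ t, shiftedTime η (x - t) = (shiftedTime η x) + -Complex.I * t := fun t => by
    simp only [shiftedTime]
    push_cast
    ring
  have := integral_div_pow_succ hh hhc (a := shiftedTime η x) (b := -Complex.I)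
    (fun t => by rw [← e]; exact shiftedTime_ne_zero hη _) n
  simp only [← e] at this
  have e2 : ∀ (f : ℝ → ℝ) (m : ℕ), ∫ y, ((g x * f y : ℝ) : ℂ) * (shiftedTime η (x - y) ^ m)⁻¹ =
      (∫ y, (f y : ℂ) / shiftedTime η (x - y) ^ m) * g x := fun f m => by
    rw [← integral_mul_const]
    refine integral_congr_ae (Eventually.of_forall fun y => ?_)
    simp only
    push_cast
    ring
  simp only [e2, ← this]
  ring

/-- One integration by parts is made in each argument. The kernel depends on the difference of the
arguments, so the factors are `i` and `-i`, with product `+1`. -/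
theorem powerPairing_add_two (hη : 0 < η) (hg : ContDiff ℝ 1 g) (hgc : HasCompactSupport g)
    (n : ℕ) :
    (n * (n + 1) : ℂ) * powerPairing η (n + 2) g g = powerPairing η n (deriv g) (deriv g) := by
  have h1 := powerPairing_deriv_left hη hg hgc hg.continuous hgc (n + 1)
  have h2 := powerPairing_deriv_right hη (hg.continuous_deriv le_rfl) hgc.deriv hg hgc n
  rw [← h2, ← h1]
  push_cast
  linear_combination (n * (n + 1) : ℂ) * powerPairing η (n + 2) g g * Complex.I_sq

theorem powerPairing_three (hη : 0 < η) (hg : ContDiff ℝ 1 g) (hgc : HasCompactSupport g) :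
    2 * powerPairing η 3 g g = powerPairing η 1 (deriv g) (deriv g) := by
  have h := powerPairing_add_two hη hg hgc 1
  rw [← h]
  push_cast
  ring

theorem powerPairing_five (hη : 0 < η) (hg : ContDiff ℝ 2 g) (hgc : HasCompactSupport g) :
    24 * powerPairing η 5 g g = powerPairing η 1 (deriv (deriv g)) (deriv (deriv g)) := by
  have h := powerPairing_add_two hη (hg.of_le one_le_two) hgc 3
  have hg' : ContDiff ℝ 1 (deriv g) := by
    have : ContDiff ℝ (1 + 1) g := by
      rw [one_add_one_eq_two]
      exact hg
    exact (contDiff_succ_iff_deriv.1 this).2.2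
  rw [← powerPairing_three hη hg' hgc.deriv, ← h]
  push_cast
  ring

/-- The real part of `1/(2η + is)` is the Poisson kernel of width `2η`. -/
theorem powerPairing_one_re (hη : 0 < η) (hg : Continuous g) (hgc : HasCompactSupport g) :
    (powerPairing η 1 g g).re =
      ∫ q : ℝ × ℝ, (g q.1 * g q.2) * (2 * η / ((2 * η) ^ 2 + (q.2 - q.1) ^ 2)) := by
  have hi := integrable_mul_of_hasCompactSupport hg hgc hg hgc
    (continuous_inv_shiftedTime_pow hη 1)
  simp only [powerPairing, div_eq_mul_inv _ (shiftedTime _ _ ^ 1)]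
  have h2 := Complex.reCLM.integral_comp_comm hi
  simp only [Complex.reCLM_apply] at h2
  rw [← h2]
  refine integral_congr_ae (Eventually.of_forall fun q => ?_)
  simp only [pow_one]
  rw [Complex.re_ofReal_mul, Complex.inv_re, Complex.normSq_apply, shiftedTime_re]
  have : (shiftedTime η (q.1 - q.2)).im = q.1 - q.2 := by simp [shiftedTime]
  rw [this]
  congr 2
  ring

theorem tendsto_powerPairing_one_re (hg : Continuous g) (hgc : HasCompactSupport g) :
    Tendsto (fun η => (powerPairing η 1 g g).re) (𝓝[>] 0) (𝓝 (Real.pi * ∫ u, g u ^ 2)) := by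
  have hΦc : HasCompactSupport fun q : ℝ × ℝ => g q.1 * g q.2 := by
    refine HasCompactSupport.intro (hgc.isCompact.prod hgc.isCompact) fun q hq => ?_
    rw [Set.mem_prod, not_and_or] at hq
    rcases hq with h | h
    · simp [image_eq_zero_of_notMem_tsupport h]
    · simp [image_eq_zero_of_notMem_tsupport h]
  have h := tendsto_integral_poisson (by fun_prop : Continuous fun q : ℝ × ℝ => g q.1 * g q.2) hΦc
  simp only [← pow_two (g _)] at h
  have h2 : Tendsto (fun η : ℝ => 2 * η) (𝓝[>] 0) (𝓝[>] 0) := by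
    refine tendsto_nhdsWithin_iff.2 ⟨?_, ?_⟩
    · have : Continuous fun η : ℝ => 2 * η := by fun_prop
      simpa using (this.tendsto 0).mono_left nhdsWithin_le_nhds
    · filter_upwards [self_mem_nhdsWithin] with η hη
      have : 0 < η := hη
      simpa
  refine (h.comp h2).congr' ?_
  filter_upwards [self_mem_nhdsWithin] with η hη
  rw [powerPairing_one_re hη hg hgc]
  rfl

theorem abs_shiftedTime_re_le {η : ℝ} (hη : η ∈ Set.Icc (0 : ℝ) (1 / 2)) (s : ℝ) :
    |(shiftedTime η s).re| ≤ 1 := by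
  rw [shiftedTime_re, abs_of_nonneg (by linarith [hη.1])]
  linarith [hη.2]

/-- The remainder is continuous up to `η = 0`, where its integral against a real function is purely
imaginary. The restriction `η ≤ 1/2` keeps `Re A` within the strip free of other zeros. -/
theorem tendsto_integral_vacuumRemainder (hg : Continuous g) (hgc : HasCompactSupport g) :
    Tendsto (fun η => (∫ q : ℝ × ℝ, ((g q.1 * g q.2 : ℝ) : ℂ) *
      vacuumRemainder (shiftedTime η (q.1 - q.2))).re) (𝓝[>] 0) (𝓝 0) := by
  let F : ℝ → ℝ × ℝ → ℂ := fun η q => ((g q.1 * g q.2 : ℝ) : ℂ) *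
      vacuumRemainder (shiftedTime η (q.1 - q.2))
  have hF : ContinuousOn (fun η => ∫ q, F η q) (Set.Icc 0 (1 / 2)) := by
    refine continuousOn_integral_of_compact_support (k := tsupport g ×ˢ tsupport g)
      (hgc.isCompact.prod hgc.isCompact) ?_ fun η q _ hq => ?_
    · intro r hr
      refine ContinuousAt.continuousWithinAt ?_
      simp only [Function.uncurry_def, F]
      refine ContinuousAt.mul (by fun_prop) ?_
      have h1 := continuousAt_vacuumRemainder (abs_shiftedTime_re_le hr.1 (r.2.1 - r.2.2))
      exact h1.comp (f := fun r : ℝ × ℝ × ℝ => shiftedTime r.1 (r.2.1 - r.2.2))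
        (continuous_shiftedTime continuous_fst (by fun_prop)).continuousAt
    · rw [Set.mem_prod, not_and_or] at hq
      rcases hq with h | h
      · simp [F, image_eq_zero_of_notMem_tsupport h]
      · simp [F, image_eq_zero_of_notMem_tsupport h]
  have h0 : (∫ q, F 0 q).re = 0 := by
    have hi : Integrable (F 0) := by
      refine integrable_mul_of_hasCompactSupport hg hgc hg hgc
        (k := fun q => vacuumRemainder (shiftedTime 0 (q.1 - q.2)))
        (continuous_iff_continuousAt.2 fun q => ?_)
      have h1 := continuousAt_vacuumRemainder
        (abs_shiftedTime_re_le (η := 0) ⟨le_rfl, by norm_num⟩ (q.1 - q.2))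
      exact h1.comp (f := fun q : ℝ × ℝ => shiftedTime 0 (q.1 - q.2))
        (continuous_shiftedTime continuous_const (by fun_prop)).continuousAt
    have h2 := Complex.reCLM.integral_comp_comm hi
    simp only [Complex.reCLM_apply] at h2
    rw [← h2]
    simp [F, vacuumRemainder_imaginary, -Complex.ofReal_mul]
  have h3 := (Complex.continuous_re.tendsto _).comp (hF 0 ⟨le_rfl, by norm_num⟩)
  rw [h0] at h3
  refine h3.mono_left ?_
  rw [nhdsWithin_le_iff]
  filter_upwards [Ioo_mem_nhdsGT (show (0 : ℝ) < 1 / 2 by norm_num)] with η hη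
  exact Set.Ioo_subset_Icc_self hη

/-- The Laurent expansion supplies the coefficients: `24/A⁵` becomes the pairing of `g''` with
`1/A`, and `4/A³` becomes twice that of `g'`. Each pairing with `1/A` contributes `π` times an `L²`
norm squared in the limit. -/
theorem tendsto_vacuum_integral (ξ : ℝ) (hg : ContDiff ℝ 2 g) (hgc : HasCompactSupport g) :
    Tendsto (fun η => (∫ q : ℝ × ℝ, ((g q.1 * g q.2 : ℝ) : ℂ) * (1 / shiftedTime η (q.1 - q.2) *
        (3 / 2 / (ξ ^ 4 * shiftedSinh η (q.1 - q.2) ^ 4)))).re) (𝓝[>] 0)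
      (𝓝 (1 / ξ ^ 4 * (Real.pi * (∫ u, deriv (deriv g) u ^ 2) +
        2 * (Real.pi * ∫ u, deriv g u ^ 2) + 11 / 30 * (Real.pi * ∫ u, g u ^ 2)))) := by
  have hg' : ContDiff ℝ 1 (deriv g) := by
    have : ContDiff ℝ (1 + 1) g := by
      rw [one_add_one_eq_two]
      exact hg
    exact (contDiff_succ_iff_deriv.1 this).2.2
  have h := ((((tendsto_powerPairing_one_re (hg'.continuous_deriv le_rfl) hgc.deriv.deriv).add
    ((tendsto_powerPairing_one_re hg'.continuous hgc.deriv).const_mul 2)).add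
    ((tendsto_powerPairing_one_re hg.continuous hgc).const_mul (11 / 30))).add
    (tendsto_integral_vacuumRemainder hg.continuous hgc)).const_mul (1 / ξ ^ 4)
  rw [add_zero] at h
  refine h.congr' ?_
  filter_upwards [Ioo_mem_nhdsGT (show (0 : ℝ) < 1 / 2 by norm_num)] with η hη
  have hP : ∀ n : ℕ, Integrable fun q : ℝ × ℝ =>
      ((g q.1 * g q.2 : ℝ) : ℂ) / shiftedTime η (q.1 - q.2) ^ n := fun n =>
    integrable_mul_of_hasCompactSupport hg.continuous hgc hg.continuous hgc
      (continuous_inv_shiftedTime_pow hη.1 n)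
  have hR : Integrable fun q : ℝ × ℝ => ((g q.1 * g q.2 : ℝ) : ℂ) *
      vacuumRemainder (shiftedTime η (q.1 - q.2)) := by
    refine integrable_mul_of_hasCompactSupport hg.continuous hgc hg.continuous hgc
      (k := fun q => vacuumRemainder (shiftedTime η (q.1 - q.2)))
      (continuous_iff_continuousAt.2 fun q => ?_)
    have h1 := continuousAt_vacuumRemainder
      (abs_shiftedTime_re_le (Set.Ioo_subset_Icc_self hη) (q.1 - q.2))
    exact h1.comp (f := fun q : ℝ × ℝ => shiftedTime η (q.1 - q.2))
      (continuous_shiftedTime continuous_const (by fun_prop)).continuousAt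
  have key : ∫ q : ℝ × ℝ, ((g q.1 * g q.2 : ℝ) : ℂ) * (1 / shiftedTime η (q.1 - q.2) *
        (3 / 2 / (ξ ^ 4 * shiftedSinh η (q.1 - q.2) ^ 4))) =
      ((1 / ξ ^ 4 : ℝ) : ℂ) * (24 * powerPairing η 5 g g + 4 * powerPairing η 3 g g +
        ((11 / 30 : ℝ) : ℂ) * powerPairing η 1 g g +
        ∫ q : ℝ × ℝ, ((g q.1 * g q.2 : ℝ) : ℂ) * vacuumRemainder (shiftedTime η (q.1 - q.2))) := by
    have i5 := (hP 5).const_mul 24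
    have i3 := (hP 3).const_mul 4
    have i1 := (hP 1).const_mul ((11 / 30 : ℝ) : ℂ)
    simp only [powerPairing]
    rw [← integral_const_mul, ← integral_const_mul, ← integral_const_mul, ← integral_add' i5 i3,
      ← integral_add' (i5.add i3) i1, ← integral_add' ((i5.add i3).add i1) hR, ← integral_const_mul]
    refine integral_congr_ae (Eventually.of_forall fun q => ?_)
    simp only [Pi.add_apply, vacuumRemainder, shiftedSinh_eq_sin]
    push_cast
    ring
  rw [key, powerPairing_five hη.1 hg hgc, show (4 : ℂ) * powerPairing η 3 g g =
    ((2 : ℝ) : ℂ) * (2 * powerPairing η 3 g g) by push_cast; ring,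
    powerPairing_three hη.1 (hg.of_le one_le_two) hgc]
  simp only [Complex.re_ofReal_mul, Complex.add_re]

/-- The quantum energy inequality in rapidity coordinates. -/
theorem neg_integral_rindlerForm_le {ω : State} {W : Spacetime × Spacetime → ℂ} {ξ : ℝ}
    (hξ : 0 < ξ) (hW : ω.IsSmoothRemainder W) (hg : ContDiff ℝ (⊤ : ℕ∞) g)
    (hgc : HasCompactSupport g) :
    -(∫ u, g u ^ 2 * rindlerForm ξ W u u) ≤ 1 / (8 * Real.pi ^ 2 * ξ ^ 4) *
      ((∫ u, deriv (deriv g) u ^ 2) + 2 * (∫ u, deriv g u ^ 2) + 11 / 30 * ∫ u, g u ^ 2) := by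
  set V := (∫ u, deriv (deriv g) u ^ 2) + 2 * (∫ u, deriv g u ^ 2) + 11 / 30 * ∫ u, g u ^ 2 with hV
  have hV0 : 0 ≤ V := by
    have h : ∀ f : ℝ → ℝ, 0 ≤ ∫ u, f u ^ 2 := fun f => integral_nonneg fun u => sq_nonneg _
    have := h g
    have := h (deriv g)
    have := h (deriv (deriv g))
    rw [hV]
    positivity
  have hD := continuous_modeDensity ξ hg.continuous hgc
  have hle : ∫⁻ p, ENNReal.ofReal (modeDensity ξ g 0 p) ∂modeMeasure ≤
      ENNReal.ofReal (Real.pi / ξ ^ 4 * V) := by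
    have hpt : ∀ p, liminf (fun η => ENNReal.ofReal (modeDensity ξ g η p)) (𝓝[>] 0) =
        ENNReal.ofReal (modeDensity ξ g 0 p) := fun p => by
      have h1 : Continuous fun η => ENNReal.ofReal (modeDensity ξ g η p) :=
        ENNReal.continuous_ofReal.comp
          (hD.comp (by fun_prop : Continuous fun η : ℝ => (η, p)))
      exact ((h1.tendsto 0).mono_left nhdsWithin_le_nhds).liminf_eq
    -- The damped density converges pointwise as `η → 0`; Fatou's lemma bounds the undamped integral
    -- by the limit of the damped ones, without a dominating function.
    have hfatou := lintegral_liminf_le (μ := modeMeasure) (u := 𝓝[>] (0 : ℝ))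
      (f := fun η p => ENNReal.ofReal (modeDensity ξ g η p)) fun η =>
        (hD.comp (by fun_prop : Continuous fun p : ℝ × ℝ × ℝ => (η, p))).measurable.ennreal_ofReal
    simp only [hpt] at hfatou
    refine hfatou.trans (le_of_eq (Tendsto.liminf_eq ?_))
    have hlim := (ENNReal.continuous_ofReal.tendsto _).comp
      (tendsto_vacuum_integral ξ (contDiff_infty.1 hg 2) hgc)
    rw [show 1 / ξ ^ 4 * (Real.pi * (∫ u, deriv (deriv g) u ^ 2) +
        2 * (Real.pi * ∫ u, deriv g u ^ 2) + 11 / 30 * (Real.pi * ∫ u, g u ^ 2)) =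
        Real.pi / ξ ^ 4 * V by rw [hV]; ring] at hlim
    refine hlim.congr' ?_
    filter_upwards [Ioo_mem_nhdsGT Real.pi_pos] with η hη
    rw [lintegral_modeDensity hξ hη.1 hη.2 hg.continuous hgc]
    rfl
  have h := (ofReal_neg_integral_rindlerForm_le (ξ := ξ) hW hg hgc).trans
    (mul_le_mul_right hle _)
  rw [← ENNReal.ofReal_mul (by positivity), ENNReal.ofReal_le_ofReal_iff (by positivity)] at h
  refine le_of_mul_le_mul_left ?_ Real.pi_pos
  rw [mul_neg]
  refine h.trans (le_of_eq ?_)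
  field_simp

end

section

/-! ### The energy density along the accelerated worldline -/

theorem eq_sum_smul_coordVec (v : Spacetime) : v = ∑ a, v a • coordVec a := by
  ext i
  simp [coordVec, Pi.single_apply]

theorem mixedForm_eq_sum (F : Spacetime × Spacetime → ℂ) (p : Spacetime × Spacetime)
    (v w : Spacetime) : mixedForm F p v w =
      ∑ a, ∑ b, ((v a * w b : ℝ) : ℂ) * mixedForm F p (coordVec a) (coordVec b) := by
  have h : ∀ v w, mixedForm F p v w =
      ((fderiv ℝ (fderiv ℝ F) p).comp (ContinuousLinearMap.inl ℝ Spacetime Spacetime)) v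
        (ContinuousLinearMap.inr ℝ Spacetime Spacetime w) := fun _ _ => rfl
  simp only [h]
  conv_lhs => rw [eq_sum_smul_coordVec v, eq_sum_smul_coordVec w]
  simp only [map_sum, map_smul, sum_apply, smul_apply,
    Finset.smul_sum]
  rw [Finset.sum_comm]
  refine Finset.sum_congr rfl fun a _ => Finset.sum_congr rfl fun b _ => ?_
  rw [smul_smul, Complex.real_smul, mul_comm (w b)]

theorem acceleratedWorldline_eq (ξ τ : ℝ) :
    acceleratedWorldline ξ τ = rindlerCurve ξ (τ / ξ) := rfl

theorem hasDerivAt_acceleratedWorldline {ξ : ℝ} (hξ : ξ ≠ 0) (τ : ℝ) :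
    HasDerivAt (acceleratedWorldline ξ) (rindlerFrame 0 (τ / ξ)) τ := by
  have h : HasDerivAt (fun τ => τ / ξ) (1 / ξ) τ := (hasDerivAt_id τ).div_const ξ
  rw [hasDerivAt_pi]
  intro i
  fin_cases i
  · refine (h.sinh.const_mul ξ).congr_deriv ?_
    simp [rindlerFrame]
    field_simp
  · refine (h.cosh.const_mul ξ).congr_deriv ?_
    simp [rindlerFrame]
    field_simp
  · exact hasDerivAt_const τ 0
  · exact hasDerivAt_const τ 0

/-- For a unit timelike `v` the trace term is `-1/2` of the metric trace. In an orthonormal frame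
containing `v` it halves the `v`-component and makes the spatial ones positive, giving half a sum of
diagonal terms, each accessible to the positivity argument. -/
theorem State.energyDensity_acceleratedWorldline (ω : State) (hω : ω.IsHadamard) {ξ : ℝ}
    (hξ : ξ ≠ 0) (τ : ℝ) : ω.energyDensity hω (acceleratedWorldline ξ) τ =
      1 / 2 * ∑ j, mixedForm (ω.normalOrdered hω)
        (rindlerCurve ξ (τ / ξ), rindlerCurve ξ (τ / ξ)) (rindlerFrame j (τ / ξ))
        (rindlerFrame j (τ / ξ)) := by
  have hW : ω.IsSmoothRemainder (ω.normalOrdered hω) := Classical.choose_spec hω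
  simp only [State.energyDensity, State.stressEnergy, mixedDeriv_eq_mixedForm hW.1,
    (hasDerivAt_acceleratedWorldline hξ τ).deriv, acceleratedWorldline_eq]
  simp only [mixedForm_eq_sum _ _ (rindlerFrame _ _)]
  generalize τ / ξ = u
  have hcs : (Real.cosh u : ℂ) ^ 2 = (Real.sinh u : ℂ) ^ 2 + 1 := by
    exact_mod_cast congrArg (fun r : ℝ => (r : ℂ)) (Real.cosh_sq u)
  generalize ((rindlerCurve ξ u, rindlerCurve ξ u) : Spacetime × Spacetime) = p
  obtain ⟨M, hM⟩ : ∃ M : Fin 4 → Fin 4 → ℂ, M = fun a b =>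
    mixedForm (ω.normalOrdered hω) p (coordVec a) (coordVec b) := ⟨_, rfl⟩
  have hM' : ∀ a b, mixedForm (ω.normalOrdered hω) p (coordVec a) (coordVec b) = M a b := by
    simp [hM]
  simp only [hM']
  simp [Fin.sum_univ_four, rindlerFrame, minkowskiMetric, -Complex.ofReal_cosh,
    -Complex.ofReal_sinh]
  linear_combination (1 / 2 * M 2 2 + 1 / 2 * M 3 3) * hcs

/-! ### Reality, rescaling to proper time and the long-time limit -/

section

variable {ω : State} {ξ : ℝ} {g : ℝ → ℝ}

theorem State.energyDensity_im (hω : ω.IsHadamard) (hξ : ξ ≠ 0) (τ : ℝ) :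
    (ω.energyDensity hω (acceleratedWorldline ξ) τ).im = 0 := by
  have hW : ω.IsSmoothRemainder (ω.normalOrdered hω) := Classical.choose_spec hω
  rw [ω.energyDensity_acceleratedWorldline hω hξ, show (1 / 2 : ℂ) = ((1 / 2 : ℝ) : ℂ) by simp,
    Complex.im_ofReal_mul, Complex.im_sum]
  simp only [mixedForm_im_eq_zero hW.1 hW.im_eq_zero, Finset.sum_const_zero, mul_zero]

theorem State.energyDensity_re (hω : ω.IsHadamard) (hξ : ξ ≠ 0) (τ : ℝ) :
    (ω.energyDensity hω (acceleratedWorldline ξ) τ).re =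
      1 / 2 * rindlerForm ξ (ω.normalOrdered hω) (τ / ξ) (τ / ξ) := by
  rw [ω.energyDensity_acceleratedWorldline hω hξ, show (1 / 2 : ℂ) = ((1 / 2 : ℝ) : ℂ) by simp,
    Complex.re_ofReal_mul, Complex.re_sum]
  rfl

theorem State.continuous_energyDensity_re (hω : ω.IsHadamard) (hξ : ξ ≠ 0) :
    Continuous fun τ => (ω.energyDensity hω (acceleratedWorldline ξ) τ).re := by
  have hW : ω.IsSmoothRemainder (ω.normalOrdered hω) := Classical.choose_spec hω
  simp only [State.energyDensity_re hω hξ]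
  exact continuous_const.mul (continuous_rindlerForm ξ hW.1 (by fun_prop) (by fun_prop))

theorem integral_eq_mul_integral_comp_mul (hξ : 0 < ξ) (F : ℝ → ℝ) :
    ∫ τ, F τ = ξ * ∫ u, F (ξ * u) := by
  rw [Measure.integral_comp_mul_left, abs_of_pos (inv_pos.2 hξ), smul_eq_mul,
    mul_inv_cancel_left₀ hξ.ne']

theorem deriv_comp_const_mul (c : ℝ) (f : ℝ → ℝ) :
    deriv (fun x => f (c * x)) = fun x => c * deriv f (c * x) :=
  funext fun x => deriv_comp_mul_left c f x

theorem deriv_deriv_comp_const_mul (c : ℝ) (f : ℝ → ℝ) :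
    deriv (deriv fun x => f (c * x)) = fun x => c ^ 2 * deriv (deriv f) (c * x) := by
  rw [deriv_comp_const_mul]
  funext x
  rw [deriv_const_mul_field, deriv_comp_const_mul]
  ring

theorem hasCompactSupport_comp_const_mul {c : ℝ} (hc : c ≠ 0) (hgc : HasCompactSupport g) :
    HasCompactSupport fun x => g (c * x) :=
  hgc.comp_homeomorph (Homeomorph.mulLeft₀ c hc)

/-- The quantum energy inequality along the accelerated worldline. -/
theorem State.le_integral_energyDensity (hω : ω.IsHadamard) (hξ : 0 < ξ)
    (hg : ContDiff ℝ (⊤ : ℕ∞) g) (hgc : HasCompactSupport g) :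
    -(1 / (16 * Real.pi ^ 2)) * ((∫ τ, deriv (deriv g) τ ^ 2) +
        2 * (1 / ξ) ^ 2 * (∫ τ, deriv g τ ^ 2) + 11 * (1 / ξ) ^ 4 / 30 * ∫ τ, g τ ^ 2) ≤
      ∫ τ, g τ ^ 2 * (ω.energyDensity hω (acceleratedWorldline ξ) τ).re := by
  have hW : ω.IsSmoothRemainder (ω.normalOrdered hω) := Classical.choose_spec hω
  -- The profile is dilated so that its value at rapidity `u` is that of `g` at proper time `ξu`;
  -- its derivatives acquire powers of `ξ` that combine with `1/ξ⁴`.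
  have h := neg_integral_rindlerForm_le hξ hW
    (g := fun u => g (ξ * u)) (hg.comp (contDiff_const.mul contDiff_id))
    (hasCompactSupport_comp_const_mul hξ.ne' hgc)
  rw [deriv_deriv_comp_const_mul, deriv_comp_const_mul] at h
  simp only [mul_pow, integral_const_mul] at h
  simp only [State.energyDensity_re hω hξ.ne']
  rw [integral_eq_mul_integral_comp_mul hξ fun τ => deriv (deriv g) τ ^ 2,
    integral_eq_mul_integral_comp_mul hξ fun τ => deriv g τ ^ 2,
    integral_eq_mul_integral_comp_mul hξ fun τ => g τ ^ 2,
    integral_eq_mul_integral_comp_mul hξ fun τ => g τ ^ 2 * _]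
  have e : ∀ u, g (ξ * u) ^ 2 * (1 / 2 * rindlerForm ξ (ω.normalOrdered hω) (ξ * u / ξ)
      (ξ * u / ξ)) = 1 / 2 * (g (ξ * u) ^ 2 * rindlerForm ξ (ω.normalOrdered hω) u u) := fun u => by
    rw [mul_div_cancel_left₀ u hξ.ne']
    ring
  simp only [e, integral_const_mul]
  -- The factor `ξ` is the Jacobian `dτ = ξ du`, and the `1/2` relates `rindlerForm` to the energy
  -- density.
  have h2 := mul_le_mul_of_nonneg_left h (show 0 ≤ ξ / 2 by positivity)
  refine le_trans (le_of_eq ?_) ((neg_le_neg h2).trans (le_of_eq ?_))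
  · field_simp
    ring
  · ring

/-- Since `11/480 = (1/16)(11/30)`, the added constant cancels the `g²` term of the inequality
exactly. Dilation by `T` scales the remaining two terms as `T⁻³` and `T⁻¹`. -/
theorem State.le_integral_energyDensity_add_const (hω : ω.IsHadamard) (hξ : 0 < ξ)
    (hg : ContDiff ℝ (⊤ : ℕ∞) g) (hgc : HasCompactSupport g) {T : ℝ} (hT : 0 < T) :
    -(1 / (16 * Real.pi ^ 2)) * (T⁻¹ ^ 3 * (∫ τ, deriv (deriv g) τ ^ 2) +
        2 * (1 / ξ) ^ 2 * (T⁻¹ * ∫ τ, deriv g τ ^ 2)) ≤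
      ∫ t, ((ω.energyDensity hω (acceleratedWorldline ξ) t).re +
        11 * (1 / ξ) ^ 4 / (480 * Real.pi ^ 2)) * |g (t / T)| ^ 2 := by
  have hT' : 0 < T⁻¹ := inv_pos.2 hT
  have hgT : ContDiff ℝ (⊤ : ℕ∞) fun t => g (T⁻¹ * t) :=
    hg.comp (contDiff_const.mul contDiff_id)
  have hgTc := hasCompactSupport_comp_const_mul hT'.ne' hgc
  have h := State.le_integral_energyDensity hω hξ hgT hgTc
  rw [deriv_deriv_comp_const_mul, deriv_comp_const_mul] at h
  simp only [mul_pow, integral_const_mul] at h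
  have hsq : HasCompactSupport fun t => g (T⁻¹ * t) ^ 2 :=
    hgTc.comp_left (g := fun r : ℝ => r ^ 2) (by simp)
  have hc : Continuous fun t => g (T⁻¹ * t) ^ 2 := hgT.continuous.pow 2
  have i1 : Integrable fun t =>
      g (T⁻¹ * t) ^ 2 * (ω.energyDensity hω (acceleratedWorldline ξ) t).re :=
    (hc.mul (State.continuous_energyDensity_re hω hξ.ne')).integrable_of_hasCompactSupport
      hsq.mul_right
  have i2 : Integrable fun t => 11 * (1 / ξ) ^ 4 / (480 * Real.pi ^ 2) * g (T⁻¹ * t) ^ 2 :=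
    (hc.integrable_of_hasCompactSupport hsq).const_mul _
  have e : ∫ t, ((ω.energyDensity hω (acceleratedWorldline ξ) t).re +
        11 * (1 / ξ) ^ 4 / (480 * Real.pi ^ 2)) * |g (t / T)| ^ 2 =
      (∫ t, g (T⁻¹ * t) ^ 2 * (ω.energyDensity hω (acceleratedWorldline ξ) t).re) +
        11 * (1 / ξ) ^ 4 / (480 * Real.pi ^ 2) * ∫ t, g (T⁻¹ * t) ^ 2 := by
    rw [← integral_const_mul, ← integral_add i1 i2]
    refine integral_congr_ae (Eventually.of_forall fun t => ?_)
    beta_reduce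
    rw [sq_abs, div_eq_inv_mul t T]
    ring
  rw [e, ← sub_le_iff_le_add]
  refine le_trans (le_of_eq ?_) h
  rw [integral_eq_mul_integral_comp_mul hT' fun τ => deriv (deriv g) τ ^ 2,
    integral_eq_mul_integral_comp_mul hT' fun τ => deriv g τ ^ 2]
  field_simp
  ring

/-- The lower bound is a polynomial in `1/T` without constant term. With values in `EReal` the
`liminf` requires no upper bound on the averages. -/
theorem State.zero_le_liminf_integral_energyDensity (hω : ω.IsHadamard) (hξ : 0 < ξ)
    (hg : ContDiff ℝ (⊤ : ℕ∞) g) (hgc : HasCompactSupport g) :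
    (0 : EReal) ≤ liminf (fun T : ℝ =>
      ((∫ t : ℝ, ((ω.energyDensity hω (acceleratedWorldline ξ) t).re +
        11 * (1 / ξ) ^ 4 / (480 * Real.pi ^ 2)) * |g (t / T)| ^ 2 : ℝ) : EReal)) atTop := by
  obtain ⟨c, hc⟩ : ∃ c : ℝ → ℝ, c = fun s => -(1 / (16 * Real.pi ^ 2)) *
    (s ^ 3 * (∫ τ, deriv (deriv g) τ ^ 2) + 2 * (1 / ξ) ^ 2 * (s * ∫ τ, deriv g τ ^ 2)) := ⟨_, rfl⟩
  have hcc : Continuous fun s => ((c s : ℝ) : EReal) :=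
    continuous_coe_real_ereal.comp (by rw [hc]; fun_prop)
  have hlim := (hcc.tendsto 0).comp (tendsto_inv_atTop_zero (𝕜 := ℝ))
  have h0 : ((c 0 : ℝ) : EReal) = 0 := by simp [hc]
  rw [h0] at hlim
  rw [← hlim.liminf_eq]
  refine liminf_le_liminf ?_
  filter_upwards [eventually_gt_atTop 0] with T hT
  rw [Function.comp_apply, EReal.coe_le_coe_iff, hc]
  exact State.le_integral_energyDensity_add_const hω hξ hg hgc hT

end

end

end ScalarQFT

end

/-! ### The main theorem -/

theorem mainTheorem3 (ξ₀ α₀ : ℝ) (hξ₀ : 0 < ξ₀) (hα₀ : α₀ = 1 / ξ₀)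
    (ω : ScalarQFT.State) (hω : ω.IsHadamard)
    (g : ℝ → ℝ) (hg : ContDiff ℝ (⊤ : ℕ∞) g) (hgc : HasCompactSupport g) :
    -- the energy density along the worldline is real-valued
    (∀ τ : ℝ, (ω.energyDensity hω (ScalarQFT.acceleratedWorldline ξ₀) τ).im = 0) ∧
    -- the quantum energy inequality
    (-(1 / (16 * Real.pi ^ 2)) *
        ∫ τ : ℝ, (|deriv (deriv g) τ| ^ 2 + 2 * α₀ ^ 2 * |deriv g τ| ^ 2 +
          11 * α₀ ^ 4 / 30 * |g τ| ^ 2) ≤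
      ∫ τ : ℝ, |g τ| ^ 2 *
        (ω.energyDensity hω (ScalarQFT.acceleratedWorldline ξ₀) τ).re) ∧
    -- the shifted averaged weak energy condition
    (0 : EReal) ≤ liminf (fun T : ℝ =>
      ((∫ t : ℝ, ((ω.energyDensity hω (ScalarQFT.acceleratedWorldline ξ₀) t).re +
        11 * α₀ ^ 4 / (480 * Real.pi ^ 2)) * |g (t / T)| ^ 2 : ℝ) : EReal)) atTop := by
  subst hα₀
  refine ⟨ScalarQFT.State.energyDensity_im hω hξ₀.ne', ?_,
    ScalarQFT.State.zero_le_liminf_integral_energyDensity hω hξ₀ hg hgc⟩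
  have hsq : ∀ f : ℝ → ℝ, Continuous f → HasCompactSupport f → Integrable fun t => f t ^ 2 :=
    fun f hf hfc => by
      have hc : HasCompactSupport fun t => f t ^ 2 :=
        hfc.comp_left (g := fun r : ℝ => r ^ 2) (by simp)
      have hcont : Continuous fun t => f t ^ 2 := hf.pow 2
      exact hcont.integrable_of_hasCompactSupport hc
  have hg1 : ContDiff ℝ (⊤ : ℕ∞) (deriv g) := (contDiff_infty_iff_deriv.1 hg).2
  have hg2 : ContDiff ℝ (⊤ : ℕ∞) (deriv (deriv g)) := (contDiff_infty_iff_deriv.1 hg1).2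
  have i2 := hsq _ hg2.continuous hgc.deriv.deriv
  have i1 := (hsq _ hg1.continuous hgc.deriv).const_mul (2 * (1 / ξ₀) ^ 2)
  have i0 := (hsq _ hg.continuous hgc).const_mul (11 * (1 / ξ₀) ^ 4 / 30)
  simp only [sq_abs]
  have e : ∫ τ : ℝ, (deriv (deriv g) τ ^ 2 + 2 * (1 / ξ₀) ^ 2 * deriv g τ ^ 2 +
      11 * (1 / ξ₀) ^ 4 / 30 * g τ ^ 2) = (∫ τ, deriv (deriv g) τ ^ 2) +
        2 * (1 / ξ₀) ^ 2 * (∫ τ, deriv g τ ^ 2) + 11 * (1 / ξ₀) ^ 4 / 30 * ∫ τ, g τ ^ 2 := by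
    rw [← integral_const_mul, ← integral_const_mul, ← integral_add' i2 i1, ← integral_add' (i2.add i1) i0]
    rfl
  rw [e]
  exact ScalarQFT.State.le_integral_energyDensity hω hξ₀ hg hgc
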